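/- Let $S^5\subset\mathbb{C}^3$ be the unit sphere. For $\theta\in\mathbb{R}$, a smooth immersion $u:\mathbb{R}^2\to S^5$, $(s,t)\mapsto u(s,t)$, is called \emph{$\theta$-special Legendrian} if, for one of the two orientations of $\mathbb{R}^2$, the $2$-form $\iota_X\,\mathrm{Re}(e^{i\theta}dz^1\wedge dz^2\wedge dz^3)$ ($X$ the Euler vector field) pulls back under $u$ to the area form of the induced metric; that is, for a constant sign $\varepsilon=\pm1$, $\mathrm{Re}\big(e^{i\theta}\det_{\mathbb{C}}(u,u_s,u_t)\big)=\varepsilon\sqrt{|u_s|^2|u_t|^2-\langle u_s,u_t\rangle^2}$. For $\varphi\in\mathbb{R}$ let $T_\varphi=\{z\in\mathbb{C}^3: |z_1|^2=|z_2|^2=|z_3|^2=1/3,\ \arg z_1+\arg z_2+\arg z_3\equiv\varphi \bmod 2\pi\}$ be the generalized Clifford torus. \textbf{Theorem.} For each $\theta$ there is a two-parameter family $u_{\alpha,J}$, $(\alpha,J)\in[0,1]\times[0,\tfrac{1}{3\sqrt3}]$, of conformal $\theta$-special Legendrian immersions $\mathbb{R}^2\to S^5$, in which $J$ is the angular momentum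 parameter: the components $x_j+iy_j$ of $u_{\alpha,J}$ satisfy $x_j\,\partial_t y_j-y_j\,\partial_t x_j=J\mu_j$ with $\mu=(-1-2\alpha,\,2+\alpha,\,\alpha-1)$. The family has the following properties. (i) $u_{\alpha,J}$ is invariant under the one-parameter subgroup of $\mathrm{SU}(3)$ generated by $A=i\,\mathrm{diag}(1,\alpha,-1-\alpha)$: $e^{\sigma A}u_{\alpha,J}(s,t)=u_{\alpha,J}(s+\sigma,t)$ for all $\sigma,s,t\in\mathbb{R}$. (ii) If $\alpha=1$ or $J=\tfrac1{3\sqrt3}$, then $u_{\alpha,J}(\mathbb{R}^2)$ is a Clifford torus, i.e. it equals $B(T_\varphi)$ for some $B\in\mathrm{SU}(3)$ and $\varphi\in\mathbb{R}$. Otherwise the immersions are geometrically distinct: if $\alpha\neq1$, $J\neq\tfrac1{3\sqrt3}$ and $(\alpha',J')\in[0,1]\times[0,\tfrac{1}{3\sqrt3}]$ is different from $(\alpha,J)$, then no isometry of $S^5$ carries $u_{\alpha,J}(\mathbb{R}^2)$ onto $u_{\alpha',J'}(\mathbb{R}^2)$. (iii) The family contains, up to reparametrization and unitary motions of determinant $\pm1$,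 every $\theta$-special Legendrian immersion of the form $w(s,t)=e^{As}z(t)$, $A\in\mathfrak{so}(6)$, which covers a torus (i.e. factors through a smooth covering of a $2$-torus by $\mathbb{R}^2$): for each such $w$ there are $(\alpha,J)\in[0,1]\times[0,\tfrac{1}{3\sqrt3}]$, a unitary $B\in\mathrm{U}(3)$ with $\det B=\pm1$, and a diffeomorphism $\phi$ of $\mathbb{R}^2$ such that $w=B\circ u_{\alpha,J}\circ\phi$. -/

import Mathlib

open scoped ContDiff

/-- The Hermitian space `ℂ³`; its unit sphere is `S⁵`. -/
abbrev C3 : Type := EuclideanSpace ℂ (Fin 3)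

/-- The partial derivative `u_s`. -/
noncomputable def partialS (u : ℝ × ℝ → C3) (p : ℝ × ℝ) : C3 := fderiv ℝ u p (1, 0)

/-- The partial derivative `u_t`. -/
noncomputable def partialT (u : ℝ × ℝ → C3) (p : ℝ × ℝ) : C3 := fderiv ℝ u p (0, 1)

/-- The `θ`-special Lagrangian calibration `Re (e^{iθ} dz¹ ∧ dz² ∧ dz³)` evaluated on `(a, b, c)`. -/
noncomputable def slagForm (θ : ℝ) (a b c : C3) : ℝ :=
  (Complex.exp (θ * Complex.I) *
    Matrix.det (Matrix.of ![fun j => a j, fun j => b j, fun j => c j])).re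

/-- The normal part of the calibration: its contraction with the Euler field, at the point `x`. -/
noncomputable def slagNormal (θ : ℝ) (x v w : C3) : ℝ := slagForm θ x v w

/-- The density of the induced area form with respect to `ds ∧ dt`. -/
noncomputable def areaDensity (u : ℝ × ℝ → C3) (p : ℝ × ℝ) : ℝ :=
  Real.sqrt (‖partialS u p‖ ^ 2 * ‖partialT u p‖ ^ 2 - (inner ℝ (partialS u p) (partialT u p)) ^ 2)

/-- `u` is a smooth immersion of the plane into `S⁵` which is `θ`-special Legendrian: for one of the
two orientations of the plane (the sign `ε`), the normal part of the `θ`-special Lagrangian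
calibration pulls back to the induced area form. -/
structure IsSpecialLegendrianImmersion (θ : ℝ) (u : ℝ × ℝ → C3) : Prop where
  smooth : ContDiff ℝ ∞ u
  mem_sphere : ∀ p, ‖u p‖ = 1
  immersion : ∀ p, Function.Injective (fderiv ℝ u p)
  calibrated : ∃ ε : ℝ, (ε = 1 ∨ ε = -1) ∧
    ∀ p, slagNormal θ (u p) (partialS u p) (partialT u p) = ε * areaDensity u p

/-- `u` is conformal for the standard metrics. -/
def IsConformalParam (u : ℝ × ℝ → C3) : Prop :=
  ∀ p, ‖partialS u p‖ = ‖partialT u p‖ ∧ inner ℝ (partialS u p) (partialT u p) = 0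

/-- The action of a complex matrix on `ℂ³`, as a real-linear map. -/
noncomputable def matAct (M : Matrix (Fin 3) (Fin 3) ℂ) : C3 →L[ℝ] C3 :=
  (Matrix.toEuclideanCLM (n := Fin 3) (𝕜 := ℂ) M).restrictScalars ℝ

/-- The generator `A = i diag(1, α, -1 - α) ∈ su(3)`. -/
noncomputable def generator (α : ℝ) : C3 →L[ℝ] C3 :=
  matAct (Matrix.diagonal ![Complex.I, Complex.I * α, Complex.I * (-1 - α)])

/-- The vector `μ = (1, 1, 1) × (1, α, -1 - α)`. -/
def momentVector (α : ℝ) : Fin 3 → ℝ := ![-1 - 2 * α, 2 + α, α - 1]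

/-- The angular momenta `x_j ∂_t y_j - y_j ∂_t x_j` of the components of `u` are the constants
`m j`. -/
def HasAngularMomenta (u : ℝ × ℝ → C3) (m : Fin 3 → ℝ) : Prop :=
  ∀ p j, (u p j).re * (partialT u p j).im - (u p j).im * (partialT u p j).re = m j

/-- `u` is invariant under the one-parameter group generated by `A`, which acts on the plane by
translations of `s`. -/
def IsInvariantUnder (A : C3 →L[ℝ] C3) (u : ℝ × ℝ → C3) : Prop :=
  ∀ σ s t : ℝ, NormedSpace.exp (σ • A) (u (s, t)) = u (s + σ, t)

/-- `u` has the form `u (s, t) = e^{As} z(t)` with `A ∈ so(6)`. -/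
def IsEquivariantForm (u : ℝ × ℝ → C3) : Prop :=
  ∃ A : C3 →L[ℝ] C3, (∀ x y, inner ℝ (A x) y = -inner ℝ x (A y)) ∧
    ∃ z : ℝ → C3, ∀ s t : ℝ, u (s, t) = NormedSpace.exp (s • A) (z t)

/-- A diffeomorphism of the plane. -/
def IsPlaneDiffeo (φ : ℝ × ℝ ≃ ℝ × ℝ) : Prop := ContDiff ℝ ∞ φ ∧ ContDiff ℝ ∞ φ.symm

/-- `u` covers a torus: it factors through a smooth covering of a torus by the plane, that is,
through `ψ⁻¹` followed by the projection `ℝ² → ℝ²/ℤ²`, for a diffeomorphism `ψ` of the plane.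
(Double periodicity with respect to a lattice is the case of a linear `ψ`.) -/
def CoversTorus (u : ℝ × ℝ → C3) : Prop :=
  ∃ ψ : ℝ × ℝ ≃ ℝ × ℝ, IsPlaneDiffeo ψ ∧
    ∀ (m n : ℤ) (x : ℝ × ℝ), u (ψ (x + ((m : ℝ), (n : ℝ)))) = u (ψ x)

/-- The generalized Clifford torus
`T_φ = {z : |z_j|² = 1/3, arg z₁ + arg z₂ + arg z₃ = φ mod 2π}`. -/
def cliffordTorus (φ : ℝ) : Set C3 :=
  {z | ∃ a : Fin 3 → ℝ, ∑ j, a j = φ ∧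
    ∀ j, z j = ((1 / Real.sqrt 3 : ℝ) : ℂ) * Complex.exp (a j * Complex.I)}

/-- The surfaces described by `u` and `v` are congruent: an isometry of `S⁵` (the restriction of an
element of `O(6)`) carries the image of `u` onto the image of `v`. -/
def AreCongruent (u v : ℝ × ℝ → C3) : Prop :=
  ∃ F : C3 ≃ₗᵢ[ℝ] C3, F '' Set.range u = Set.range v

/-- The upper end `1 / (3 √3)` of the interval of the parameter `J`. -/
noncomputable def maxJ : ℝ := 1 / (3 * Real.sqrt 3)

/-!
The cross product of `ℂ³`, composed with conjugation, turns a surface with the symmetry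
`A = i diag (1, α, -1 - α)` into an integral curve: if `z` is orthogonal to `A z`, the vector
`conj (z × A z)` is Hermitian orthogonal to `z` and `A z`, and a curve `Z` with this velocity, up
to sign, sweeps out a conformal special Legendrian surface `e^{As} Z(t)`. On the zero level of the
moment map of `e^{As}` one has `|z_j|² = 1/3 + μ_j v` for a single real coordinate `v`, and
`Re (z₁ z₂ z₃) = J` is conserved; the remaining invariant oscillates where the cubic
`∏ (1/3 + μ_j v)` is at least `J²`. For maximal `J` the coordinate `v` vanishes identically, which
is a Clifford torus; for `α = 1` a real rotation commuting with `e^{As}` carries the surface to one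
with `v = 0`.

The other surfaces are told apart by the real quadratic forms vanishing on them. Fourier expansion
along the orbits, combined with the motion of the profile, shows that these are the multiples of
the moment of `A`, so that a congruence determines the spectrum of the moment, hence `α`; the range
of `v`, and with it `J`, is then read off from the values of the gradient of that form. Only
`α = J = 0` admits further forms, because this surface spans a proper real subspace.

For a surface covering a torus, write a skew-adjoint `A` as a skew-Hermitian matrix plus a term
`x ↦ conj (k × x)`. The special Legendrian equations make the matrix traceless, and at a minimum of
`|A w|²`, which compactness provides, the second derivative transversally to the orbits excludes
`k ≠ 0`. Hence `A` is conjugate to a multiple of `i diag (1, α, -1 - α)`. Equality in the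
calibration inequality then makes the profile a reparametrized integral curve of the field above,
and completeness of the torus makes the reparametrization surjective.
-/

open scoped ComplexConjugate
open Complex (I normSq)

/-! ### Integral curves -/

section IntegralCurves

variable {E : Type*} [NormedAddCommGroup E]

theorem exists_forall_hasDerivAt_of_hasCompactSupport [NormedSpace ℝ E] [CompleteSpace E]
    {F : E → E} (hF : ContDiff ℝ 1 F) (hFs : HasCompactSupport F) (x₀ : E) :
    ∃ z : ℝ → E, z 0 = x₀ ∧ ∀ t, HasDerivAt z (F (z t)) t := by
  obtain ⟨K, hK⟩ := hF.lipschitzWith_of_hasCompactSupport hFs one_ne_zero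
  obtain ⟨C, hC⟩ := hFs.exists_bound_of_continuous hF.continuous
  have hlocal (x : E) : ∃ z : ℝ → E, z 0 = x ∧
      IsMIntegralCurveOn (I := modelWithCornersSelf ℝ E) z F (Set.Ioo (-1) 1) := by
    have hPL : IsPicardLindelof (fun _ => F) (⟨0, by simp⟩ : Set.Icc (-1 : ℝ) 1) x
        C.toNNReal 0 C.toNNReal K :=
      ⟨fun _ _ => hK.lipschitzOnWith, fun _ _ => continuousOn_const,
        fun _ _ y _ => (hC y).trans (Real.le_coe_toNNReal C), by simp⟩
    obtain ⟨z, hz₀, hz⟩ := hPL.exists_eq_forall_mem_Icc_hasDerivWithinAt₀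
    exact ⟨z, hz₀, fun t ht => ((hz t (Set.Ioo_subset_Icc_self ht)).mono
      Set.Ioo_subset_Icc_self).hasFDerivWithinAt.hasMFDerivWithinAt⟩
  obtain ⟨z, hz₀, hz⟩ := exists_isMIntegralCurve_of_isMIntegralCurveOn
    (contMDiff_vectorSpace_iff_contDiff.2 hF) one_pos hlocal x₀
  exact ⟨z, hz₀, fun t => hasDerivAt_iff_hasFDerivAt.2 (hasMFDerivAt_iff_hasFDerivAt.1 (hz t))⟩

theorem norm_eq_norm_of_forall_inner_eq_zero [InnerProductSpace ℝ E] {F : E → E}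
    (htan : ∀ x, inner ℝ x (F x) = 0) {z : ℝ → E} (hz : ∀ t, HasDerivAt z (F (z t)) t)
    (t t' : ℝ) : ‖z t‖ = ‖z t'‖ := by
  have hd (t : ℝ) : HasDerivAt (fun t => ‖z t‖ ^ 2) 0 t := by
    simpa [htan] using (hz t).norm_sq
  exact (sq_eq_sq₀ (norm_nonneg _) (norm_nonneg _)).1 <|
    is_const_of_deriv_eq_zero (fun t => (hd t).differentiableAt) (fun t => (hd t).deriv) t t'

theorem exists_forall_hasDerivAt_of_inner_eq_zero [InnerProductSpace ℝ E] [FiniteDimensional ℝ E]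
    {F : E → E} (hF : ContDiff ℝ 1 F) (htan : ∀ x, inner ℝ x (F x) = 0) (x₀ : E) :
    ∃ z : ℝ → E, z 0 = x₀ ∧ ∀ t, HasDerivAt z (F (z t)) t := by
  -- Cut `F` off outside a ball: the cut-off field is still tangent to the spheres around the
  -- origin, so its integral curve stays where the cut-off is `1`.
  let χ : ContDiffBump (0 : E) := ⟨‖x₀‖ + 1, ‖x₀‖ + 2, by positivity, by linarith⟩
  obtain ⟨z, hz₀, hz⟩ := exists_forall_hasDerivAt_of_hasCompactSupport (χ.contDiff.smul hF)
    χ.hasCompactSupport.smul_right x₀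
  refine ⟨z, hz₀, fun t => ?_⟩
  have hnorm : ‖z t‖ = ‖x₀‖ := by
    rw [← hz₀]
    exact norm_eq_norm_of_forall_inner_eq_zero (fun x => by simp [inner_smul_right, htan]) hz t 0
  have hχ : χ (z t) = 1 := χ.one_of_mem_closedBall (by simp [χ, hnorm])
  simpa [hχ] using hz t

theorem contDiff_of_forall_hasDerivAt [NormedSpace ℝ E] {F : E → E} (hF : ContDiff ℝ ∞ F)
    {z : ℝ → E} (hz : ∀ t, HasDerivAt z (F (z t)) t) : ContDiff ℝ ∞ z := by
  have hd : deriv z = F ∘ z := funext fun t => (hz t).deriv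
  rw [contDiff_infty]
  intro n
  induction n with
  | zero => exact contDiff_zero.2 (continuous_iff_continuousAt.2 fun t => (hz t).continuousAt)
  | succ n ih =>
    rw [Nat.cast_succ, contDiff_succ_iff_deriv, hd]
    exact ⟨fun t => (hz t).differentiableAt, by simp, (contDiff_infty.1 hF n).comp ih⟩

theorem lipschitzOnWith_smul_add_smul [NormedSpace ℝ E] {F : E → E} {K : NNReal} {s : Set E}
    (hF : LipschitzOnWith K F s) (A : E →L[ℝ] E) {b c B C : ℝ} (hb : ‖b‖ ≤ B) (hc : ‖c‖ ≤ C) :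
    LipschitzOnWith (B.toNNReal * ‖A‖₊ + C.toNNReal * K) (fun x => b • A x + c • F x) s := by
  have hb' : ‖b‖₊ ≤ B.toNNReal := NNReal.coe_le_coe.1 (hb.trans (Real.le_coe_toNNReal B))
  have hc' : ‖c‖₊ ≤ C.toNNReal := NNReal.coe_le_coe.1 (hc.trans (Real.le_coe_toNNReal C))
  have hA : LipschitzOnWith (‖b‖₊ * ‖A‖₊) (fun x => b • A x) s :=
    ((lipschitzWith_smul b).comp A.lipschitz).lipschitzOnWith
  exact (hA.add ((lipschitzWith_smul c).comp_lipschitzOnWith hF)).weaken (by gcongr)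

theorem eq_of_forall_hasDerivAt_smul_add_smul [NormedSpace ℝ E] [FiniteDimensional ℝ E] {F : E → E}
    (hF : ContDiff ℝ 1 F) (A : E →L[ℝ] E) {b c : ℝ → ℝ} (hb : Continuous b) (hc : Continuous c)
    {R : ℝ} {x y : ℝ → E} (hx : ∀ t, HasDerivAt x (b t • A (x t) + c t • F (x t)) t)
    (hxR : ∀ t, ‖x t‖ ≤ R) (hy : ∀ t, HasDerivAt y (b t • A (y t) + c t • F (y t)) t)
    (hyR : ∀ t, ‖y t‖ ≤ R) {t₀ : ℝ} (h : x t₀ = y t₀) : x = y := by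
  obtain ⟨K, hK⟩ : ∃ K, LipschitzOnWith K F (Metric.closedBall 0 R) :=
    hF.contDiffOn.exists_lipschitzOnWith one_ne_zero (convex_closedBall 0 R)
      (isCompact_closedBall 0 R)
  ext t
  obtain ⟨a, a', ht, ht₀⟩ : ∃ a a', t ∈ Set.Ioo a a' ∧ t₀ ∈ Set.Ioo a a' :=
    ⟨min t t₀ - 1, max t t₀ + 1, by grind, by grind⟩
  obtain ⟨B, hB⟩ := (isCompact_Icc (a := a) (b := a')).exists_bound_of_continuousOn hb.continuousOn
  obtain ⟨C, hC⟩ := (isCompact_Icc (a := a) (b := a')).exists_bound_of_continuousOn hc.continuousOn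
  exact ODE_solution_unique_of_mem_Ioo (v := fun r w => b r • A w + c r • F w) (s := fun _ => _)
    (fun r hr => lipschitzOnWith_smul_add_smul hK A (hB r (Set.Ioo_subset_Icc_self hr))
      (hC r (Set.Ioo_subset_Icc_self hr))) ht₀
    (fun r _ => ⟨hx r, mem_closedBall_zero_iff.2 (hxR r)⟩)
    (fun r _ => ⟨hy r, mem_closedBall_zero_iff.2 (hyR r)⟩) h ht

theorem hasDerivAt_exp_smul_apply [NormedSpace ℝ E] [CompleteSpace E] (A : E →L[ℝ] E) (x : E)
    (s : ℝ) :
    HasDerivAt (fun s : ℝ => NormedSpace.exp (s • A) x) (A (NormedSpace.exp (s • A) x)) s := by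
  simpa using (hasDerivAt_exp_smul_const' (𝕂 := ℝ) A s).clm_apply (hasDerivAt_const s x)

theorem exp_zero_smul_apply [NormedSpace ℝ E] (A : E →L[ℝ] E) (x : E) :
    NormedSpace.exp ((0 : ℝ) • A) x = x := by
  simp

theorem exp_smul_apply_eq_of_hasDerivAt [NormedSpace ℝ E] [CompleteSpace E] (A : E →L[ℝ] E)
    {x : ℝ → E} (hx : ∀ s, HasDerivAt x (A (x s)) s) (s : ℝ) :
    NormedSpace.exp (s • A) (x 0) = x s := by
  refine congrFun (ODE_solution_unique_univ (v := fun _ => A) (s := fun _ => Set.univ) (t₀ := 0)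
    (fun _ => A.lipschitz.lipschitzOnWith)
    (fun s => ⟨hasDerivAt_exp_smul_apply A (x 0) s, trivial⟩) (fun s => ⟨hx s, trivial⟩) ?_) s
  exact exp_zero_smul_apply A (x 0)

end IntegralCurves

/-! ### Coordinates on `ℂ³` -/

section Coordinates

theorem inner_eq_sum_re_im (x y : C3) :
    inner ℝ x y = ∑ j, ((x j).re * (y j).re + (x j).im * (y j).im) := by
  rw [PiLp.inner_apply]
  refine Finset.sum_congr rfl fun j _ => ?_
  rw [Complex.inner, Complex.mul_re, Complex.conj_re, Complex.conj_im]
  ring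

theorem norm_sq_eq_sum_normSq (x : C3) : ‖x‖ ^ 2 = ∑ j, normSq (x j) := by
  simp only [EuclideanSpace.norm_sq_eq, Complex.normSq_eq_norm_sq]

theorem norm_eq_one_iff_sum_normSq (x : C3) : ‖x‖ = 1 ↔ ∑ j, normSq (x j) = 1 := by
  rw [← norm_sq_eq_sum_normSq, pow_eq_one_iff_of_nonneg (norm_nonneg x) two_ne_zero]

theorem hasDerivAt_iff_forall_coord {z : ℝ → C3} {z' : C3} {t : ℝ} :
    HasDerivAt z z' t ↔ ∀ j, HasDerivAt (fun t => z t j) (z' j) t := by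
  simp only [hasDerivAt_iff_hasFDerivAt, ← hasFDerivWithinAt_univ]
  exact hasFDerivWithinAt_piLp 2

theorem hasDerivAt_re {f : ℝ → ℂ} {f' : ℂ} {t : ℝ} (h : HasDerivAt f f' t) :
    HasDerivAt (fun t => (f t).re) f'.re t :=
  Complex.reCLM.hasFDerivAt.comp_hasDerivAt t h

theorem hasDerivAt_im {f : ℝ → ℂ} {f' : ℂ} {t : ℝ} (h : HasDerivAt f f' t) :
    HasDerivAt (fun t => (f t).im) f'.im t :=
  Complex.imCLM.hasFDerivAt.comp_hasDerivAt t h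

theorem hasDerivAt_normSq {f : ℝ → ℂ} {f' : ℂ} {t : ℝ} (h : HasDerivAt f f' t) :
    HasDerivAt (fun t => normSq (f t)) (2 * (conj (f t) * f').re) t := by
  simpa only [Complex.normSq_eq_norm_sq, Complex.inner, mul_comm f'] using h.norm_sq

end Coordinates

/-! ### Partial derivatives -/

section PartialDerivatives

variable {u : ℝ × ℝ → C3}

theorem hasDerivAt_partialS (hu : Differentiable ℝ u) (s t : ℝ) :
    HasDerivAt (fun s => u (s, t)) (partialS u (s, t)) s :=
  (hu (s, t)).hasFDerivAt.comp_hasDerivAt s ((hasDerivAt_id s).prodMk (hasDerivAt_const s t))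

theorem hasDerivAt_partialT (hu : Differentiable ℝ u) (s t : ℝ) :
    HasDerivAt (fun t => u (s, t)) (partialT u (s, t)) t :=
  (hu (s, t)).hasFDerivAt.comp_hasDerivAt t ((hasDerivAt_const t s).prodMk (hasDerivAt_id t))

theorem fderiv_apply_eq_partial (u : ℝ × ℝ → C3) (p : ℝ × ℝ) (x y : ℝ) :
    fderiv ℝ u p (x, y) = x • partialS u p + y • partialT u p := by
  rw [partialS, partialT, ← map_smul, ← map_smul, ← map_add]
  simp

theorem fderiv_map (L : C3 →L[ℝ] C3) (hu : Differentiable ℝ u) (p : ℝ × ℝ) :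
    fderiv ℝ (fun p => L (u p)) p = L.comp (fderiv ℝ u p) :=
  (L.hasFDerivAt.comp p (hu p).hasFDerivAt).fderiv

theorem partialS_map (L : C3 →L[ℝ] C3) (hu : Differentiable ℝ u) (p : ℝ × ℝ) :
    partialS (fun p => L (u p)) p = L (partialS u p) := by
  rw [partialS, fderiv_map L hu, partialS, ContinuousLinearMap.comp_apply]

theorem partialT_map (L : C3 →L[ℝ] C3) (hu : Differentiable ℝ u) (p : ℝ × ℝ) :
    partialT (fun p => L (u p)) p = L (partialT u p) := by
  rw [partialT, fderiv_map L hu, partialT, ContinuousLinearMap.comp_apply]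

theorem IsSpecialLegendrianImmersion.differentiable {θ : ℝ}
    (hu : IsSpecialLegendrianImmersion θ u) : Differentiable ℝ u :=
  hu.smooth.differentiable (by simp)

end PartialDerivatives

/-! ### Unitary motions -/

section UnitaryMotions

theorem matAct_apply (M : Matrix (Fin 3) (Fin 3) ℂ) (z : C3) (j : Fin 3) :
    matAct M z j = ∑ k, M j k * z k := by
  simp [matAct, Matrix.ofLp_toEuclideanCLM, Matrix.mulVec, dotProduct]

theorem matAct_mul (B C : Matrix (Fin 3) (Fin 3) ℂ) (x : C3) :
    matAct (B * C) x = matAct B (matAct C x) := by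
  simp [matAct]

theorem matAct_one (x : C3) : matAct 1 x = x := by
  simp [matAct]

theorem matAct_smul_one (c : ℂ) (x : C3) : matAct (c • 1) x = c • x := by
  simp [matAct]

variable {B : Matrix (Fin 3) (Fin 3) ℂ}

theorem inner_matAct (hB : B ∈ Matrix.unitaryGroup (Fin 3) ℂ) (x y : C3) :
    inner ℝ (matAct B x) (matAct B y) = inner ℝ x y :=
  congrArg Complex.re <| ContinuousLinearMap.inner_map_map_of_mem_unitary
    (Unitary.map_mem (Matrix.toEuclideanCLM (n := Fin 3) (𝕜 := ℂ)) hB) x y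

theorem norm_matAct (hB : B ∈ Matrix.unitaryGroup (Fin 3) ℂ) (x : C3) : ‖matAct B x‖ = ‖x‖ :=
  ContinuousLinearMap.norm_map_of_mem_unitary
    (Unitary.map_mem (Matrix.toEuclideanCLM (n := Fin 3) (𝕜 := ℂ)) hB) x

theorem slagForm_matAct {θ θ' : ℝ}
    (hB : Complex.exp (θ' * I) * B.det = Complex.exp (θ * I)) (x y z : C3) :
    slagForm θ' (matAct B x) (matAct B y) (matAct B z) = slagForm θ x y z := by
  have h : Matrix.of ![fun j => matAct B x j, fun j => matAct B y j, fun j => matAct B z j] =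
      Matrix.of ![fun j => x j, fun j => y j, fun j => z j] * B.transpose := by
    ext i j
    fin_cases i <;> simp [matAct_apply, Matrix.mul_apply, mul_comm]
  rw [slagForm, slagForm, h, Matrix.det_mul, Matrix.det_transpose, ← hB]
  congr 1
  ring

theorem IsSpecialLegendrianImmersion.matAct {θ θ' : ℝ} {u : ℝ × ℝ → C3}
    (hu : IsSpecialLegendrianImmersion θ u) (hB : B ∈ Matrix.unitaryGroup (Fin 3) ℂ)
    (hdet : Complex.exp (θ' * I) * B.det = Complex.exp (θ * I)) :
    IsSpecialLegendrianImmersion θ' (fun p => matAct B (u p)) where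
  smooth := (_root_.matAct B).contDiff.comp hu.smooth
  mem_sphere p := by rw [norm_matAct hB, hu.mem_sphere]
  immersion p := by
    rw [fderiv_map _ hu.differentiable]
    exact ((AddMonoidHomClass.isometry_of_norm _ (norm_matAct hB)).injective).comp (hu.immersion p)
  calibrated := by
    obtain ⟨ε, hε, h⟩ := hu.calibrated
    refine ⟨ε, hε, fun p => ?_⟩
    rw [slagNormal, areaDensity, partialS_map _ hu.differentiable,
      partialT_map _ hu.differentiable, slagForm_matAct hdet, norm_matAct hB, norm_matAct hB,
      inner_matAct hB]
    exact h p

theorem IsConformalParam.matAct {u : ℝ × ℝ → C3} (hu : IsConformalParam u)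
    (hs : Differentiable ℝ u) (hB : B ∈ Matrix.unitaryGroup (Fin 3) ℂ) :
    IsConformalParam (fun p => matAct B (u p)) := by
  intro p
  rw [partialS_map _ hs, partialT_map _ hs, norm_matAct hB, norm_matAct hB,
    inner_matAct hB]
  exact hu p

end UnitaryMotions

/-! ### The one-parameter group and its commuting flow -/

section Flow

/-- The weights `(1, α, -1 - α)` of the one-parameter group generated by `generator α`. -/
def weight (α : ℝ) : Fin 3 → ℝ := ![1, α, -1 - α]

/-- The one-parameter group generated by `generator α`, see `exp_smul_generator`. -/
noncomputable def rotate (α s : ℝ) (z : C3) : C3 :=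
  WithLp.toLp 2 fun j => Complex.exp (I * (weight α j * s : ℝ)) * z j

/-- The conjugate cross product of `z` and `generator α z`, up to sign. Its integral curves are the
profiles of the conformal equivariant special Legendrian surfaces for `θ = 0`. -/
noncomputable def flowField (α : ℝ) (z : C3) : C3 :=
  WithLp.toLp 2 fun j => I * momentVector α j * conj (z (j + 1) * z (j + 2))

/-- The product of the three coordinates. Its real part is conserved by `flowField` and is the
parameter `J` of a profile. -/
noncomputable def coordProd (z : C3) : ℂ := z 0 * z 1 * z 2

@[simp] theorem rotate_apply (α s : ℝ) (z : C3) (j : Fin 3) :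
    rotate α s z j = Complex.exp (I * (weight α j * s : ℝ)) * z j := rfl

@[simp] theorem flowField_apply (α : ℝ) (z : C3) (j : Fin 3) :
    flowField α z j = I * momentVector α j * conj (z (j + 1) * z (j + 2)) := rfl

@[simp] theorem generator_apply (α : ℝ) (z : C3) (j : Fin 3) :
    generator α z j = I * weight α j * z j := by
  rw [generator, matAct_apply]
  fin_cases j <;> simp [Matrix.diagonal_apply, weight]

theorem sum_weight (α : ℝ) : ∑ j, weight α j = 0 := by
  simp [weight, Fin.sum_univ_three]

theorem sum_momentVector (α : ℝ) : ∑ j, momentVector α j = 0 := by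
  simp only [momentVector, Fin.sum_univ_three, Matrix.cons_val]
  ring

theorem sum_weight_mul_momentVector (α : ℝ) : ∑ j, weight α j * momentVector α j = 0 := by
  simp only [momentVector, weight, Fin.sum_univ_three, Matrix.cons_val]
  ring

theorem weight_eq_neg_add (α : ℝ) (j : Fin 3) :
    weight α j = -weight α (j + 1) - weight α (j + 2) := by
  have h := sum_weight α
  simp only [Fin.sum_univ_three] at h
  fin_cases j <;> simp only [Fin.zero_eta, Fin.mk_one, Fin.reduceFinMk, Fin.reduceAdd] <;> linarith

theorem momentVector_eq_weight_sub (α : ℝ) (j : Fin 3) :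
    momentVector α j = weight α (j + 2) - weight α (j + 1) := by
  fin_cases j <;> simp [momentVector, weight] <;> ring

theorem normSq_exp_I_mul (x : ℝ) : normSq (Complex.exp (I * x)) = 1 := by
  rw [Complex.normSq_eq_norm_sq, mul_comm, Complex.norm_exp_ofReal_mul_I, one_pow]

theorem conj_exp_I_mul (x : ℝ) : conj (Complex.exp (I * x)) = Complex.exp (-(I * x)) := by
  rw [← Complex.exp_conj]
  simp

theorem hasDerivAt_rotate (α : ℝ) (z : C3) (s : ℝ) :
    HasDerivAt (fun s => rotate α s z) (generator α (rotate α s z)) s := by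
  refine hasDerivAt_iff_forall_coord.2 fun j => ?_
  have hexp : HasDerivAt (fun s : ℝ => I * ((weight α j * s : ℝ) : ℂ)) (I * weight α j) s := by
    simpa using ((hasDerivAt_id s).const_mul (weight α j)).ofReal_comp.const_mul I
  refine (hexp.cexp.mul_const (z j)).congr_deriv ?_
  rw [generator_apply, rotate_apply]
  ring

@[simp] theorem rotate_zero (α : ℝ) (z : C3) : rotate α 0 z = z := by
  ext j
  simp

theorem exp_smul_generator (α s : ℝ) (z : C3) :
    NormedSpace.exp (s • generator α) z = rotate α s z := by
  simpa using exp_smul_apply_eq_of_hasDerivAt (generator α) (hasDerivAt_rotate α z) s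

theorem rotate_add (α s r : ℝ) (z : C3) : rotate α s (rotate α r z) = rotate α (r + s) z := by
  ext j
  simp only [rotate_apply, ← mul_assoc, ← Complex.exp_add]
  congr 2
  push_cast
  ring

theorem normSq_rotate (α s : ℝ) (z : C3) (j : Fin 3) : normSq (rotate α s z j) = normSq (z j) := by
  rw [rotate_apply, map_mul, normSq_exp_I_mul, one_mul]

theorem norm_rotate (α s : ℝ) (z : C3) : ‖rotate α s z‖ = ‖z‖ :=
  (sq_eq_sq₀ (norm_nonneg _) (norm_nonneg _)).1 <| by
    simp only [norm_sq_eq_sum_normSq, normSq_rotate]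

theorem coordProd_rotate (α s : ℝ) (z : C3) : coordProd (rotate α s z) = coordProd z := by
  have hsum := sum_weight α
  have hexp : Complex.exp (I * (weight α 0 * s : ℝ)) * Complex.exp (I * (weight α 1 * s : ℝ)) *
      Complex.exp (I * (weight α 2 * s : ℝ)) = 1 := by
    rw [← Complex.exp_add, ← Complex.exp_add, ← mul_add, ← mul_add, ← Complex.ofReal_add,
      ← Complex.ofReal_add, ← add_mul, ← add_mul, ← Fin.sum_univ_three, hsum]
    simp
  simp only [coordProd, rotate_apply]
  linear_combination (z 0 * z 1 * z 2) * hexp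

theorem flowField_rotate (α s : ℝ) (z : C3) :
    flowField α (rotate α s z) = rotate α s (flowField α z) := by
  ext j
  have hphase : weight α j * s = -(weight α (j + 1) * s) + -(weight α (j + 2) * s) := by
    rw [weight_eq_neg_add α j]
    ring
  simp only [flowField_apply, rotate_apply, map_mul, conj_exp_I_mul, hphase]
  push_cast
  rw [mul_add, Complex.exp_add, mul_neg, mul_neg]
  ring

theorem contDiff_coord (j : Fin 3) {n : WithTop ℕ∞} : ContDiff ℝ n (fun z : C3 => z j) :=
  contDiff_piLp_apply 2

theorem contDiff_flowField (α : ℝ) {n : WithTop ℕ∞} : ContDiff ℝ n (flowField α) :=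
  (contDiff_piLp 2).2 fun _ => contDiff_const.mul
    (Complex.conjCLE.contDiff.comp ((contDiff_coord _).mul (contDiff_coord _)))

theorem inner_flowField (α : ℝ) (z : C3) : inner ℝ z (flowField α z) = 0 := by
  have h := sum_momentVector α
  simp only [Fin.sum_univ_three] at h
  rw [inner_eq_sum_re_im]
  simp [Fin.sum_univ_three]
  linear_combination ((z 0).re * (z 1).re * (z 2).im + (z 0).re * (z 1).im * (z 2).re +
    (z 0).im * (z 1).re * (z 2).re - (z 0).im * (z 1).im * (z 2).im) * h

theorem inner_generator_flowField (α : ℝ) (x : C3) :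
    inner ℝ (generator α x) (flowField α x) = 0 := by
  have h := sum_weight_mul_momentVector α
  simp only [Fin.sum_univ_three] at h
  rw [inner_eq_sum_re_im]
  simp [Fin.sum_univ_three]
  linear_combination ((x 0).re * (x 1).re * (x 2).re - (x 0).re * (x 1).im * (x 2).im
    - (x 0).im * (x 1).re * (x 2).im - (x 0).im * (x 1).im * (x 2).re) * h

theorem norm_generator_sq (α : ℝ) (x : C3) :
    ‖generator α x‖ ^ 2 = ∑ j, weight α j ^ 2 * normSq (x j) := by
  rw [norm_sq_eq_sum_normSq]
  refine Finset.sum_congr rfl fun j _ => ?_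
  rw [generator_apply, map_mul, map_mul, Complex.normSq_I, Complex.normSq_ofReal]
  ring

theorem norm_flowField_sq (α : ℝ) (x : C3) : ‖flowField α x‖ ^ 2 =
    ∑ j, momentVector α j ^ 2 * (normSq (x (j + 1)) * normSq (x (j + 2))) := by
  rw [norm_sq_eq_sum_normSq]
  refine Finset.sum_congr rfl fun j _ => ?_
  rw [flowField_apply, map_mul, map_mul, Complex.normSq_I, Complex.normSq_ofReal,
    Complex.normSq_conj, map_mul]
  ring

theorem slagForm_generator_flowField (α : ℝ) (x : C3) :
    slagForm 0 x (generator α x) (flowField α x) = -‖flowField α x‖ ^ 2 := by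
  rw [slagForm, norm_flowField_sq, Matrix.det_fin_three]
  simp [Fin.sum_univ_three, momentVector_eq_weight_sub, Complex.normSq_apply]
  ring

end Flow

/-! ### The zero level of the moment map -/

section Level

variable {α : ℝ}

/-- The points of `S⁵` at which the moment map of the group `rotate α` vanishes. The orbit of such a
point is Legendrian, and the profiles stay in this set. -/
def zeroMoment (α : ℝ) : Set C3 := {z | ‖z‖ = 1 ∧ ∑ j, weight α j * normSq (z j) = 0}

/-- The coordinate `v` on `zeroMoment α` for which `|z_j|² = 1/3 + μ_j v`. -/
noncomputable def level (α : ℝ) (z : C3) : ℝ := (normSq (z 1) - 1 / 3) / (2 + α)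

/-- The cubic `∏ (1/3 + μ_j v)`, which is the value of `|z₁ z₂ z₃|²` at the level `v`. -/
noncomputable def levelCubic (α v : ℝ) : ℝ := ∏ j, (1 / 3 + momentVector α j * v)

theorem rotate_mem_zeroMoment {z : C3} (hz : z ∈ zeroMoment α) (s : ℝ) :
    rotate α s z ∈ zeroMoment α := by
  simpa only [zeroMoment, Set.mem_ofPred_eq, norm_rotate, normSq_rotate] using hz

theorem normSq_eq_of_mem_zeroMoment (hα : 0 ≤ α) {z : C3} (hz : z ∈ zeroMoment α) (j : Fin 3) :
    normSq (z j) = 1 / 3 + momentVector α j * level α z := by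
  have hne : 2 + α ≠ 0 := by positivity
  have h1 := (norm_eq_one_iff_sum_normSq z).1 hz.1
  have h0 := hz.2
  simp only [weight, Fin.sum_univ_three, Matrix.cons_val] at h1 h0
  have hl : (2 + α) * level α z = normSq (z 1) - 1 / 3 := mul_div_cancel₀ _ hne
  apply mul_left_cancel₀ hne
  fin_cases j <;>
    simp only [momentVector, Fin.zero_eta, Fin.mk_one, Fin.reduceFinMk, Matrix.cons_val]
  · linear_combination (1 + α) * h1 + h0 + (1 + 2 * α) * hl
  · linear_combination -(2 + α) * hl
  · linear_combination h1 - h0 + (1 - α) * hl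

theorem normSq_coordProd_of_mem_zeroMoment (hα : 0 ≤ α) {z : C3} (hz : z ∈ zeroMoment α) :
    normSq (coordProd z) = levelCubic α (level α z) := by
  simp only [coordProd, map_mul, normSq_eq_of_mem_zeroMoment hα hz, levelCubic,
    Fin.prod_univ_three]

theorem norm_generator_eq_norm_flowField {x : C3} (hx : x ∈ zeroMoment α) :
    ‖generator α x‖ = ‖flowField α x‖ := by
  have h1 := (norm_eq_one_iff_sum_normSq x).1 hx.1
  have h0 := hx.2
  refine (sq_eq_sq₀ (norm_nonneg _) (norm_nonneg _)).1 ?_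
  rw [norm_generator_sq, norm_flowField_sq]
  simp only [weight, momentVector, Fin.sum_univ_three, Fin.reduceAdd, Matrix.cons_val] at h1 h0 ⊢
  linear_combination -(normSq (x 0) + α ^ 2 * normSq (x 1) + (-1 - α) ^ 2 * normSq (x 2)) * h1
    + (normSq (x 0) + α * normSq (x 1) + (-1 - α) * normSq (x 2)) * h0

theorem levelCubic_eq (α v : ℝ) : levelCubic α v =
    1 / 27 - (1 + α + α ^ 2) * v ^ 2 + (1 + 2 * α) * (2 + α) * (1 - α) * v ^ 3 := by
  simp only [levelCubic, momentVector, Fin.prod_univ_three, Matrix.cons_val]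
  ring

@[simp] theorem levelCubic_zero (α : ℝ) : levelCubic α 0 = 1 / 27 := by
  rw [levelCubic_eq]
  ring

theorem continuous_levelCubic (α : ℝ) : Continuous (levelCubic α) := by
  unfold levelCubic
  fun_prop

theorem deriv_levelCubic (α v : ℝ) : deriv (levelCubic α) v =
    v * (3 * ((1 + 2 * α) * (2 + α) * (1 - α)) * v - 2 * (1 + α + α ^ 2)) := by
  rw [funext (levelCubic_eq α)]
  refine HasDerivAt.deriv ((((hasDerivAt_pow 2 v).const_mul _).const_sub _).add
    ((hasDerivAt_pow 3 v).const_mul _) |>.congr_deriv ?_)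
  push_cast
  ring

theorem strictMonoOn_levelCubic (hα : α ∈ Set.Icc (0 : ℝ) 1) :
    StrictMonoOn (levelCubic α) (Set.Iic 0) := by
  obtain ⟨h0, h1⟩ := hα
  intro v _ w (hw : w ≤ 0) hvw
  rw [levelCubic_eq, levelCubic_eq]
  have hquad : (1 + α + α ^ 2) * w ^ 2 < (1 + α + α ^ 2) * v ^ 2 :=
    mul_lt_mul_of_pos_left (by nlinarith) (by positivity)
  have hcubic : (1 + 2 * α) * (2 + α) * (1 - α) * v ^ 3 ≤
      (1 + 2 * α) * (2 + α) * (1 - α) * w ^ 3 :=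
    mul_le_mul_of_nonneg_left ((Odd.strictMono_pow (n := 3) (by decide)).monotone hvw.le)
      (mul_nonneg (by positivity) (by linarith))
  linarith

theorem maxJ_pos : 0 < maxJ := by
  unfold maxJ
  positivity

theorem maxJ_sq : maxJ ^ 2 = 1 / 27 := by
  rw [maxJ, div_pow, mul_pow, Real.sq_sqrt (by norm_num)]
  norm_num

theorem exists_levelCubic_eq {J : ℝ} (hα : α ∈ Set.Icc (0 : ℝ) 1)
    (hJ : J ∈ Set.Icc (0 : ℝ) maxJ) :
    ∃ v ≤ 0, (∀ j, 0 ≤ 1 / 3 + momentVector α j * v) ∧ levelCubic α v = J ^ 2 := by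
  have hα0 := hα.1
  have hm0 : -(1 / (3 * (2 + α))) ≤ 0 := neg_nonpos.2 (by positivity)
  have hμm : (2 + α) * -(1 / (3 * (2 + α))) = -(1 / 3) := by field_simp
  have hcubic : levelCubic α (-(1 / (3 * (2 + α)))) = 0 :=
    Finset.prod_eq_zero (Finset.mem_univ 1)
      (by simp only [momentVector, Matrix.cons_val, hμm, add_neg_cancel])
  have hmem : J ^ 2 ∈ Set.Icc (levelCubic α (-(1 / (3 * (2 + α))))) (levelCubic α 0) := by
    rw [hcubic, levelCubic_zero, ← maxJ_sq]
    exact ⟨sq_nonneg J, pow_le_pow_left₀ hJ.1 hJ.2 2⟩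
  obtain ⟨v, hv, hvJ⟩ := intermediate_value_Icc hm0 (continuous_levelCubic α).continuousOn hmem
  have hμv := mul_le_mul_of_nonneg_left hv.1 (show 0 ≤ 2 + α by positivity)
  refine ⟨v, hv.2, fun j => ?_, hvJ⟩
  fin_cases j <;>
    simp only [momentVector, Fin.zero_eta, Fin.mk_one, Fin.reduceFinMk, Matrix.cons_val]
  · nlinarith [hv.2]
  · linarith
  · nlinarith [hv.2, hα.2]

/-- The point with the nonnegative real coordinates `√(1/3 + μ_j v)`; it has level `v` as long as no
radicand is negative. -/
noncomputable def startPoint (α v : ℝ) : C3 :=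
  WithLp.toLp 2 fun j => (√(1 / 3 + momentVector α j * v) : ℂ)

@[simp] theorem startPoint_apply (α v : ℝ) (j : Fin 3) :
    startPoint α v j = (√(1 / 3 + momentVector α j * v) : ℂ) := rfl

section startPoint

variable {v : ℝ} (hv : ∀ j, 0 ≤ 1 / 3 + momentVector α j * v)
include hv

theorem normSq_startPoint (j : Fin 3) :
    normSq (startPoint α v j) = 1 / 3 + momentVector α j * v := by
  rw [startPoint_apply, Complex.normSq_ofReal, Real.mul_self_sqrt (hv j)]

theorem startPoint_mem_zeroMoment : startPoint α v ∈ zeroMoment α := by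
  have hμ := sum_momentVector α
  have hw := sum_weight α
  have hwμ := sum_weight_mul_momentVector α
  simp only [Fin.sum_univ_three] at hμ hw hwμ
  refine ⟨(norm_eq_one_iff_sum_normSq _).2 ?_, ?_⟩ <;>
    simp only [normSq_startPoint hv, Fin.sum_univ_three]
  · linear_combination v * hμ
  · linear_combination (1 / 3) * hw + v * hwμ

theorem level_startPoint (hα : 0 ≤ α) : level α (startPoint α v) = v := by
  have hne : 2 + α ≠ 0 := by positivity
  rw [level, normSq_startPoint hv, momentVector]
  simp only [Matrix.cons_val]
  field_simp
  ring

theorem coordProd_startPoint {J : ℝ} (hJ : 0 ≤ J) (hvJ : levelCubic α v = J ^ 2) :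
    coordProd (startPoint α v) = J := by
  simp only [coordProd, startPoint_apply]
  rw [← Complex.ofReal_mul, ← Complex.ofReal_mul, ← Real.sqrt_mul (hv 0),
    ← Real.sqrt_mul (mul_nonneg (hv 0) (hv 1)),
    ← Fin.prod_univ_three fun j => 1 / 3 + momentVector α j * v, ← levelCubic, hvJ, Real.sqrt_sq hJ]

end startPoint

end Level

/-! ### Flow curves and their conserved quantities -/

/-- The curves that move with velocity `b` along `generator α` and `c` along `flowField α`. -/
def IsFlowCurve (α : ℝ) (b c : ℝ → ℝ) (z : ℝ → C3) : Prop :=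
  ∀ t, HasDerivAt z (b t • generator α (z t) + c t • flowField α (z t)) t

namespace IsFlowCurve

variable {α : ℝ} {b c : ℝ → ℝ} {z : ℝ → C3}

theorem hasDerivAt_normSq (hz : IsFlowCurve α b c z) (j : Fin 3) (t : ℝ) :
    HasDerivAt (fun t => normSq (z t j))
      (2 * c t * momentVector α j * (coordProd (z t)).im) t := by
  refine (_root_.hasDerivAt_normSq (hasDerivAt_iff_forall_coord.1 (hz t) j)).congr_deriv ?_
  fin_cases j <;> simp [coordProd] <;> ring

theorem hasDerivAt_coordProd (hz : IsFlowCurve α b c z) (t : ℝ) :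
    HasDerivAt (fun t => coordProd (z t)) (I * ((c t * ∑ j, momentVector α j *
      (normSq (z t (j + 1)) * normSq (z t (j + 2))) : ℝ) : ℂ)) t := by
  have h := hasDerivAt_iff_forall_coord.1 (hz t)
  refine (((h 0).mul (h 1)).mul (h 2)).congr_deriv ?_
  simp [Fin.sum_univ_three, Complex.normSq_eq_conj_mul_self, weight_eq_neg_add α 2]
  ring

theorem sum_mul_normSq_eq (hz : IsFlowCurve α b c z) {m : Fin 3 → ℝ}
    (hm : ∑ j, m j * momentVector α j = 0) (t t' : ℝ) :
    ∑ j, m j * normSq (z t j) = ∑ j, m j * normSq (z t' j) := by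
  have hd (t : ℝ) : HasDerivAt (fun t => ∑ j, m j * normSq (z t j)) 0 t := by
    refine (HasDerivAt.fun_sum (u := Finset.univ) fun j _ =>
      (hz.hasDerivAt_normSq j t).const_mul (m j)).congr_deriv ?_
    calc ∑ j, m j * (2 * c t * momentVector α j * (coordProd (z t)).im)
        = 2 * c t * (coordProd (z t)).im * ∑ j, m j * momentVector α j := by
          rw [Finset.mul_sum]
          exact Finset.sum_congr rfl fun j _ => by ring
      _ = 0 := by rw [hm, mul_zero]
  exact is_const_of_deriv_eq_zero (fun t => (hd t).differentiableAt) (fun t => (hd t).deriv) t t'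

theorem coordProd_re_eq (hz : IsFlowCurve α b c z) (t t' : ℝ) :
    (coordProd (z t)).re = (coordProd (z t')).re := by
  have hd (t : ℝ) : HasDerivAt (fun t => (coordProd (z t)).re) 0 t :=
    (hasDerivAt_re (hz.hasDerivAt_coordProd t)).congr_deriv
      (by rw [Complex.I_mul_re, Complex.ofReal_im, neg_zero])
  exact is_const_of_deriv_eq_zero (fun t => (hd t).differentiableAt) (fun t => (hd t).deriv) t t'

theorem mem_zeroMoment (hz : IsFlowCurve α b c z) {t₀ : ℝ} (h : z t₀ ∈ zeroMoment α) (t : ℝ) :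
    z t ∈ zeroMoment α := by
  have h1 := hz.sum_mul_normSq_eq (m := fun _ => 1) (by simpa using sum_momentVector α) t t₀
  have h0 := hz.sum_mul_normSq_eq (sum_weight_mul_momentVector α) t t₀
  simp only [one_mul, ← norm_sq_eq_sum_normSq] at h1
  exact ⟨((sq_eq_sq₀ (norm_nonneg _) (norm_nonneg _)).1 h1).trans h.1, h0.trans h.2⟩

theorem hasDerivAt_level (hz : IsFlowCurve α b c z) (hα : 0 ≤ α) (t : ℝ) :
    HasDerivAt (fun t => level α (z t)) (2 * c t * (coordProd (z t)).im) t := by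
  have hne : 2 + α ≠ 0 := by positivity
  refine (((hz.hasDerivAt_normSq 1 t).sub_const (1 / 3)).div_const (2 + α)).congr_deriv ?_
  simp only [momentVector, Matrix.cons_val]
  field_simp

theorem hasDerivAt_coordProd_im (hz : IsFlowCurve α b c z) (hα : 0 ≤ α) {t : ℝ}
    (ht : z t ∈ zeroMoment α) :
    HasDerivAt (fun t => (coordProd (z t)).im) (c t * deriv (levelCubic α) (level α (z t))) t := by
  refine (hasDerivAt_im (hz.hasDerivAt_coordProd t)).congr_deriv ?_
  rw [Complex.I_mul_im, Complex.ofReal_re, deriv_levelCubic]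
  simp only [normSq_eq_of_mem_zeroMoment hα ht, Fin.sum_univ_three, momentVector, Fin.reduceAdd,
    Matrix.cons_val]
  ring

end IsFlowCurve

/-! ### Profiles -/

/-- `Z` is the profile of the equivariant conformal special Legendrian surface with parameters
`α`, `J` and `θ = 0`: the integral curve that starts at a point with minimal level. -/
structure IsProfile (α J : ℝ) (Z : ℝ → C3) : Prop where
  flow : ∀ t, HasDerivAt Z (flowField α (Z t)) t
  start : ∃ v ≤ 0, (∀ j, 0 ≤ 1 / 3 + momentVector α j * v) ∧ levelCubic α v = J ^ 2 ∧
    Z 0 = startPoint α v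

theorem exists_isProfile {α J : ℝ} (hα : α ∈ Set.Icc (0 : ℝ) 1) (hJ : J ∈ Set.Icc (0 : ℝ) maxJ) :
    ∃ Z, IsProfile α J Z := by
  obtain ⟨v, hv0, hv, hvJ⟩ := exists_levelCubic_eq hα hJ
  obtain ⟨Z, hZ0, hZ⟩ := exists_forall_hasDerivAt_of_inner_eq_zero (contDiff_flowField α)
    (inner_flowField α) (startPoint α v)
  exact ⟨Z, hZ, v, hv0, hv, hvJ, hZ0⟩

/-- A profile with parameters `α`, `J`; the junk value `0` when there is none. -/
noncomputable def profile (α J : ℝ) : ℝ → C3 :=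
  open Classical in if h : ∃ Z, IsProfile α J Z then h.choose else 0

theorem isProfile_profile {α J : ℝ} (hα : α ∈ Set.Icc (0 : ℝ) 1) (hJ : J ∈ Set.Icc (0 : ℝ) maxJ) :
    IsProfile α J (profile α J) := by
  have h := exists_isProfile hα hJ
  rw [profile, dif_pos h]
  exact h.choose_spec

/-- The surface swept out by a curve under the one-parameter group. -/
noncomputable def sweep (α : ℝ) (Z : ℝ → C3) (p : ℝ × ℝ) : C3 := rotate α p.1 (Z p.2)

theorem contDiff_sweep (α : ℝ) {Z : ℝ → C3} (hZ : ContDiff ℝ ∞ Z) : ContDiff ℝ ∞ (sweep α Z) :=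
  (contDiff_piLp 2).2 fun j =>
    (contDiff_const.mul (Complex.ofRealCLM.contDiff.comp
      (contDiff_const.mul contDiff_fst))).cexp.mul
        ((contDiff_coord j).comp (hZ.comp contDiff_snd))

namespace IsProfile

variable {α J : ℝ} {Z : ℝ → C3}

theorem isFlowCurve (h : IsProfile α J Z) : IsFlowCurve α (fun _ => 0) (fun _ => 1) Z := fun t => by
  simpa using h.flow t

theorem contDiff (h : IsProfile α J Z) : ContDiff ℝ ∞ Z :=
  contDiff_of_forall_hasDerivAt (contDiff_flowField α) h.flow

theorem mem_zeroMoment (h : IsProfile α J Z) (t : ℝ) : Z t ∈ zeroMoment α := by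
  obtain ⟨v, -, hv, -, hst⟩ := h.start
  exact h.isFlowCurve.mem_zeroMoment (hst ▸ startPoint_mem_zeroMoment hv) t

theorem norm_eq_one (h : IsProfile α J Z) (t : ℝ) : ‖Z t‖ = 1 := (h.mem_zeroMoment t).1

theorem normSq_eq (h : IsProfile α J Z) (hα : 0 ≤ α) (t : ℝ) (j : Fin 3) :
    normSq (Z t j) = 1 / 3 + momentVector α j * level α (Z t) :=
  normSq_eq_of_mem_zeroMoment hα (h.mem_zeroMoment t) j

theorem coordProd_zero (h : IsProfile α J Z) (hJ : 0 ≤ J) : coordProd (Z 0) = J := by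
  obtain ⟨v, -, hv, hvJ, hst⟩ := h.start
  rw [hst, coordProd_startPoint hv hJ hvJ]

theorem level_zero_nonpos (h : IsProfile α J Z) (hα : 0 ≤ α) : level α (Z 0) ≤ 0 := by
  obtain ⟨v, hv0, hv, -, hst⟩ := h.start
  rwa [hst, level_startPoint hv hα]

theorem levelCubic_level_zero (h : IsProfile α J Z) (hα : 0 ≤ α) :
    levelCubic α (level α (Z 0)) = J ^ 2 := by
  obtain ⟨v, -, hv, hvJ, hst⟩ := h.start
  rwa [hst, level_startPoint hv hα]

theorem eq_startPoint (h : IsProfile α J Z) (hα : 0 ≤ α) : Z 0 = startPoint α (level α (Z 0)) := by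
  obtain ⟨v, -, hv, -, hst⟩ := h.start
  rw [hst, level_startPoint hv hα]

theorem coordProd_re (h : IsProfile α J Z) (hJ : 0 ≤ J) (t : ℝ) : (coordProd (Z t)).re = J := by
  rw [h.isFlowCurve.coordProd_re_eq t 0, h.coordProd_zero hJ, Complex.ofReal_re]

theorem level_zero_le (h : IsProfile α J Z) (hα : α ∈ Set.Icc (0 : ℝ) 1) (hJ : 0 ≤ J) (t : ℝ) :
    level α (Z 0) ≤ level α (Z t) := by
  by_contra! hlt
  have hle := h.level_zero_nonpos hα.1
  have hlt' := strictMonoOn_levelCubic hα (hlt.le.trans hle) hle hlt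
  rw [h.levelCubic_level_zero hα.1, ← normSq_coordProd_of_mem_zeroMoment hα.1 (h.mem_zeroMoment t),
    Complex.normSq_apply, h.coordProd_re hJ] at hlt'
  nlinarith [mul_self_nonneg (coordProd (Z t)).im]

theorem hasDerivAt_level (h : IsProfile α J Z) (hα : 0 ≤ α) (t : ℝ) :
    HasDerivAt (fun t => level α (Z t)) (2 * (coordProd (Z t)).im) t := by
  simpa using h.isFlowCurve.hasDerivAt_level hα t

theorem hasDerivAt_coordProd_im (h : IsProfile α J Z) (hα : 0 ≤ α) (t : ℝ) :
    HasDerivAt (fun t => (coordProd (Z t)).im) (deriv (levelCubic α) (level α (Z t))) t := by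
  simpa using h.isFlowCurve.hasDerivAt_coordProd_im hα (h.mem_zeroMoment t)

theorem eq_of_hasDerivAt (h : IsProfile α J Z) {Y : ℝ → C3}
    (hY : ∀ t, HasDerivAt Y (flowField α (Y t)) t) {t₀ : ℝ} (h0 : Z t₀ = Y t₀) : Z = Y := by
  have hY1 (t : ℝ) : ‖Y t‖ ≤ 1 := by
    rw [norm_eq_norm_of_forall_inner_eq_zero (inner_flowField α) hY t t₀, ← h0, h.norm_eq_one]
  exact eq_of_forall_hasDerivAt_smul_add_smul (contDiff_flowField α) (generator α)
    continuous_const continuous_const h.isFlowCurve (fun t => (h.norm_eq_one t).le)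
    (fun t => by simpa using hY t) hY1 h0

theorem coord_zero_ne_zero (h : IsProfile α J Z) (hα : 0 ≤ α) : Z 0 0 ≠ 0 := by
  obtain ⟨v, hv0, hv, -, hst⟩ := h.start
  have hn : normSq (Z 0 0) = 1 / 3 + (-1 - 2 * α) * v := hst ▸ normSq_startPoint hv 0
  rw [← map_ne_zero normSq, hn]
  nlinarith

-- If the generator vanished at `Z t`, then `Z t` would be an equilibrium of the flow.
theorem generator_ne_zero (h : IsProfile α J Z) (hα : 0 ≤ α) (t : ℝ) : generator α (Z t) ≠ 0 := by
  intro hA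
  have hcoord (j : Fin 3) (hw : weight α j ≠ 0) : Z t j = 0 := by
    simpa [hw] using congrArg (fun z : C3 => z j) hA
  have h0 : Z t 0 = 0 := hcoord 0 (by simp [weight])
  have h2 : Z t 2 = 0 := hcoord 2 (by simp only [weight, Matrix.cons_val]; linarith)
  have hV : flowField α (Z t) = 0 := by
    ext j
    fin_cases j <;> simp [h0, h2]
  have hconst : Z = fun _ => Z t :=
    h.eq_of_hasDerivAt (t₀ := t) (fun r => by simpa [hV] using hasDerivAt_const r (Z t)) rfl
  exact h.coord_zero_ne_zero hα (by rw [hconst, h0])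

theorem contDiff_sweep (h : IsProfile α J Z) : ContDiff ℝ ∞ (sweep α Z) :=
  _root_.contDiff_sweep α h.contDiff

theorem differentiable_sweep (h : IsProfile α J Z) : Differentiable ℝ (sweep α Z) :=
  h.contDiff_sweep.differentiable (by simp)

theorem partialS_sweep (h : IsProfile α J Z) (p : ℝ × ℝ) :
    partialS (sweep α Z) p = generator α (sweep α Z p) :=
  (hasDerivAt_partialS h.differentiable_sweep p.1 p.2).unique (hasDerivAt_rotate α (Z p.2) p.1)

theorem partialT_sweep (h : IsProfile α J Z) (p : ℝ × ℝ) :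
    partialT (sweep α Z) p = flowField α (sweep α Z p) := by
  refine (hasDerivAt_partialT h.differentiable_sweep p.1 p.2).unique ?_
  rw [sweep, flowField_rotate]
  exact hasDerivAt_iff_forall_coord.2 fun j =>
    (hasDerivAt_iff_forall_coord.1 (h.flow p.2) j).const_mul
      (Complex.exp (I * (weight α j * p.1 : ℝ)))

theorem sweep_mem_zeroMoment (h : IsProfile α J Z) (p : ℝ × ℝ) : sweep α Z p ∈ zeroMoment α :=
  rotate_mem_zeroMoment (h.mem_zeroMoment p.2) p.1

theorem generator_sweep_ne_zero (h : IsProfile α J Z) (hα : 0 ≤ α) (p : ℝ × ℝ) :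
    generator α (sweep α Z p) ≠ 0 := by
  have hn : ‖generator α (sweep α Z p)‖ ^ 2 = ‖generator α (Z p.2)‖ ^ 2 := by
    simp only [norm_generator_sq, sweep, normSq_rotate]
  have hpos : 0 < ‖generator α (Z p.2)‖ := norm_pos_iff.2 (h.generator_ne_zero hα p.2)
  rw [← norm_ne_zero_iff, ← sq_eq_zero_iff.ne, hn]
  positivity

theorem isConformalParam (h : IsProfile α J Z) : IsConformalParam (sweep α Z) := by
  intro p
  rw [h.partialS_sweep, h.partialT_sweep]
  exact ⟨norm_generator_eq_norm_flowField (h.sweep_mem_zeroMoment p),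
    inner_generator_flowField _ _⟩

theorem isSpecialLegendrianImmersion (h : IsProfile α J Z) (hα : 0 ≤ α) :
    IsSpecialLegendrianImmersion 0 (sweep α Z) where
  smooth := h.contDiff_sweep
  mem_sphere p := (h.sweep_mem_zeroMoment p).1
  immersion p := by
    rw [injective_iff_map_eq_zero]
    rintro ⟨x, y⟩ hxy
    rw [fderiv_apply_eq_partial, h.partialS_sweep, h.partialT_sweep] at hxy
    have hA := h.generator_sweep_ne_zero hα p
    have hF : flowField α (sweep α Z p) ≠ 0 := by
      rwa [← norm_ne_zero_iff, ← norm_generator_eq_norm_flowField (h.sweep_mem_zeroMoment p),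
        norm_ne_zero_iff]
    have hli : LinearIndependent ℝ ![generator α (sweep α Z p), flowField α (sweep α Z p)] := by
      refine linearIndependent_of_ne_zero_of_inner_eq_zero ?_ ?_
      · simp [Fin.forall_fin_two, hA, hF]
      · simp [Pairwise, Fin.forall_fin_two, inner_generator_flowField,
          real_inner_comm (generator α _)]
    exact Prod.ext_iff.2 (LinearIndependent.pair_iff.1 hli x y hxy)
  calibrated := by
    refine ⟨-1, Or.inr rfl, fun p => ?_⟩
    have hsq (r : ℝ) : √(r ^ 2 * r ^ 2 - 0 ^ 2) = r ^ 2 := by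
      rw [zero_pow two_ne_zero, sub_zero, Real.sqrt_mul_self (sq_nonneg r)]
    rw [slagNormal, areaDensity, h.partialS_sweep, h.partialT_sweep, slagForm_generator_flowField,
      inner_generator_flowField, norm_generator_eq_norm_flowField (h.sweep_mem_zeroMoment p), hsq,
      neg_one_mul]

end IsProfile

/-! ### The family -/

section Family

/-- The phase `e^{-iθ/3}`, whose cube is `e^{-iθ}`. -/
noncomputable def phase (θ : ℝ) : ℂ := Complex.exp (I * ((-(θ / 3) : ℝ) : ℂ))

theorem phase_cube (θ : ℝ) : Complex.exp (θ * I) * phase θ ^ 3 = 1 := by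
  rw [phase, ← Complex.exp_nat_mul, ← Complex.exp_add, Complex.exp_eq_one_iff]
  refine ⟨0, ?_⟩
  push_cast
  ring

theorem conj_phase_mul (θ : ℝ) : conj (phase θ) * phase θ = 1 := by
  rw [← Complex.normSq_eq_conj_mul_self, phase, normSq_exp_I_mul, Complex.ofReal_one]

theorem smul_one_mem_unitaryGroup {c : ℂ} (hc : conj c * c = 1) :
    c • (1 : Matrix (Fin 3) (Fin 3) ℂ) ∈ Matrix.unitaryGroup (Fin 3) ℂ := by
  rw [Matrix.mem_unitaryGroup_iff', star_smul, star_one, Matrix.smul_mul, Matrix.mul_smul, mul_one,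
    smul_smul, RCLike.star_def, hc, one_smul]

theorem det_smul_one (c : ℂ) : (c • (1 : Matrix (Fin 3) (Fin 3) ℂ)).det = c ^ 3 := by
  simp

/-- The family of conformal equivariant `θ`-special Legendrian immersions: the surfaces swept out by
the profiles, turned by a phase that takes the calibration for `0` to the one for `θ`. -/
noncomputable def legendrianFamily (θ α J : ℝ) (p : ℝ × ℝ) : C3 :=
  matAct (phase θ • 1) (sweep α (profile α J) p)

theorem im_conj_mul_flowField (α : ℝ) (x : C3) (j : Fin 3) :
    (conj (x j) * flowField α x j).im = (coordProd x).re * momentVector α j := by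
  fin_cases j <;> simp [coordProd] <;> ring

variable (θ : ℝ) {α J : ℝ} (hα : α ∈ Set.Icc (0 : ℝ) 1) (hJ : J ∈ Set.Icc (0 : ℝ) maxJ)

theorem isInvariantUnder_legendrianFamily (α J : ℝ) :
    IsInvariantUnder (generator α) (legendrianFamily θ α J) := by
  intro σ s t
  rw [exp_smul_generator, legendrianFamily, legendrianFamily, matAct_smul_one, matAct_smul_one,
    sweep, sweep, ← rotate_add]
  ext j
  simp only [rotate_apply, PiLp.smul_apply, smul_eq_mul]
  ring

include hα hJ

theorem isSpecialLegendrianImmersion_legendrianFamily :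
    IsSpecialLegendrianImmersion θ (legendrianFamily θ α J) :=
  ((isProfile_profile hα hJ).isSpecialLegendrianImmersion hα.1).matAct
    (smul_one_mem_unitaryGroup (conj_phase_mul θ)) (by rw [det_smul_one, phase_cube]; simp)

theorem isConformalParam_legendrianFamily : IsConformalParam (legendrianFamily θ α J) :=
  (isProfile_profile hα hJ).isConformalParam.matAct (isProfile_profile hα hJ).differentiable_sweep
    (smul_one_mem_unitaryGroup (conj_phase_mul θ))

theorem hasAngularMomenta_legendrianFamily :
    HasAngularMomenta (legendrianFamily θ α J) (fun j => J * momentVector α j) := by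
  have h := isProfile_profile hα hJ
  have hre (p : ℝ × ℝ) : (coordProd (sweep α (profile α J) p)).re = J := by
    rw [sweep, coordProd_rotate, h.coordProd_re hJ.1]
  have him (x y : ℂ) : x.re * y.im - x.im * y.re = (conj x * y).im := by
    rw [Complex.mul_im, Complex.conj_re, Complex.conj_im]
    ring
  intro p j
  unfold legendrianFamily
  rw [partialT_map _ h.differentiable_sweep, h.partialT_sweep, matAct_smul_one, matAct_smul_one,
    him, PiLp.smul_apply, PiLp.smul_apply, smul_eq_mul, smul_eq_mul, map_mul, mul_mul_mul_comm,
    conj_phase_mul, one_mul, im_conj_mul_flowField, hre]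

end Family

/-! ### The Clifford tori of the family -/

section CliffordTorus

/-- The point of the Clifford torus with the arguments `a j`. -/
noncomputable def torusPoint (a : Fin 3 → ℝ) : C3 :=
  WithLp.toLp 2 fun j => ((1 / √3 : ℝ) : ℂ) * Complex.exp (a j * I)

@[simp] theorem torusPoint_apply (a : Fin 3 → ℝ) (j : Fin 3) :
    torusPoint a j = ((1 / √3 : ℝ) : ℂ) * Complex.exp (a j * I) := rfl

theorem mem_cliffordTorus_iff {φ : ℝ} {z : C3} :
    z ∈ cliffordTorus φ ↔ ∃ a, ∑ j, a j = φ ∧ torusPoint a = z := by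
  refine exists_congr fun a => and_congr_right fun _ => ?_
  simp only [PiLp.ext_iff, torusPoint_apply, eq_comm]

theorem hasDerivAt_torusPoint_smul (m : Fin 3 → ℝ) (t : ℝ) :
    HasDerivAt (fun t : ℝ => torusPoint (t • m))
      (WithLp.toLp 2 fun j => I * m j * torusPoint (t • m) j) t := by
  refine hasDerivAt_iff_forall_coord.2 fun j => ?_
  have hexp : HasDerivAt (fun t : ℝ => (((t • m) j : ℝ) : ℂ) * I) (m j * I) t := by
    simpa using ((hasDerivAt_id t).mul_const (m j)).ofReal_comp.mul_const I
  refine (hexp.cexp.const_mul _).congr_deriv ?_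
  simp only [torusPoint_apply]
  ring

theorem flowField_torusPoint (α : ℝ) {a : Fin 3 → ℝ} (ha : ∑ j, a j = 0) :
    flowField α (torusPoint a) =
      WithLp.toLp 2 fun j => I * (1 / √3 * momentVector α j : ℝ) * torusPoint a j := by
  ext j
  have hphase : (a j : ℂ) * I = -(a (j + 1) * I) + -(a (j + 2) * I) := by
    rw [Fin.sum_univ_three] at ha
    have ha' : a j = -a (j + 1) - a (j + 2) := by
      fin_cases j <;> simp only [Fin.zero_eta, Fin.mk_one, Fin.reduceFinMk, Fin.reduceAdd] <;>
        linarith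
    rw [ha']
    push_cast
    ring
  simp only [flowField_apply, torusPoint_apply, hphase, Complex.exp_add, map_mul,
    Complex.conj_ofReal, ← Complex.exp_conj, Complex.conj_I, Complex.ofReal_mul, mul_neg]
  ring

theorem rotate_torusPoint (α s : ℝ) (a : Fin 3 → ℝ) :
    rotate α s (torusPoint a) = torusPoint (a + s • weight α) := by
  ext j
  rw [rotate_apply, torusPoint_apply, torusPoint_apply, mul_left_comm, ← Complex.exp_add]
  congr 2
  simp only [Pi.add_apply, Pi.smul_apply, smul_eq_mul]
  push_cast
  ring

theorem exists_eq_smul_momentVector_add_smul_weight {α : ℝ} (hα : 0 ≤ α) {a : Fin 3 → ℝ}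
    (ha : ∑ j, a j = 0) : ∃ s t : ℝ, a = t • momentVector α + s • weight α := by
  have hE : 1 + α + α ^ 2 ≠ 0 := by positivity
  rw [Fin.sum_univ_three] at ha
  have ha2 : a 2 = -a 0 - a 1 := by linarith
  refine ⟨(a 0 + α * a 1 + (-1 - α) * a 2) / (2 * (1 + α + α ^ 2)),
    ((-1 - 2 * α) * a 0 + (2 + α) * a 1 + (α - 1) * a 2) / (6 * (1 + α + α ^ 2)), ?_⟩
  ext j
  fin_cases j <;> simp [weight, momentVector, ha2] <;> field_simp <;> ring

theorem image_phase_cliffordTorus (θ φ : ℝ) :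
    matAct (phase θ • 1) '' cliffordTorus φ = cliffordTorus (φ - θ) := by
  have hphase (a : Fin 3 → ℝ) :
      matAct (phase θ • 1) (torusPoint a) = torusPoint fun j => a j - θ / 3 := by
    ext j
    rw [matAct_smul_one, PiLp.smul_apply, torusPoint_apply, torusPoint_apply, phase, smul_eq_mul,
      mul_left_comm, ← Complex.exp_add]
    congr 2
    push_cast
    ring
  ext x
  simp only [Set.mem_image, mem_cliffordTorus_iff, Fin.sum_univ_three]
  constructor
  · rintro ⟨_, ⟨a, ha, rfl⟩, rfl⟩
    exact ⟨_, by linarith, (hphase a).symm⟩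
  · rintro ⟨a, ha, rfl⟩
    exact ⟨_, ⟨fun j => a j + θ / 3, by linarith, rfl⟩, by simp only [hphase, add_sub_cancel_right]⟩

namespace IsProfile

variable {α J : ℝ} {Z : ℝ → C3}

theorem apply_zero_of_maxJ (h : IsProfile α maxJ Z) (hα : α ∈ Set.Icc (0 : ℝ) 1) :
    Z 0 = torusPoint 0 := by
  have hv : level α (Z 0) = 0 :=
    (strictMonoOn_levelCubic hα).injOn (h.level_zero_nonpos hα.1) Set.self_mem_Iic
      (by rw [h.levelCubic_level_zero hα.1, levelCubic_zero, maxJ_sq])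
  ext j
  rw [h.eq_startPoint hα.1, hv]
  simp

theorem eq_torusPoint_of_maxJ (h : IsProfile α maxJ Z) (hα : α ∈ Set.Icc (0 : ℝ) 1) :
    Z = fun t => torusPoint (t • (1 / √3) • momentVector α) := by
  refine h.eq_of_hasDerivAt (t₀ := 0) (fun t => ?_) (by rw [h.apply_zero_of_maxJ hα, zero_smul])
  rw [flowField_torusPoint α]
  · exact hasDerivAt_torusPoint_smul _ t
  · simp only [Pi.smul_apply, smul_eq_mul, ← Finset.mul_sum, sum_momentVector, mul_zero]

theorem range_sweep_of_maxJ (h : IsProfile α maxJ Z) (hα : α ∈ Set.Icc (0 : ℝ) 1) :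
    Set.range (sweep α Z) = cliffordTorus 0 := by
  ext x
  simp only [Set.mem_range, Prod.exists, mem_cliffordTorus_iff, sweep, h.eq_torusPoint_of_maxJ hα,
    rotate_torusPoint]
  constructor
  · rintro ⟨s, t, rfl⟩
    refine ⟨_, ?_, rfl⟩
    simp only [Pi.add_apply, Pi.smul_apply, smul_eq_mul, Finset.sum_add_distrib, ← Finset.mul_sum,
      sum_momentVector, sum_weight, mul_zero, add_zero]
  · rintro ⟨a, ha, rfl⟩
    obtain ⟨s, t, rfl⟩ := exists_eq_smul_momentVector_add_smul_weight hα.1 ha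
    exact ⟨s, t * √3, by rw [smul_smul, mul_assoc, mul_one_div_cancel (by positivity), mul_one]⟩

end IsProfile

/-- The rotation in the first two coordinates with cosine `q` and sine `p`. It commutes with
`rotate 1` and `flowField 1`. -/
def planeRotation (p q : ℝ) : Matrix (Fin 3) (Fin 3) ℂ := !![(q : ℂ), p, 0; -p, q, 0; 0, 0, 1]

theorem planeRotation_mem {p q : ℝ} (hpq : p * p + q * q = 1) :
    planeRotation p q ∈ Matrix.specialUnitaryGroup (Fin 3) ℂ := by
  have hpqC : (p : ℂ) * p + q * q = 1 := by exact_mod_cast hpq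
  rw [Matrix.mem_specialUnitaryGroup_iff, Matrix.mem_unitaryGroup_iff]
  constructor
  · ext i j
    fin_cases i <;> fin_cases j <;>
      simp [planeRotation, Matrix.mul_apply, Fin.sum_univ_three, mul_comm, hpqC,
        (add_comm _ _).trans hpqC]
  · simp [planeRotation, Matrix.det_fin_three]
    linear_combination hpqC

theorem rotate_one_planeRotation (p q s : ℝ) (z : C3) :
    rotate 1 s (matAct (planeRotation p q) z) = matAct (planeRotation p q) (rotate 1 s z) := by
  ext j
  fin_cases j <;> simp [matAct_apply, Fin.sum_univ_three, planeRotation, weight] <;> ring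

theorem flowField_one_planeRotation (p q : ℝ) (z : C3) :
    flowField 1 (matAct (planeRotation p q) z) = matAct (planeRotation p q) (flowField 1 z) := by
  ext j
  fin_cases j <;>
    simp [matAct_apply, Fin.sum_univ_three, planeRotation, momentVector] <;> ring

namespace IsProfile

variable {J : ℝ} {Z : ℝ → C3}

theorem exists_planeRotation_of_one (h : IsProfile 1 J Z) :
    ∃ p q : ℝ, p * p + q * q = 1 ∧ Z 0 = matAct (planeRotation p q) (torusPoint 0) := by
  obtain ⟨v, -, hv, -, hst⟩ := h.start
  have hμ : momentVector 1 = ![-3, 3, 0] := by norm_num [momentVector]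
  have h0 := Real.mul_self_sqrt (hv 0)
  have h1 := Real.mul_self_sqrt (hv 1)
  have h3 : √3 * √3 = (3 : ℝ) := Real.mul_self_sqrt (by norm_num)
  have h3ne : ((√3 : ℝ) : ℂ) ≠ 0 := Complex.ofReal_ne_zero.2 (by positivity)
  refine ⟨√3 * (√(1 / 3 + momentVector 1 0 * v) - √(1 / 3 + momentVector 1 1 * v)) / 2,
    √3 * (√(1 / 3 + momentVector 1 0 * v) + √(1 / 3 + momentVector 1 1 * v)) / 2, ?_, ?_⟩
  · simp only [hμ, Matrix.cons_val] at h0 h1 ⊢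
    linear_combination ((√(1 / 3 + -3 * v) * √(1 / 3 + -3 * v) +
      √(1 / 3 + 3 * v) * √(1 / 3 + 3 * v)) / 2) * h3 + (3 / 2) * h0 + (3 / 2) * h1
  · rw [hst]
    ext j
    fin_cases j <;>
      simp [matAct_apply, Fin.sum_univ_three, planeRotation, hμ] <;> field_simp <;> ring

theorem range_sweep_of_one (h : IsProfile 1 J Z) :
    ∃ B ∈ Matrix.specialUnitaryGroup (Fin 3) ℂ,
      Set.range (sweep 1 Z) = matAct B '' cliffordTorus 0 := by
  have hα : (1 : ℝ) ∈ Set.Icc (0 : ℝ) 1 := ⟨zero_le_one, le_rfl⟩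
  have hW := isProfile_profile hα ⟨maxJ_pos.le, le_rfl⟩
  obtain ⟨p, q, hpq, hZ0⟩ := h.exists_planeRotation_of_one
  have hZ : Z = fun t => matAct (planeRotation p q) (profile 1 maxJ t) := by
    refine h.eq_of_hasDerivAt (t₀ := 0) (fun t => ?_) (by rw [hZ0, hW.apply_zero_of_maxJ hα])
    rw [flowField_one_planeRotation]
    exact (matAct _).hasFDerivAt.comp_hasDerivAt t (hW.flow t)
  refine ⟨planeRotation p q, planeRotation_mem hpq, ?_⟩
  rw [← hW.range_sweep_of_maxJ hα, ← Set.range_comp, hZ]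
  exact congrArg Set.range (funext fun r => rotate_one_planeRotation p q r.1 _)

end IsProfile

theorem exists_range_legendrianFamily_eq (θ : ℝ) {α J : ℝ} (hα : α ∈ Set.Icc (0 : ℝ) 1)
    (hJ : J ∈ Set.Icc (0 : ℝ) maxJ) (h : α = 1 ∨ J = maxJ) :
    ∃ φ : ℝ, ∃ B ∈ Matrix.specialUnitaryGroup (Fin 3) ℂ,
      Set.range (legendrianFamily θ α J) = matAct B '' cliffordTorus φ := by
  have hP := isProfile_profile hα hJ
  obtain ⟨B, hB, hr⟩ : ∃ B ∈ Matrix.specialUnitaryGroup (Fin 3) ℂ,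
      Set.range (sweep α (profile α J)) = matAct B '' cliffordTorus 0 := by
    rcases h with rfl | rfl
    · exact hP.range_sweep_of_one
    · exact ⟨1, one_mem _, by simp [hP.range_sweep_of_maxJ hα, matAct_one]⟩
  refine ⟨0 - θ, B, hB, ?_⟩
  calc Set.range (legendrianFamily θ α J)
      = matAct (phase θ • 1) '' Set.range (sweep α (profile α J)) := Set.range_comp _ _
    _ = matAct B '' (matAct (phase θ • 1) '' cliffordTorus 0) := by
      rw [hr, Set.image_image, Set.image_image]
      simp only [← matAct_mul, Matrix.smul_mul, Matrix.mul_smul, one_mul, mul_one]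
    _ = matAct B '' cliffordTorus (0 - θ) := by rw [image_phase_cliffordTorus]

end CliffordTorus

/-! ### Quadratic forms vanishing on the surfaces -/

/-- The self-adjoint operator of the quadratic form `∑ w_j |z_j|²`, the moment of `rotate α`. -/
noncomputable def momentOperator (α : ℝ) : C3 →L[ℝ] C3 :=
  matAct (Matrix.diagonal fun j => (weight α j : ℂ))

@[simp] theorem momentOperator_apply (α : ℝ) (x : C3) (j : Fin 3) :
    momentOperator α x j = weight α j * x j := by
  rw [momentOperator, matAct_apply]
  exact Matrix.mulVec_diagonal _ _ j

theorem isSymmetric_momentOperator (α : ℝ) :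
    (momentOperator α : C3 →ₗ[ℝ] C3).IsSymmetric := fun x y => by
  simp [inner_eq_sum_re_im, mul_assoc, mul_left_comm]

theorem inner_momentOperator_self (α : ℝ) (x : C3) :
    inner ℝ (momentOperator α x) x = ∑ j, weight α j * normSq (x j) := by
  simp [inner_eq_sum_re_im, Complex.normSq_apply, mul_add, mul_assoc]

theorem eq_of_isSymmetric_of_forall_inner_self_eq {E : Type*} [NormedAddCommGroup E]
    [InnerProductSpace ℝ E] {M N : E →L[ℝ] E} (hM : (M : E →ₗ[ℝ] E).IsSymmetric)
    (hN : (N : E →ₗ[ℝ] E).IsSymmetric) (h : ∀ x, inner ℝ (M x) x = inner ℝ (N x) x) : M = N := by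
  have hsub : (M : E →ₗ[ℝ] E) - N = 0 := by
    rw [← (hM.sub hN).inner_map_self_eq_zero]
    intro x
    rw [LinearMap.sub_apply, inner_sub_left]
    exact sub_eq_zero.2 (h x)
  exact ContinuousLinearMap.coe_injective (sub_eq_zero.1 hsub)

theorem exists_linear_add_antilinear (L : C3 →L[ℝ] C3) : ∃ H G : Matrix (Fin 3) (Fin 3) ℂ,
    ∀ x j, L x j = ∑ k, (H j k * x k + G j k * conj (x k)) := by
  refine ⟨fun j k => (L (EuclideanSpace.single k 1) j - I * L (EuclideanSpace.single k I) j) / 2,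
    fun j k => (L (EuclideanSpace.single k 1) j + I * L (EuclideanSpace.single k I) j) / 2,
    fun x j => ?_⟩
  have hx : x = ∑ k, ((x k).re • EuclideanSpace.single k (1 : ℂ) +
      (x k).im • EuclideanSpace.single k I) := by
    ext j
    fin_cases j <;> simp [Fin.sum_univ_three, Complex.re_add_im]
  conv_lhs => rw [hx]
  simp only [map_sum, map_add, map_smul, WithLp.ofLp_sum, Finset.sum_apply]
  refine Finset.sum_congr rfl fun k _ => ?_
  simp only [PiLp.add_apply, PiLp.smul_apply, Complex.real_smul, Complex.re_eq_add_conj,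
    Complex.im_eq_sub_conj]
  field_simp
  linear_combination (L (EuclideanSpace.single k I) j * (x k - conj (x k))) * Complex.I_sq

theorem linearIndependent_exp :
    LinearIndependent ℂ fun (r s : ℝ) => Complex.exp (I * (r * s : ℝ)) := by
  let χ (r : ℝ) : Multiplicative ℝ →* ℂ :=
    { toFun := fun s => Complex.exp (I * (r * s.toAdd : ℝ))
      map_one' := by simp
      map_mul' := fun s s' => by
        rw [← Complex.exp_add, ← mul_add, ← Complex.ofReal_add, ← mul_add, toAdd_mul] }
  have hχ : Function.Injective χ := fun r r' h => by
    have hd (r : ℝ) : HasDerivAt (fun s : ℝ => Complex.exp (I * (r * s : ℝ))) (I * r) 0 := by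
      simpa using ((((hasDerivAt_id (0 : ℝ)).const_mul r).ofReal_comp).const_mul I).cexp
    have hfun : (fun s : ℝ => Complex.exp (I * (r * s : ℝ))) =
        fun s => Complex.exp (I * (r' * s : ℝ)) :=
      funext fun s => DFunLike.congr_fun h (Multiplicative.ofAdd s)
    have hI := (hd r).unique (hfun ▸ hd r')
    exact Complex.ofReal_injective (mul_left_cancel₀ Complex.I_ne_zero hI)
  exact (linearIndependent_monoidHom (Multiplicative ℝ) ℂ).comp χ hχ

theorem sum_eq_zero_of_sum_mul_exp_eq_zero {ι : Type*} [Fintype ι] (w : ι → ℝ) (c : ι → ℂ)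
    (h : ∀ s : ℝ, ∑ i, c i * Complex.exp (I * (w i * s : ℝ)) = 0) (r : ℝ) :
    ∑ i with w i = r, c i = 0 := by
  classical
  by_cases hr : r ∈ Finset.univ.image w
  · refine linearIndependent_iff'.1 linearIndependent_exp (Finset.univ.image w)
      (fun r => ∑ i with w i = r, c i) (funext fun s => ?_) r hr
    rw [Pi.zero_apply, ← h s, Finset.sum_apply, ← Finset.sum_fiberwise_of_maps_to
      (fun i _ => Finset.mem_image_of_mem w (Finset.mem_univ i))]
    refine Finset.sum_congr rfl fun r _ => ?_
    rw [Pi.smul_apply, smul_eq_mul, Finset.sum_mul]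
    exact Finset.sum_congr rfl fun i hi => by rw [(Finset.mem_filter.1 hi).2]
  · rw [Finset.filter_eq_empty_iff.2, Finset.sum_empty]
    exact fun i _ hi => hr (Finset.mem_image.2 ⟨i, Finset.mem_univ i, hi⟩)

theorem sum_eq_zero_of_re_sum_mul_exp_eq_zero {ι : Type*} [Fintype ι] {w : ι → ℝ}
    (hw : ∀ i, 0 ≤ w i) {a : ℝ} {c : ι → ℂ}
    (h : ∀ s : ℝ, a + (∑ i, c i * Complex.exp (I * (w i * s : ℝ))).re = 0) :
    a + (∑ i with w i = 0, c i).re = 0 ∧ ∀ r > 0, ∑ i with w i = r, c i = 0 := by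
  have hsum (s : ℝ) : ∑ i : Unit ⊕ ι ⊕ ι,
      Sum.elim (fun _ => (2 * a : ℂ)) (Sum.elim c fun i => conj (c i)) i *
        Complex.exp (I * (Sum.elim (fun _ => 0) (Sum.elim w fun i => -w i) i * s : ℝ)) = 0 := by
    have hconj : ∑ i, conj (c i) * Complex.exp (I * (-w i * s : ℝ)) =
        conj (∑ i, c i * Complex.exp (I * (w i * s : ℝ))) := by
      rw [map_sum]
      refine Finset.sum_congr rfl fun i _ => ?_
      rw [map_mul, conj_exp_I_mul, neg_mul, Complex.ofReal_neg, mul_neg]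
    simp only [Fintype.sum_sum_type, Sum.elim_inl, Sum.elim_inr, hconj, Complex.add_conj,
      Finset.univ_unique, Finset.sum_singleton, zero_mul, Complex.ofReal_zero, mul_zero,
      Complex.exp_zero, mul_one]
    exact_mod_cast show 2 * a + 2 * _ = 0 by rw [← mul_add, h, mul_zero]
  have key (r : ℝ) : (if 0 = r then (2 * a : ℂ) else 0) + ((∑ i with w i = r, c i) +
      ∑ i with -w i = r, conj (c i)) = 0 := by
    have h := sum_eq_zero_of_sum_mul_exp_eq_zero _ _ hsum r
    simp only [Finset.sum_filter, Fintype.sum_sum_type, Sum.elim_inl, Sum.elim_inr,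
      Finset.univ_unique, Finset.sum_singleton] at h ⊢
    exact h
  refine ⟨?_, fun r hr => ?_⟩
  · have h0 := key 0
    simp only [if_true, neg_eq_zero, ← map_sum, Complex.add_conj] at h0
    have h0' : 2 * a + 2 * (∑ i with w i = 0, c i).re = 0 := by exact_mod_cast h0
    linarith
  · have hneg : ∑ i with -w i = r, conj (c i) = 0 := by
      rw [Finset.filter_eq_empty_iff.2 fun i _ hi => by linarith [hw i], Finset.sum_empty]
    simpa only [hr.ne, hneg, if_false, zero_add, add_zero] using key r

section Monomials

variable (α : ℝ)

/-- The off-diagonal real quadratic monomials on `ℂ³`. Conjugates are placed so that the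
frequencies `quadFreq` are nonnegative for `α ∈ [0, 1]`. -/
def quadMono (z : C3) : Fin 9 → ℂ :=
  ![z 0 * conj (z 1), z 0 * conj (z 2), z 1 * conj (z 2), z 0 * z 1, conj (z 0) * conj (z 2),
    conj (z 1) * conj (z 2), z 0 * z 0, z 1 * z 1, conj (z 2) * conj (z 2)]

/-- The pair of coordinates that enter a monomial of `quadMono`. -/
def quadPair : Fin 9 → Fin 3 × Fin 3 :=
  ![(0, 1), (0, 2), (1, 2), (0, 1), (0, 2), (1, 2), (0, 0), (1, 1), (2, 2)]

/-- The frequency of a monomial of `quadMono` along the orbits of `rotate α`. -/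
def quadFreq : Fin 9 → ℝ :=
  ![1 - α, 2 + α, 1 + 2 * α, 1 + α, α, 1, 2, 2 * α, 2 + 2 * α]

/-- Three times the slope at `v = 0` of the squared modulus of a monomial of `quadMono`, as a
function of the level `v`. -/
def quadSlope (i : Fin 9) : ℝ :=
  momentVector α (quadPair i).1 + momentVector α (quadPair i).2

theorem normSq_quadMono (z : C3) (i : Fin 9) :
    normSq (quadMono z i) = normSq (z (quadPair i).1) * normSq (z (quadPair i).2) := by
  fin_cases i <;> simp [quadMono, quadPair]

theorem quadMono_rotate (s : ℝ) (z : C3) (i : Fin 9) :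
    quadMono (rotate α s z) i = quadMono z i * Complex.exp (I * (quadFreq α i * s : ℝ)) := by
  have hmul (a b x y : ℂ) : Complex.exp a * x * (Complex.exp b * y) =
      x * y * Complex.exp (a + b) := by
    rw [Complex.exp_add]
    ring
  fin_cases i <;>
    simp only [quadMono, quadFreq, rotate_apply, map_mul, conj_exp_I_mul, hmul, Fin.reduceFinMk,
      Fin.isValue, Matrix.cons_val, Fin.zero_eta, Fin.mk_one] <;>
    congr 2 <;> simp [weight] <;> ring

theorem exists_inner_self_eq_sum_quadMono (M : C3 →L[ℝ] C3) : ∃ (m : Fin 3 → ℝ) (c : Fin 9 → ℂ),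
    ∀ x, inner ℝ (M x) x = ∑ j, m j * normSq (x j) + (∑ i, c i * quadMono x i).re := by
  obtain ⟨H, G, hM⟩ := exists_linear_add_antilinear M
  refine ⟨fun j => (H j j).re, ![H 1 0 + conj (H 0 1), H 2 0 + conj (H 0 2),
    H 2 1 + conj (H 1 2), conj (G 0 1 + G 1 0), G 0 2 + G 2 0, G 1 2 + G 2 1, conj (G 0 0),
    conj (G 1 1), G 2 2], fun x => ?_⟩
  simp only [inner_eq_sum_re_im, hM, Fin.sum_univ_three]
  simp [Fin.sum_univ_succ, quadMono, Complex.normSq_apply]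
  ring

theorem quadFreq_nonneg {α : ℝ} (hα : α ∈ Set.Icc (0 : ℝ) 1) (i : Fin 9) : 0 ≤ quadFreq α i := by
  obtain ⟨h0, h1⟩ := hα
  fin_cases i <;> simp [quadFreq] <;> linarith

theorem exists_sum_quadMono_of_forall_sweep {α : ℝ} (hα : α ∈ Set.Icc (0 : ℝ) 1) {Z : ℝ → C3}
    {M : C3 →L[ℝ] C3} (hq : ∀ p, inner ℝ (M (sweep α Z p)) (sweep α Z p) = 0) :
    ∃ (m : Fin 3 → ℝ) (c : Fin 9 → ℂ),
      (∀ x, inner ℝ (M x) x = ∑ j, m j * normSq (x j) + (∑ i, c i * quadMono x i).re) ∧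
      ∀ t, ∑ j, m j * normSq (Z t j) +
          (∑ i with quadFreq α i = 0, c i * quadMono (Z t) i).re = 0 ∧
        ∀ r > 0, ∑ i with quadFreq α i = r, c i * quadMono (Z t) i = 0 := by
  obtain ⟨m, c, hmc⟩ := exists_inner_self_eq_sum_quadMono M
  refine ⟨m, c, hmc, fun t => sum_eq_zero_of_re_sum_mul_exp_eq_zero (quadFreq_nonneg hα)
    fun s => .trans ?_ (hq (s, t))⟩
  simp only [hmc, sweep, normSq_rotate, quadMono_rotate, mul_assoc]

theorem quadFreq_pos {α : ℝ} (hα : α ∈ Set.Ioo (0 : ℝ) 1) (i : Fin 9) : 0 < quadFreq α i := by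
  obtain ⟨h0, h1⟩ := hα
  fin_cases i <;> simp [quadFreq] <;> linarith

-- Two frequencies coincide only for `α = 1/2` and `α = 1/3`, and then only in pairs.
theorem exists_quadFreq_resonance {α : ℝ} (hα : α ∈ Set.Ioo (0 : ℝ) 1) (i : Fin 9) :
    ∃ l, quadSlope α l ≠ quadSlope α i ∧ ∀ k, quadFreq α k = quadFreq α i → k = i ∨ k = l := by
  obtain ⟨h0, h1⟩ := hα
  by_cases h : α = 1 / 2
  · refine ⟨![4, 0, 6, 1, 0, 7, 2, 5, 0] i, fun hs => ?_, fun k hk => by_contra fun hkl => ?_⟩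
    · fin_cases i <;> simp [quadSlope, quadPair, momentVector] at hs <;> linarith
    · fin_cases i <;> fin_cases k <;> simp [quadFreq] at hk hkl <;> linarith
  · have h2 : 2 * α ≠ 1 := fun h' => h (by linarith)
    refine ⟨![7, 0, 6, 1, 0, 7, 2, 0, 0] i, fun hs => ?_, fun k hk => by_contra fun hkl => ?_⟩
    · fin_cases i <;> simp [quadSlope, quadPair, momentVector] at hs <;> linarith
    · fin_cases i <;> fin_cases k <;> simp [quadFreq] at hk hkl <;>
        first | linarith | exact h2 (by linarith)

end Monomials

theorem eq_zero_of_forall_mem_Icc_quadratic_eq_zero {a b c x₀ x₁ : ℝ} (hx : x₀ < x₁)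
    (h : ∀ x ∈ Set.Icc x₀ x₁, a + b * x + c * x ^ 2 = 0) : a = 0 ∧ b = 0 ∧ c = 0 := by
  let p : Polynomial ℝ := .C a + .C b * .X + .C c * .X ^ 2
  have hp : p = 0 := Polynomial.eq_zero_of_infinite_isRoot p <|
    (Set.Icc_infinite hx).mono fun x hx => by simpa [p] using h x hx
  exact ⟨by simpa [p] using congrArg (·.coeff 0) hp, by simpa [p] using congrArg (·.coeff 1) hp,
    by simpa [p, Polynomial.coeff_X] using congrArg (·.coeff 2) hp⟩

namespace IsProfile

variable {α J : ℝ} {Z : ℝ → C3} (h : IsProfile α J Z) (hα : α ∈ Set.Icc (0 : ℝ) 1)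
  (hJ : J ∈ Set.Ico (0 : ℝ) maxJ)

include h hα hJ

theorem level_zero_neg : level α (Z 0) < 0 := by
  refine (h.level_zero_nonpos hα.1).lt_of_ne fun h0 => hJ.2.ne ?_
  have hsq := h.levelCubic_level_zero hα.1
  rw [h0, levelCubic_zero, ← maxJ_sq] at hsq
  exact ((sq_eq_sq₀ maxJ_pos.le hJ.1).1 hsq).symm

theorem deriv_levelCubic_level_zero_pos : 0 < deriv (levelCubic α) (level α (Z 0)) := by
  have hv := h.level_zero_neg hα hJ
  have hD : 0 ≤ (1 + 2 * α) * (2 + α) * (1 - α) :=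
    mul_nonneg (mul_nonneg (by linarith [hα.1]) (by linarith [hα.1])) (by linarith [hα.2])
  rw [deriv_levelCubic]
  exact mul_pos_of_neg_of_neg hv (by nlinarith [hα.1, mul_nonneg hD (neg_nonneg.2 hv.le)])

theorem exists_level_ne : ∃ t, level α (Z t) ≠ level α (Z 0) := by
  by_contra! hconst
  have him (t : ℝ) : (coordProd (Z t)).im = 0 := by
    have hd := h.hasDerivAt_level hα.1 t
    rw [funext hconst] at hd
    simpa using hd.unique (hasDerivAt_const t _)
  have hd := h.hasDerivAt_coordProd_im hα.1 0
  rw [funext him] at hd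
  exact (h.deriv_levelCubic_level_zero_pos hα hJ).ne' (hd.unique (hasDerivAt_const 0 _))

theorem exists_Icc_subset_range_level :
    ∃ v > level α (Z 0), Set.Icc (level α (Z 0)) v ⊆ Set.range fun t => level α (Z t) := by
  obtain ⟨t₁, ht₁⟩ := h.exists_level_ne hα hJ
  have hcont : Continuous fun t => level α (Z t) :=
    continuous_iff_continuousAt.2 fun t => (h.hasDerivAt_level hα.1 t).continuousAt
  exact ⟨level α (Z t₁), (h.level_zero_le hα hJ.1 t₁).lt_of_ne ht₁.symm,
    intermediate_value_univ 0 t₁ hcont⟩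

theorem quadratic_level_eq_zero {a b c : ℝ}
    (hq : ∀ t, a + b * level α (Z t) + c * level α (Z t) ^ 2 = 0) : a = 0 ∧ b = 0 ∧ c = 0 := by
  obtain ⟨v, hv, hsub⟩ := h.exists_Icc_subset_range_level hα hJ
  refine eq_zero_of_forall_mem_Icc_quadratic_eq_zero hv fun x hx => ?_
  obtain ⟨t, rfl⟩ := hsub hx
  exact hq t

theorem exists_eq_smul_weight_of_sum_mul_normSq_eq_zero {m : Fin 3 → ℝ}
    (hm : ∀ t, ∑ j, m j * normSq (Z t j) = 0) : ∃ a : ℝ, m = a • weight α := by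
  obtain ⟨h0, h1, -⟩ := h.quadratic_level_eq_zero hα hJ (a := (∑ j, m j) / 3)
    (b := ∑ j, m j * momentVector α j) (c := 0) fun t => by
      have hmt := hm t
      simp only [h.normSq_eq hα.1, Fin.sum_univ_three] at hmt ⊢
      linear_combination hmt
  simp only [Fin.sum_univ_three, momentVector, Matrix.cons_val] at h0 h1
  refine ⟨m 0, funext fun j => ?_⟩
  fin_cases j <;> simp [weight]
  · linear_combination (1 - α) * h0 + (1 / 3) * h1
  · linear_combination (2 + α) * h0 - (1 / 3) * h1

-- Compare the squared moduli of the two terms, which are quadratic polynomials in the level.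
theorem eq_zero_of_add_quadMono_eq_zero {c d : ℂ} {i l : Fin 9}
    (hil : quadSlope α l ≠ quadSlope α i)
    (hcd : ∀ t, c * quadMono (Z t) i + d * quadMono (Z t) l = 0) : c = 0 := by
  obtain ⟨h0, h1, -⟩ := h.quadratic_level_eq_zero hα hJ (a := (normSq c - normSq d) / 9)
    (b := (normSq c * quadSlope α i - normSq d * quadSlope α l) / 3)
    (c := normSq c * (momentVector α (quadPair i).1 * momentVector α (quadPair i).2) -
      normSq d * (momentVector α (quadPair l).1 * momentVector α (quadPair l).2)) fun t => by
      have hn : normSq (c * quadMono (Z t) i) = normSq (d * quadMono (Z t) l) := by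
        rw [eq_neg_of_add_eq_zero_left (hcd t), Complex.normSq_neg]
      simp only [map_mul, normSq_quadMono, h.normSq_eq hα.1] at hn
      simp only [quadSlope]
      linear_combination hn
  have hc : normSq c * (quadSlope α i - quadSlope α l) = 0 := by
    linear_combination 3 * h1 - 9 * quadSlope α l * h0
  exact Complex.normSq_eq_zero.1 ((mul_eq_zero.1 hc).resolve_right (sub_ne_zero.2 hil.symm))

omit hα in
-- The Fourier expansion along the orbits separates the monomials, up to resonant pairs.
theorem exists_eq_smul_momentOperator_of_pos (hα : α ∈ Set.Ioo (0 : ℝ) 1) {M : C3 →L[ℝ] C3}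
    (hM : (M : C3 →ₗ[ℝ] C3).IsSymmetric)
    (hq : ∀ p, inner ℝ (M (sweep α Z p)) (sweep α Z p) = 0) :
    ∃ a : ℝ, M = a • momentOperator α := by
  have hα' := Set.Ioo_subset_Icc_self hα
  obtain ⟨m, c, hmc, hfourier⟩ := exists_sum_quadMono_of_forall_sweep hα' hq
  obtain ⟨a, rfl⟩ :=
    h.exists_eq_smul_weight_of_sum_mul_normSq_eq_zero hα' hJ fun t => by
      simpa [(quadFreq_pos hα _).ne'] using (hfourier t).1
  have hc (i : Fin 9) : c i = 0 := by
    obtain ⟨l, hl, hres⟩ := exists_quadFreq_resonance hα i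
    have hil : i ≠ l := fun h => hl (h ▸ rfl)
    refine h.eq_zero_of_add_quadMono_eq_zero hα' hJ hl
      (d := if quadFreq α l = quadFreq α i then c l else 0) fun t => ?_
    have hsum := (hfourier t).2 (quadFreq α i) (quadFreq_pos hα i)
    rw [Finset.sum_filter, Finset.sum_eq_add i l hil (fun k _ hk => if_neg fun hki =>
      (hres k hki).elim hk.1 hk.2) (by simp) (by simp), if_pos rfl] at hsum
    rwa [ite_mul, zero_mul]
  refine ⟨a, eq_of_isSymmetric_of_forall_inner_self_eq hM
    ((isSymmetric_momentOperator α).smul rfl) fun x => ?_⟩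
  rw [hmc]
  simp [hc, inner_smul_left, inner_momentOperator_self, Finset.mul_sum, mul_assoc]

end IsProfile

section Bilinear

variable {E E' F : Type*} [NormedAddCommGroup E] [NormedSpace ℝ E] [NormedAddCommGroup E']
  [NormedSpace ℝ E'] [NormedAddCommGroup F] [NormedSpace ℝ F] {x p : ℝ → E} {y q : ℝ → E'}
  {U : ℝ → ℝ} (hx : ∀ t, HasDerivAt x (p t) t) (hp : ∀ t, HasDerivAt p (U t • x t) t)
  (hy : ∀ t, HasDerivAt y (q t) t) (hq : ∀ t, HasDerivAt q ((U t - 1) • y t) t)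

theorem hasDerivAt_bilinear (B : E →L[ℝ] E' →L[ℝ] F) {x' : E} {y' : E'} {t : ℝ}
    (hx : HasDerivAt x x' t) (hy : HasDerivAt y y' t) :
    HasDerivAt (fun t => B (x t) (y t)) (B (x t) y' + B x' (y t)) t :=
  B.hasDerivAt_of_bilinear (fun _ => hx) fun _ => hy

theorem eq_zero_of_hasDerivAt_of_eq_zero {f : ℝ → F} {f' : F} {t : ℝ}
    (hf : HasDerivAt f f' t) (h : ∀ t, f t = 0) : f' = 0 := by
  rw [funext h] at hf
  exact hf.unique (hasDerivAt_const t 0)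

include hx hp hy hq

-- The potentials of `x` and `y` differ by a nonzero constant.
theorem bilinear_eq_zero_of_forall_apply_eq_zero {C : E →L[ℝ] E' →L[ℝ] F}
    (h : ∀ t, C (x t) (y t) = 0) (t : ℝ) :
    C (p t) (y t) = 0 ∧ C (x t) (q t) = 0 ∧ C (p t) (q t) = 0 := by
  have h1 (t : ℝ) : C (x t) (q t) + C (p t) (y t) = 0 :=
    eq_zero_of_hasDerivAt_of_eq_zero (hasDerivAt_bilinear C (hx t) (hy t)) h
  have h2 (t : ℝ) : C (p t) (q t) = 0 := by
    have hd := eq_zero_of_hasDerivAt_of_eq_zero ((hasDerivAt_bilinear C (hx t) (hq t)).add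
      (hasDerivAt_bilinear C (hp t) (hy t))) h1
    simp only [map_smul, smul_apply, h t, smul_zero, zero_add, add_zero] at hd
    rwa [← two_smul ℝ, smul_eq_zero_iff_right two_ne_zero] at hd
  have h3 : C (p t) (y t) = 0 := by
    have hd := eq_zero_of_hasDerivAt_of_eq_zero (hasDerivAt_bilinear C (hp t) (hq t)) h2
    simp only [map_smul, smul_apply] at hd
    linear_combination (norm := module) U t • h1 t - hd
  exact ⟨h3, by simpa [h3] using h1 t, h2 t⟩

theorem bilinear_eq_zero_of_forall_apply_self_add_eq_zero {B : E →L[ℝ] E →L[ℝ] F}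
    {B' : E' →L[ℝ] E' →L[ℝ] F} (hB : ∀ u v, B u v = B v u) (hB' : ∀ u v, B' u v = B' v u)
    (h : ∀ t, B (x t) (x t) + B' (y t) (y t) = 0) {t : ℝ} {U' : ℝ} (hU : HasDerivAt U U' t)
    (hU' : U' ≠ 0) :
    (B (x t) (x t) = 0 ∧ B (x t) (p t) = 0 ∧ B (p t) (p t) = 0) ∧
      B' (y t) (y t) = 0 ∧ B' (y t) (q t) = 0 ∧ B' (q t) (q t) = 0 := by
  have h1 (t : ℝ) : B (x t) (p t) + B' (y t) (q t) = 0 := by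
    have hd := eq_zero_of_hasDerivAt_of_eq_zero ((hasDerivAt_bilinear B (hx t) (hx t)).add
      (hasDerivAt_bilinear B' (hy t) (hy t))) h
    rw [hB (p t), hB' (q t)] at hd
    linear_combination (norm := module) (1 / 2 : ℝ) • hd
  have h2 (t : ℝ) : B (p t) (p t) + B' (q t) (q t) - B' (y t) (y t) = 0 := by
    have hd := eq_zero_of_hasDerivAt_of_eq_zero ((hasDerivAt_bilinear B (hx t) (hp t)).add
      (hasDerivAt_bilinear B' (hy t) (hq t))) h1
    simp only [map_smul] at hd
    linear_combination (norm := module) hd - U t • h t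
  have h3 (t : ℝ) : B' (y t) (q t) = 0 := by
    have hd := eq_zero_of_hasDerivAt_of_eq_zero (((hasDerivAt_bilinear B (hp t) (hp t)).add
      (hasDerivAt_bilinear B' (hq t) (hq t))).sub (hasDerivAt_bilinear B' (hy t) (hy t))) h2
    simp only [map_smul, smul_apply, hB (p t), hB' (q t)] at hd
    linear_combination (norm := module) (-1 / 4 : ℝ) • (hd - (2 * U t) • h1 t)
  have h4 (t : ℝ) : B' (q t) (q t) + (U t - 1) • B' (y t) (y t) = 0 := by
    have hd := eq_zero_of_hasDerivAt_of_eq_zero (hasDerivAt_bilinear B' (hy t) (hq t)) h3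
    rw [map_smul] at hd
    rw [add_comm]; exact hd
  have h5 : B' (y t) (y t) = 0 := by
    have hd := eq_zero_of_hasDerivAt_of_eq_zero ((hasDerivAt_bilinear B' (hq t) (hq t)).add
      ((hU.sub_const 1).smul (hasDerivAt_bilinear B' (hy t) (hy t)))) h4
    simp only [map_smul, smul_apply, hB' (q t), h3 t, smul_zero, zero_add,
      add_zero] at hd
    exact (smul_eq_zero_iff_right hU').1 hd
  have h6 : B' (q t) (q t) = 0 := by simpa [h5] using h4 t
  exact ⟨⟨by simpa [h5] using h t, by simpa [h3 t] using h1 t, by simpa [h5, h6] using h2 t⟩,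
    h5, h3 t, h6⟩

end Bilinear

/-- The real-bilinear form `a u v̄ + b ū v + c u v + d ū v̄` on `ℂ`; every real-bilinear form with
complex values is of this type. -/
noncomputable def mixedForm (a b c d : ℂ) : ℂ →L[ℝ] ℂ →L[ℝ] ℂ :=
  let m := ContinuousLinearMap.mul ℝ ℂ
  let id := ContinuousLinearMap.id ℝ ℂ
  let σ : ℂ →L[ℝ] ℂ := Complex.conjCLE
  a • m.bilinearComp id σ + b • m.bilinearComp σ id + c • m + d • m.bilinearComp σ σ

theorem mixedForm_apply (a b c d u v : ℂ) : mixedForm a b c d u v =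
    a * (u * conj v) + b * (conj u * v) + c * (u * v) + d * (conj u * conj v) := by
  simp [mixedForm]

theorem eq_zero_of_mixedForm_eq_zero {a b c d : ℂ} (h : mixedForm a b c d = 0) :
    a = 0 ∧ b = 0 ∧ c = 0 ∧ d = 0 := by
  have happ (u v : ℂ) : a * (u * conj v) + b * (conj u * v) + c * (u * v) +
      d * (conj u * conj v) = 0 := by
    rw [← mixedForm_apply, h]
    simp
  have h11 := happ 1 1
  have h1I := happ 1 I
  have hI1 := happ I 1
  have hII := happ I I
  simp only [map_one, Complex.conj_I] at h11 h1I hI1 hII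
  refine ⟨?_, ?_, ?_, ?_⟩
  · linear_combination (h11 + hII + I * (h1I - hI1) - (-3 * a + b + c + d) * Complex.I_sq) / 4
  · linear_combination (h11 + hII - I * (h1I - hI1) - (a - 3 * b + c + d) * Complex.I_sq) / 4
  · linear_combination (h11 - hII - I * (h1I + hI1) - (a + b - 3 * c + d) * Complex.I_sq) / 4
  · linear_combination (h11 - hII + I * (h1I + hI1) - (a + b + c - 3 * d) * Complex.I_sq) / 4

theorem eq_zero_of_im_conj_mul_ne_zero {F : Type*} [AddCommGroup F] [Module ℝ F]
    [TopologicalSpace F] {x p : ℂ} (h : (conj x * p).im ≠ 0) {L : ℂ →L[ℝ] F} (hx : L x = 0)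
    (hp : L p = 0) : L = 0 := by
  refine ContinuousLinearMap.ext fun w => (smul_eq_zero_iff_right h).1 ?_
  have hw : (conj x * p).im • w = (conj w * p).im • x + (conj x * w).im • p := by
    apply Complex.ext <;> simp <;> ring
  rw [← map_smul, hw, map_add, map_smul, map_smul, hx, hp, smul_zero, smul_zero, add_zero]

theorem bilinear_eq_zero_of_im_conj_mul_ne_zero {F : Type*} [NormedAddCommGroup F]
    [NormedSpace ℝ F] {x p y q : ℂ} (hxp : (conj x * p).im ≠ 0) (hyq : (conj y * q).im ≠ 0)
    {C : ℂ →L[ℝ] ℂ →L[ℝ] F} (hxy : C x y = 0) (hpy : C p y = 0) (hxq : C x q = 0)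
    (hpq : C p q = 0) : C = 0 :=
  eq_zero_of_im_conj_mul_ne_zero hxp (eq_zero_of_im_conj_mul_ne_zero hyq hxy hxq)
    (eq_zero_of_im_conj_mul_ne_zero hyq hpy hpq)

theorem filter_quadFreq_zero :
    ({i | quadFreq 0 i = 0} : Finset (Fin 9)) = {4, 7} ∧
    ({i | quadFreq 0 i = 1} : Finset (Fin 9)) = {0, 2, 3, 5} ∧
    ({i | quadFreq 0 i = 2} : Finset (Fin 9)) = {1, 6, 8} := by
  refine ⟨?_, ?_, ?_⟩ <;> ext i <;> fin_cases i <;> simp [quadFreq]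

namespace IsProfile

variable {α J : ℝ} {Z : ℝ → C3}

theorem hasDerivAt_flowField (h : IsProfile α J Z) (t : ℝ) (j : Fin 3) :
    HasDerivAt (fun t => flowField α (Z t) j) ((momentVector α j *
      (momentVector α (j + 1) * normSq (Z t (j + 2)) +
        momentVector α (j + 2) * normSq (Z t (j + 1)))) • Z t j) t := by
  have hd := hasDerivAt_iff_forall_coord.1 (h.flow t)
  refine (((hd (j + 1)).mul (hd (j + 2))).star.const_mul (I * momentVector α j)).congr_deriv ?_
  fin_cases j <;>
    simp [Complex.normSq_eq_conj_mul_self] <;> ring_nf <;> simp only [Complex.I_sq] <;> ring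

theorem coord_two_eq_coord_zero (h : IsProfile 0 J Z) (t : ℝ) : Z t 2 = Z t 0 := by
  let Y (t : ℝ) : C3 := WithLp.toLp 2 ![Z t 2, Z t 1, Z t 0]
  have hY (t : ℝ) : HasDerivAt Y (flowField 0 (Y t)) t := by
    have hd := hasDerivAt_iff_forall_coord.1 (h.flow t)
    refine hasDerivAt_iff_forall_coord.2 fun j => ?_
    fin_cases j
    · exact (hd 2).congr_deriv (by simp [Y, momentVector]; ring)
    · exact (hd 1).congr_deriv (by simp [Y, momentVector]; ring)
    · exact (hd 0).congr_deriv (by simp [Y, momentVector]; ring)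
  have h0 : Z 0 = Y 0 := by
    have hs := h.eq_startPoint le_rfl
    ext j
    fin_cases j <;> simp only [Y] <;> rw [hs] <;> simp [momentVector]
  exact congrArg (fun z : C3 => z 2) (congrFun (h.eq_of_hasDerivAt hY h0) t)

theorem exists_coordProd_im_ne_zero (h : IsProfile α J Z) (hα : α ∈ Set.Icc (0 : ℝ) 1)
    (hJ : J ∈ Set.Ico (0 : ℝ) maxJ) : ∃ t, (coordProd (Z t)).im ≠ 0 := by
  by_contra! him
  obtain ⟨t, ht⟩ := h.exists_level_ne hα hJ
  exact ht (is_const_of_deriv_eq_zero (fun t => (h.hasDerivAt_level hα.1 t).differentiableAt)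
    (fun t => by rw [(h.hasDerivAt_level hα.1 t).deriv, him, mul_zero]) t 0)

theorem im_conj_mul_flowField_ne_zero (h : IsProfile 0 J Z) (hJ : 0 < J) (t : ℝ) (j : Fin 3) :
    (conj (Z t j) * flowField 0 (Z t) j).im ≠ 0 := by
  rw [im_conj_mul_flowField, h.coordProd_re hJ.le]
  refine mul_ne_zero hJ.ne' ?_
  fin_cases j <;> simp [momentVector]

section Zero

variable (h : IsProfile 0 J Z)

include h

theorem hasDerivAt_flowField_zero (t : ℝ) :
    HasDerivAt (fun t => flowField 0 (Z t) 0) ((4 * level 0 (Z t) - 1 / 3) • Z t 0) t :=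
  (h.hasDerivAt_flowField t 0).congr_deriv <| by
    simp only [h.normSq_eq le_rfl]
    simp only [momentVector, Matrix.cons_val, Fin.isValue, Fin.reduceAdd]
    congr 1
    ring

theorem hasDerivAt_flowField_one (t : ℝ) :
    HasDerivAt (fun t => flowField 0 (Z t) 1) ((4 * level 0 (Z t) - 1 / 3 - 1) • Z t 1) t :=
  (h.hasDerivAt_flowField t 1).congr_deriv <| by
    simp only [h.normSq_eq le_rfl]
    simp only [momentVector, Matrix.cons_val, Fin.isValue, Fin.reduceAdd]
    congr 1
    ring

theorem mixedForm_coord_eq_zero (hJ : 0 < J) {a b c d : ℂ}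
    (hC : ∀ t, mixedForm a b c d (Z t 0) (Z t 1) = 0) : mixedForm a b c d = 0 := by
  have hd (j : Fin 3) (t : ℝ) := hasDerivAt_iff_forall_coord.1 (h.flow t) j
  obtain ⟨hpy, hxq, hpq⟩ := bilinear_eq_zero_of_forall_apply_eq_zero (hd 0)
    h.hasDerivAt_flowField_zero (hd 1) h.hasDerivAt_flowField_one hC 0
  exact bilinear_eq_zero_of_im_conj_mul_ne_zero (h.im_conj_mul_flowField_ne_zero hJ 0 0)
    (h.im_conj_mul_flowField_ne_zero hJ 0 1) (hC 0) hpy hxq hpq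

theorem mixedForm_coord_self_eq_zero (hJ : J ∈ Set.Ioo (0 : ℝ) maxJ) {a c d a' c' d' : ℂ}
    (hB : ∀ t, mixedForm a a c d (Z t 0) (Z t 0) + mixedForm a' a' c' d' (Z t 1) (Z t 1) = 0) :
    mixedForm a a c d = 0 ∧ mixedForm a' a' c' d' = 0 := by
  have hd (j : Fin 3) (t : ℝ) := hasDerivAt_iff_forall_coord.1 (h.flow t) j
  have hsymm (a c d u v : ℂ) : mixedForm a a c d u v = mixedForm a a c d v u := by
    simp only [mixedForm_apply]
    ring
  obtain ⟨t, ht⟩ := h.exists_coordProd_im_ne_zero ⟨le_rfl, zero_le_one⟩ ⟨hJ.1.le, hJ.2⟩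
  obtain ⟨⟨hxx, hxp, hpp⟩, hyy, hyq, hqq⟩ := bilinear_eq_zero_of_forall_apply_self_add_eq_zero
    (hd 0) h.hasDerivAt_flowField_zero (hd 1) h.hasDerivAt_flowField_one (hsymm a c d)
    (hsymm a' c' d') hB (((h.hasDerivAt_level le_rfl t).const_mul 4).sub_const (1 / 3))
    (mul_ne_zero four_ne_zero (mul_ne_zero two_ne_zero ht))
  have hx := h.im_conj_mul_flowField_ne_zero hJ.1 t 0
  have hy := h.im_conj_mul_flowField_ne_zero hJ.1 t 1
  exact ⟨bilinear_eq_zero_of_im_conj_mul_ne_zero hx hx hxx ((hsymm ..).trans hxp) hxp hpp,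
    bilinear_eq_zero_of_im_conj_mul_ne_zero hy hy hyy ((hsymm ..).trans hyq) hyq hqq⟩

theorem exists_eq_smul_momentOperator_of_zero (hJ : J ∈ Set.Ioo (0 : ℝ) maxJ) {M : C3 →L[ℝ] C3}
    (hM : (M : C3 →ₗ[ℝ] C3).IsSymmetric)
    (hq : ∀ p, inner ℝ (M (sweep 0 Z p)) (sweep 0 Z p) = 0) :
    ∃ a : ℝ, M = a • momentOperator 0 := by
  obtain ⟨m, c, hmc, hfourier⟩ :=
    exists_sum_quadMono_of_forall_sweep (Set.left_mem_Icc.2 zero_le_one) hq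
  obtain ⟨hfilter_zero, hfilter_one, hfilter_two⟩ := filter_quadFreq_zero
  have hfreq_one : mixedForm (c 0) (c 2) (c 3) (c 5) = 0 := by
    refine h.mixedForm_coord_eq_zero hJ.1 fun t => ?_
    have ht := (hfourier t).2 1 one_pos
    simp [hfilter_one, quadMono, h.coord_two_eq_coord_zero] at ht
    rw [mixedForm_apply]
    linear_combination ht
  have hfreq_two := (h.mixedForm_coord_self_eq_zero hJ (a := c 1 / 2) (c := c 6) (d := c 8)
    (a' := 0) (c' := 0) (d' := 0) fun t => by
      have ht := (hfourier t).2 2 two_pos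
      simp [hfilter_two, quadMono, h.coord_two_eq_coord_zero] at ht
      simp only [mixedForm_apply]
      linear_combination ht).1
  obtain ⟨hfreq_zero, hfreq_zero'⟩ := h.mixedForm_coord_self_eq_zero hJ (a := (m 0 + m 2 : ℂ) / 2)
    (c := conj (c 4) / 2) (d := c 4 / 2) (a' := m 1 / 2) (c' := c 7 / 2) (d' := conj (c 7) / 2)
    fun t => by
      have ht := congrArg Complex.ofReal (hfourier t).1
      simp [-Complex.add_re, -Complex.mul_re, hfilter_zero, quadMono, h.coord_two_eq_coord_zero,
        Complex.re_eq_add_conj, Fin.sum_univ_three, Complex.normSq_eq_conj_mul_self] at ht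
      simp only [mixedForm_apply]
      linear_combination ht
  obtain ⟨hc0, hc2, hc3, hc5⟩ := eq_zero_of_mixedForm_eq_zero hfreq_one
  obtain ⟨hc1, -, hc6, hc8⟩ := eq_zero_of_mixedForm_eq_zero hfreq_two
  obtain ⟨hm, -, -, hc4⟩ := eq_zero_of_mixedForm_eq_zero hfreq_zero
  obtain ⟨hm1, -, hc7, -⟩ := eq_zero_of_mixedForm_eq_zero hfreq_zero'
  simp only [div_eq_zero_iff, OfNat.ofNat_ne_zero, or_false, Complex.ofReal_eq_zero,
    ← Complex.ofReal_add] at hc1 hm hc4 hm1 hc7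
  have hm2 : m 2 = -m 0 := (neg_eq_of_add_eq_zero_right hm).symm
  refine ⟨m 0, eq_of_isSymmetric_of_forall_inner_self_eq hM
    ((isSymmetric_momentOperator 0).smul rfl) fun x => ?_⟩
  rw [hmc]
  simp [inner_smul_left, inner_momentOperator_self, Fin.sum_univ_succ, weight, *]
  ring

end Zero

end IsProfile

/-! ### Congruence -/

section Congruence

theorem hasEigenvalue_smul_momentOperator_iff {c α μ : ℝ} :
    Module.End.HasEigenvalue ((c • momentOperator α : C3 →L[ℝ] C3) : Module.End ℝ C3) μ ↔
      ∃ j, c * weight α j = μ := by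
  constructor
  · intro h
    obtain ⟨x, hx⟩ := h.exists_hasEigenvector
    obtain ⟨j, hj⟩ : ∃ j, x j ≠ 0 := by
      by_contra! hall
      exact hx.2 (by ext j; exact hall j)
    have hxj := congrArg (fun z : C3 => z j) hx.apply_eq_smul
    refine ⟨j, Complex.ofReal_injective (mul_right_cancel₀ hj ?_)⟩
    simpa [mul_assoc] using hxj
  · rintro ⟨j, rfl⟩
    refine Module.End.hasEigenvalue_of_hasEigenvector (x := EuclideanSpace.single j 1)
      (Module.End.hasEigenvector_iff.2 ⟨Module.End.mem_eigenspace_iff.2 ?_, by simp⟩)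
    ext k
    by_cases hk : k = j
    · subst hk
      simp
    · simp [hk]

theorem hasEigenvalue_momentOperator_iff {α μ : ℝ} :
    Module.End.HasEigenvalue ((momentOperator α : C3 →L[ℝ] C3) : Module.End ℝ C3) μ ↔
      ∃ j, weight α j = μ := by
  simpa only [one_smul, one_mul] using hasEigenvalue_smul_momentOperator_iff (c := 1)

theorem eq_of_range_weight_eq {c α α' : ℝ} (hα : α ∈ Set.Ico (0 : ℝ) 1)
    (hα' : α' ∈ Set.Icc (0 : ℝ) 1)
    (h : ∀ μ, (∃ j, c * weight α j = μ) ↔ ∃ j, weight α' j = μ) : α = α' ∧ |c| = 1 := by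
  obtain ⟨a0, a1⟩ := hα
  obtain ⟨b0, b1⟩ := hα'
  obtain ⟨k, hk⟩ := (h _).1 ⟨0, rfl⟩
  obtain ⟨j, hj⟩ := (h _).2 ⟨0, rfl⟩
  obtain ⟨i, hi⟩ := (h _).2 ⟨2, rfl⟩
  have hle : weight α' k ≤ 1 := by
    fin_cases k <;> simp [weight] <;> linarith
  have hc1 : c ≤ 1 := by
    rw [hk] at hle
    simpa [weight] using hle
  have hj' : c = 1 ∨ c * (1 + α) = -1 := by
    fin_cases j <;> simp [weight] at hj
    · left; linarith
    · nlinarith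
    · right; linarith
  rcases hj' with rfl | hc
  · refine ⟨?_, abs_one⟩
    fin_cases i <;> simp [weight] at hi <;> linarith
  · have hneg : c < 0 := by nlinarith
    fin_cases i <;> simp [weight] at hi
    · have h0 : α = 0 := by nlinarith
      subst h0
      have hc' : c = -1 := by linarith
      exact ⟨by linarith, by rw [hc', abs_neg, abs_one]⟩
    · nlinarith
    · nlinarith

theorem eq_of_map_smul_momentOperator_eq {c α α' : ℝ} (hα : α ∈ Set.Ico (0 : ℝ) 1)
    (hα' : α' ∈ Set.Icc (0 : ℝ) 1) (F : C3 ≃ₗᵢ[ℝ] C3)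
    (hF : ∀ x, F ((c • momentOperator α) x) = momentOperator α' (F x)) : α = α' ∧ |c| = 1 := by
  refine eq_of_range_weight_eq hα hα' fun μ => ?_
  have hconj : F.toLinearEquiv.conj ((c • momentOperator α : C3 →L[ℝ] C3) : Module.End ℝ C3) =
      ((momentOperator α' : C3 →L[ℝ] C3) : Module.End ℝ C3) := by
    ext1 x
    exact (hF (F.symm x)).trans (congrArg (momentOperator α') (F.apply_symm_apply x))
  rw [← hasEigenvalue_smul_momentOperator_iff, Module.End.hasEigenvalue_iff_isRoot_charpoly,
    ← LinearEquiv.charpoly_conj F.toLinearEquiv, hconj,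
    ← Module.End.hasEigenvalue_iff_isRoot_charpoly, hasEigenvalue_momentOperator_iff]

theorem level_rotate (α s : ℝ) (z : C3) : level α (rotate α s z) = level α z := by
  rw [level, level, normSq_rotate]

theorem level_eq_of_norm_momentOperator_eq {α : ℝ} (hα : α ∈ Set.Ico (0 : ℝ) 1) {x y : C3}
    (hx : x ∈ zeroMoment α) (hy : y ∈ zeroMoment α)
    (h : ‖momentOperator α x‖ = ‖momentOperator α y‖) : level α x = level α y := by
  have hnorm : ∀ {z}, z ∈ zeroMoment α → ‖momentOperator α z‖ ^ 2 =
      2 * (1 + α + α ^ 2) / 3 - (1 - α) * (1 + 2 * α) * (2 + α) * level α z := by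
    intro z hz
    simp only [norm_sq_eq_sum_normSq, momentOperator_apply, map_mul, Complex.normSq_ofReal,
      normSq_eq_of_mem_zeroMoment hα.1 hz, weight, momentVector, Fin.sum_univ_three,
      Matrix.cons_val]
    ring
  have hne : (1 - α) * (1 + 2 * α) * (2 + α) ≠ 0 :=
    (mul_pos (mul_pos (sub_pos.2 hα.2) (by linarith [hα.1])) (by linarith [hα.1])).ne'
  apply mul_left_cancel₀ hne
  linear_combination hnorm hx - hnorm hy - (‖momentOperator α x‖ + ‖momentOperator α y‖) * h

namespace IsProfile

variable {α J α' J' : ℝ} {Z Z' : ℝ → C3}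

theorem exists_eq_smul_momentOperator (h : IsProfile α J Z) (hα : α ∈ Set.Ico (0 : ℝ) 1)
    (hJ : J ∈ Set.Ico (0 : ℝ) maxJ) (h0 : ¬ (α = 0 ∧ J = 0)) {M : C3 →L[ℝ] C3}
    (hM : (M : C3 →ₗ[ℝ] C3).IsSymmetric)
    (hq : ∀ p, inner ℝ (M (sweep α Z p)) (sweep α Z p) = 0) :
    ∃ a : ℝ, M = a • momentOperator α := by
  rcases hα.1.eq_or_lt with rfl | hα0
  · have hJ0 : 0 < J := hJ.1.lt_of_ne fun hJ0 => h0 ⟨rfl, hJ0.symm⟩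
    exact h.exists_eq_smul_momentOperator_of_zero ⟨hJ0, hJ.2⟩ hM hq
  · exact h.exists_eq_smul_momentOperator_of_pos hJ ⟨hα0, hα.2⟩ hM hq

theorem exists_map_smul_momentOperator_eq (h : IsProfile α J Z) (hα : α ∈ Set.Ico (0 : ℝ) 1)
    (hJ : J ∈ Set.Ico (0 : ℝ) maxJ) (h0 : ¬ (α = 0 ∧ J = 0)) (F : C3 ≃ₗᵢ[ℝ] C3)
    (hF : ∀ p, ∑ j, weight α' j * normSq (F (sweep α Z p) j) = 0) :
    ∃ c : ℝ, ∀ x, F ((c • momentOperator α) x) = momentOperator α' (F x) := by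
  let M : C3 →L[ℝ] C3 :=
    (F.symm : C3 →L[ℝ] C3) ∘L momentOperator α' ∘L (F : C3 →L[ℝ] C3)
  have hMF : ∀ x, F (M x) = momentOperator α' (F x) := fun x => F.apply_symm_apply _
  obtain ⟨c, hc⟩ := h.exists_eq_smul_momentOperator hα hJ h0 (M := M)
    (fun x y => by
      change inner ℝ (M x) y = inner ℝ x (M y)
      rw [← F.inner_map_map, ← F.inner_map_map x, hMF, hMF]
      exact isSymmetric_momentOperator α' _ _)
    (fun p => by rw [← F.inner_map_map, hMF, inner_momentOperator_self, hF])
  exact ⟨c, hc ▸ hMF⟩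

theorem level_zero_le_level_zero (h : IsProfile α J Z) (hα : α ∈ Set.Icc (0 : ℝ) 1) (hJ : 0 ≤ J)
    {F : C3 → C3} (hF : F '' Set.range (sweep α Z) = Set.range (sweep α Z'))
    (hlevel : ∀ p, level α (F (sweep α Z p)) = level α (sweep α Z p)) :
    level α (Z 0) ≤ level α (Z' 0) := by
  obtain ⟨_, ⟨p, rfl⟩, hp⟩ : Z' 0 ∈ F '' Set.range (sweep α Z) :=
    hF ▸ ⟨(0, 0), rotate_zero α (Z' 0)⟩
  rw [← hp, hlevel, sweep, level_rotate]
  exact h.level_zero_le hα hJ p.2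

theorem eq_of_image_range_sweep_eq (h : IsProfile α J Z) (h' : IsProfile α' J' Z')
    (hα : α ∈ Set.Ico (0 : ℝ) 1) (hJ : J ∈ Set.Ico (0 : ℝ) maxJ) (hα' : α' ∈ Set.Icc (0 : ℝ) 1)
    (hJ' : 0 ≤ J') (h0 : ¬ (α = 0 ∧ J = 0)) (F : C3 ≃ₗᵢ[ℝ] C3)
    (hF : F '' Set.range (sweep α Z) = Set.range (sweep α' Z')) : α = α' ∧ J = J' := by
  have hmap : ∀ p, F (sweep α Z p) ∈ zeroMoment α' := by
    intro p
    obtain ⟨p', hp'⟩ : F (sweep α Z p) ∈ Set.range (sweep α' Z') :=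
      hF ▸ Set.mem_image_of_mem _ ⟨p, rfl⟩
    exact hp' ▸ h'.sweep_mem_zeroMoment p'
  obtain ⟨c, hc⟩ := h.exists_map_smul_momentOperator_eq hα hJ h0 F fun p => (hmap p).2
  obtain ⟨rfl, hc1⟩ := eq_of_map_smul_momentOperator_eq hα hα' F hc
  have hlevel : ∀ p, level α (F (sweep α Z p)) = level α (sweep α Z p) := fun p =>
    level_eq_of_norm_momentOperator_eq hα (hmap p) (h.sweep_mem_zeroMoment p) <| by
      rw [← hc, F.norm_map, smul_apply, norm_smul, Real.norm_eq_abs, hc1,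
        one_mul]
  have hFsymm : F.symm '' Set.range (sweep α Z') = Set.range (sweep α Z) := by
    rw [← hF, Set.image_image]
    simp
  have hlevel0 : level α (Z 0) = level α (Z' 0) := by
    refine le_antisymm (h.level_zero_le_level_zero hα' hJ.1 hF hlevel)
      (h'.level_zero_le_level_zero hα' hJ' hFsymm fun p => ?_)
    obtain ⟨_, ⟨p', rfl⟩, hp'⟩ : sweep α Z' p ∈ F '' Set.range (sweep α Z) := hF ▸ ⟨p, rfl⟩
    rw [← hp', F.symm_apply_apply, hlevel]
  refine ⟨rfl, (sq_eq_sq₀ hJ.1 hJ').1 ?_⟩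
  rw [← h.levelCubic_level_zero hα.1, ← h'.levelCubic_level_zero hα.1, hlevel0]

theorem coord_one_zero_eq_zero (h : IsProfile 0 0 Z) : Z 0 1 = 0 := by
  have hprod := h.coordProd_zero le_rfl
  rw [coordProd, h.coord_two_eq_coord_zero] at hprod
  simpa [h.coord_zero_ne_zero le_rfl] using hprod

theorem sweep_one_re_eq_zero (h : IsProfile 0 0 Z) (p : ℝ × ℝ) : (sweep 0 Z p 1).re = 0 := by
  have hZ := fun t => hasDerivAt_iff_forall_coord.1 (h.flow t)
  -- The reflection `(z₁, z₂, z₃) ↦ (z̄₁, -z̄₂, z̄₃)` preserves the flow and the initial value.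
  have hrefl : Z = fun t => WithLp.toLp 2 ![conj (Z t 0), -conj (Z t 1), conj (Z t 2)] := by
    refine h.eq_of_hasDerivAt (t₀ := 0) (fun t => hasDerivAt_iff_forall_coord.2 fun j => ?_) ?_
    · fin_cases j
      · simpa [flowField, momentVector] using (hZ t 0).star
      · refine HasDerivAt.congr_deriv (f := fun t => -conj (Z t 1)) (hZ t 1).star.neg ?_
        simp [flowField, momentVector]
      · simpa [flowField, momentVector] using (hZ t 2).star
    · ext j
      fin_cases j
      · rw [h.eq_startPoint le_rfl]
        simp
      · simp [h.coord_one_zero_eq_zero]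
      · rw [h.eq_startPoint le_rfl]
        simp
  have hre : (Z p.2 1).re = -(Z p.2 1).re := by
    simpa using congrArg (fun z : C3 => (z 1).re) (congrFun hrefl p.2)
  simpa [sweep, weight] using self_eq_neg.1 hre

theorem span_range_sweep_zero_ne_top (h : IsProfile 0 0 Z) :
    Submodule.span ℝ (Set.range (sweep 0 Z)) ≠ ⊤ := by
  let L : C3 →ₗ[ℝ] ℝ :=
    Complex.reLm ∘ₗ (EuclideanSpace.projₗ (1 : Fin 3) : C3 →ₗ[ℂ] ℂ).restrictScalars ℝ
  intro htop
  have hker : Submodule.span ℝ (Set.range (sweep 0 Z)) ≤ LinearMap.ker L :=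
    Submodule.span_le.2 (Set.range_subset_iff.2 h.sweep_one_re_eq_zero)
  have : L (EuclideanSpace.single 1 1) = 0 := hker (htop ▸ Submodule.mem_top)
  simp [L] at this

end IsProfile

theorem torusPoint_add_torusPoint (a : Fin 3 → ℝ) (j : Fin 3) :
    torusPoint a + torusPoint (a + (Pi.single (j + 1) Real.pi - Pi.single (j + 2) Real.pi)) =
      EuclideanSpace.single j (((2 / √3 : ℝ) : ℂ) * Complex.exp (a j * I)) := by
  ext k
  fin_cases j <;> fin_cases k <;>
    simp [sub_eq_add_neg, add_mul, Complex.exp_add, Complex.exp_neg] <;> ring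

theorem span_cliffordTorus (φ : ℝ) : Submodule.span ℝ (cliffordTorus φ) = ⊤ := by
  rw [eq_top_iff]
  intro x _
  have hsum : x = ∑ j, EuclideanSpace.single j (x j) := by
    ext k
    simp [Finset.sum_apply]
  rw [hsum]
  refine Submodule.sum_mem _ fun j _ => ?_
  let a : Fin 3 → ℝ := Pi.single j (x j).arg + Pi.single (j + 1) (φ - (x j).arg)
  have ha : ∑ i, a i = φ := by simp [a, Finset.sum_add_distrib]
  have hmem : torusPoint a + torusPoint
      (a + (Pi.single (j + 1) Real.pi - Pi.single (j + 2) Real.pi)) ∈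
        Submodule.span ℝ (cliffordTorus φ) := by
    refine add_mem (Submodule.subset_span (mem_cliffordTorus_iff.2 ⟨_, ha, rfl⟩))
      (Submodule.subset_span (mem_cliffordTorus_iff.2 ⟨_, ?_, rfl⟩))
    simp [Finset.sum_add_distrib, Finset.sum_sub_distrib, ha]
  have haj : a j = (x j).arg := by simp [a]
  rw [torusPoint_add_torusPoint, haj] at hmem
  convert Submodule.smul_mem _ (√3 / 2 * ‖x j‖) hmem
  ext k
  by_cases hk : k = j
  · subst hk
    simp
    field_simp
    exact (Complex.norm_mul_exp_arg_mul_I (x k)).symm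
  · simp [hk]

theorem AreCongruent.symm {u v : ℝ × ℝ → C3} (h : AreCongruent u v) : AreCongruent v u := by
  obtain ⟨F, hF⟩ := h
  refine ⟨F.symm, ?_⟩
  rw [← hF, Set.image_image]
  simp

theorem AreCongruent.trans {u v w : ℝ × ℝ → C3} (h : AreCongruent u v) (h' : AreCongruent v w) :
    AreCongruent u w := by
  obtain ⟨F, hF⟩ := h
  obtain ⟨G, hG⟩ := h'
  refine ⟨F.trans G, ?_⟩
  rw [← hG, ← hF, Set.image_image]
  rfl

theorem span_image_eq_top_iff (F : C3 ≃ₗᵢ[ℝ] C3) {s : Set C3} :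
    Submodule.span ℝ (F '' s) = ⊤ ↔ Submodule.span ℝ s = ⊤ := by
  have h : Submodule.span ℝ (F '' s) =
      (Submodule.span ℝ s).map (F.toLinearEquiv : C3 →ₗ[ℝ] C3) := Submodule.span_image _
  rw [h]
  exact Submodule.map_eq_top_iff

theorem exists_linearIsometryEquiv_eq_matAct {B : Matrix (Fin 3) (Fin 3) ℂ}
    (hB : B ∈ Matrix.unitaryGroup (Fin 3) ℂ) : ∃ F : C3 ≃ₗᵢ[ℝ] C3, ∀ x, F x = matAct B x :=
  ⟨(⟨matAct B, norm_matAct hB⟩ : C3 →ₗᵢ[ℝ] C3).toLinearIsometryEquiv rfl, fun _ => rfl⟩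

theorem areCongruent_sweep_legendrianFamily (θ α J : ℝ) :
    AreCongruent (sweep α (profile α J)) (legendrianFamily θ α J) := by
  obtain ⟨F, hF⟩ := exists_linearIsometryEquiv_eq_matAct
    (smul_one_mem_unitaryGroup (conj_phase_mul θ))
  exact ⟨F, by rw [← Set.range_comp]; exact congrArg Set.range (funext fun p => hF _)⟩

theorem span_range_legendrianFamily_eq_top (θ : ℝ) {α J : ℝ} (hα : α ∈ Set.Icc (0 : ℝ) 1)
    (hJ : J ∈ Set.Icc (0 : ℝ) maxJ) (h : α = 1 ∨ J = maxJ) :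
    Submodule.span ℝ (Set.range (legendrianFamily θ α J)) = ⊤ := by
  obtain ⟨φ, B, hB, hr⟩ := exists_range_legendrianFamily_eq θ hα hJ h
  obtain ⟨F, hF⟩ :=
    exists_linearIsometryEquiv_eq_matAct (Matrix.mem_specialUnitaryGroup_iff.1 hB).1
  rw [hr, ← Set.image_congr fun x _ => hF x, span_image_eq_top_iff, span_cliffordTorus]

theorem not_areCongruent (θ : ℝ) {α J α' J' : ℝ} (hα : α ∈ Set.Icc (0 : ℝ) 1)
    (hJ : J ∈ Set.Icc (0 : ℝ) maxJ) (hα' : α' ∈ Set.Icc (0 : ℝ) 1) (hJ' : J' ∈ Set.Icc (0 : ℝ) maxJ)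
    (h : ¬ (α = 1 ∨ J = maxJ)) (hne : (α, J) ≠ (α', J')) :
    ¬ AreCongruent (legendrianFamily θ α J) (legendrianFamily θ α' J') := by
  intro hcong
  have hIco : ∀ {a b : ℝ}, a ∈ Set.Icc 0 1 → b ∈ Set.Icc 0 maxJ → ¬ (a = 1 ∨ b = maxJ) →
      a ∈ Set.Ico 0 1 ∧ b ∈ Set.Ico 0 maxJ := fun ha hb hab =>
    ⟨⟨ha.1, ha.2.lt_of_ne (hab ∘ Or.inl)⟩, hb.1, hb.2.lt_of_ne (hab ∘ Or.inr)⟩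
  obtain ⟨F, hF⟩ := ((areCongruent_sweep_legendrianFamily θ α J).trans hcong).trans
    (areCongruent_sweep_legendrianFamily θ α' J').symm
  have hP := isProfile_profile hα hJ
  have hP' := isProfile_profile hα' hJ'
  by_cases h0 : α = 0 ∧ J = 0
  · obtain ⟨rfl, rfl⟩ := h0
    by_cases h' : α' = 1 ∨ J' = maxJ
    · obtain ⟨G, hG⟩ := (areCongruent_sweep_legendrianFamily θ 0 0).trans hcong
      refine hP.span_range_sweep_zero_ne_top ((span_image_eq_top_iff G).1 ?_)
      rw [hG, span_range_legendrianFamily_eq_top θ hα' hJ' h']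
    · obtain ⟨F', hF'⟩ : AreCongruent (sweep α' (profile α' J')) (sweep 0 (profile 0 0)) :=
        AreCongruent.symm ⟨F, hF⟩
      obtain ⟨rfl, rfl⟩ := hP'.eq_of_image_range_sweep_eq hP (hIco hα' hJ' h').1
        (hIco hα' hJ' h').2 hα le_rfl (fun h0 => hne (by rw [h0.1, h0.2])) F' hF'
      exact hne rfl
  · obtain ⟨rfl, rfl⟩ := hP.eq_of_image_range_sweep_eq hP' (hIco hα hJ h).1 (hIco hα hJ h).2 hα'
      hJ'.1 h0 F hF
    exact hne rfl

end Congruence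

/-! ### The conjugate cross product -/

section ConjCross

/-- The conjugate cross product `(x, y) ↦ conj (x × y)` of `ℂ³`, a real-bilinear map: the vector
`conjCross x y` is Hermitian orthogonal to `x` and `y`, and `Re det (x, y, z)` is its real inner
product with `z`. -/
noncomputable def conjCross : C3 →L[ℝ] C3 →L[ℝ] C3 :=
  (LinearMap.mk₂ ℝ (fun x y : C3 => WithLp.toLp 2 fun j =>
    conj (x (j + 1) * y (j + 2) - x (j + 2) * y (j + 1)))
    (fun _ _ _ => by ext; simp; ring) (fun _ _ _ => by ext; simp; ring)
    (fun _ _ _ => by ext; simp; ring) fun _ _ _ => by ext; simp; ring).toContinuousBilinearMap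

@[simp]
theorem conjCross_apply (x y : C3) (j : Fin 3) :
    conjCross x y j = conj (x (j + 1) * y (j + 2) - x (j + 2) * y (j + 1)) := rfl

theorem inner_real_eq_re (x y : C3) : inner ℝ x y = (inner ℂ x y).re := rfl

theorem inner_conjCross_left (x y : C3) : inner ℂ x (conjCross x y) = 0 := by
  simp [PiLp.inner_apply, Fin.sum_univ_three]
  ring

theorem conjCross_swap (x y : C3) : conjCross y x = -conjCross x y := by
  ext j
  simp
  ring

theorem inner_conjCross_right (x y : C3) : inner ℂ y (conjCross x y) = 0 := by
  rw [conjCross_swap, inner_neg_right, inner_conjCross_left, neg_zero]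

theorem conjCross_self (x : C3) : conjCross x x = 0 := by
  ext j
  simp [mul_comm]

theorem conjCross_smul_right (c : ℂ) (x y : C3) : conjCross x (c • y) = conj c • conjCross x y := by
  ext j
  simp
  ring

theorem conjCross_conjCross (x y z : C3) :
    conjCross x (conjCross y z) = (inner ℂ x z : ℂ) • y - (inner ℂ x y : ℂ) • z := by
  ext j
  simp only [PiLp.inner_apply, RCLike.inner_apply, Fin.sum_univ_three]
  fin_cases j <;> simp <;> ring

theorem norm_conjCross_sq (x y : C3) :
    ‖conjCross x y‖ ^ 2 = ‖x‖ ^ 2 * ‖y‖ ^ 2 - normSq (inner ℂ x y) := by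
  simp only [norm_sq_eq_sum_normSq, PiLp.inner_apply, RCLike.inner_apply, Fin.sum_univ_three,
    Complex.normSq_apply]
  simp
  ring

theorem slagForm_zero_eq_inner (x y z : C3) : slagForm 0 x y z = inner ℝ (conjCross x y) z := by
  simp [slagForm, Matrix.det_fin_three, PiLp.inner_apply, Fin.sum_univ_three]
  ring

theorem matAct_conjCross {H : Matrix (Fin 3) (Fin 3) ℂ} (hH : ∀ j k, conj (H j k) = -H k j)
    (x y : C3) : matAct H (conjCross x y) = conjCross (matAct H x) y + conjCross x (matAct H y) +
      H.trace • conjCross x y := by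
  ext j
  simp only [PiLp.add_apply, PiLp.smul_apply, conjCross_apply, matAct_apply, Fin.sum_univ_three,
    Matrix.trace_fin_three, smul_eq_mul, map_sub, map_add, map_mul, hH]
  fin_cases j <;> simp <;> ring

theorem eq_zero_of_inner_conjCross {x p y : C3} (hN : conjCross x p ≠ 0) (h1 : inner ℂ x y = 0)
    (h2 : inner ℂ p y = 0) (h3 : inner ℂ (conjCross x p) y = 0) : y = 0 := by
  have e := norm_conjCross_sq y (conjCross x p)
  rw [conjCross_conjCross, inner_eq_zero_symm.1 h1, inner_eq_zero_symm.1 h2,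
    inner_eq_zero_symm.1 h3] at e
  simpa [hN] using e

variable {x p : C3} (hx : ‖x‖ = 1) (hp : p ≠ 0) (hxp : inner ℂ x p = 0)

include hx hxp in
theorem norm_conjCross : ‖conjCross x p‖ = ‖p‖ := by
  rw [← sq_eq_sq₀ (norm_nonneg _) (norm_nonneg _), norm_conjCross_sq, hxp, hx]
  simp

include hx hp hxp

theorem conjCross_ne_zero : conjCross x p ≠ 0 := by
  rwa [← norm_ne_zero_iff, norm_conjCross hx hxp, norm_ne_zero_iff]

theorem eq_sum_inner_smul (y : C3) :
    y = (inner ℂ x y : ℂ) • x + (inner ℂ p y / (‖p‖ : ℂ) ^ 2) • p +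
      (inner ℂ (conjCross x p) y / (‖p‖ : ℂ) ^ 2) • conjCross x p := by
  have hpn : (‖p‖ : ℂ) ≠ 0 := by simpa using hp
  refine sub_eq_zero.1 (eq_zero_of_inner_conjCross (conjCross_ne_zero hx hp hxp) ?_ ?_ ?_) <;>
  simp only [inner_sub_right, inner_add_right, inner_smul_right, inner_conjCross_left,
    inner_conjCross_right, inner_eq_zero_symm.1 (inner_conjCross_left x p),
    inner_eq_zero_symm.1 (inner_conjCross_right x p), inner_eq_zero_symm.1 hxp, hxp,
    inner_self_eq_norm_sq_to_K, norm_conjCross hx hxp, hx] <;>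
  simp [hpn]

end ConjCross

/-! ### Equality in the calibration inequality -/

theorem eq_smul_add_smul_of_inner_sq_eq {E : Type*} [NormedAddCommGroup E] [InnerProductSpace ℝ E]
    {b n c : E} (hbn : inner ℝ b n = 0) (hn : ‖n‖ ≤ ‖b‖) (hnc : inner ℝ n c ≠ 0)
    (h : inner ℝ n c ^ 2 = ‖b‖ ^ 2 * ‖c‖ ^ 2 - inner ℝ b c ^ 2) :
    ‖n‖ = ‖b‖ ∧ ‖b‖ ^ 2 • c = inner ℝ b c • b + inner ℝ n c • n := by
  have key : ‖‖b‖ ^ 2 • c - (inner ℝ b c • b + inner ℝ n c • n)‖ ^ 2 =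
      inner ℝ n c ^ 2 * (‖n‖ ^ 2 - ‖b‖ ^ 2) := by
    simp only [← real_inner_self_eq_norm_sq, inner_sub_left, inner_sub_right, inner_add_left,
      inner_add_right, inner_smul_left, inner_smul_right, conj_trivial, hbn, real_inner_comm b n,
      real_inner_comm b c, real_inner_comm n c] at h ⊢
    linear_combination -inner ℝ b b * h
  have hnb : ‖n‖ = ‖b‖ := by
    refine hn.antisymm (le_of_sq_le_sq ?_ (norm_nonneg _))
    have : 0 ≤ inner ℝ n c ^ 2 * (‖n‖ ^ 2 - ‖b‖ ^ 2) := key ▸ sq_nonneg _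
    linarith [nonneg_of_mul_nonneg_right this (by positivity)]
  rw [hnb, sub_self, mul_zero, sq_eq_zero_iff, norm_eq_zero, sub_eq_zero] at key
  exact ⟨hnb, key⟩

theorem gram_pos_of_injective {u : ℝ × ℝ → C3} {p : ℝ × ℝ}
    (h : Function.Injective (fderiv ℝ u p)) :
    0 < ‖partialS u p‖ ^ 2 * ‖partialT u p‖ ^ 2 - inner ℝ (partialS u p) (partialT u p) ^ 2 := by
  set b := partialS u p with hb
  set c := partialT u p with hc
  have hb0 : b ≠ 0 := fun h0 => by
    rw [hb, partialS, map_eq_zero_iff _ h] at h0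
    simp at h0
  have hx : -inner ℝ b c • b + ‖b‖ ^ 2 • c ≠ 0 := fun h0 => by
    rw [hb, hc, ← fderiv_apply_eq_partial, map_eq_zero_iff _ h, Prod.mk_eq_zero] at h0
    exact pow_ne_zero 2 (norm_ne_zero_iff.2 hb0) h0.2
  have e : ‖-inner ℝ b c • b + ‖b‖ ^ 2 • c‖ ^ 2 =
      ‖b‖ ^ 2 * (‖b‖ ^ 2 * ‖c‖ ^ 2 - inner ℝ b c ^ 2) := by
    rw [norm_add_sq_real, norm_smul, norm_smul, inner_smul_left, inner_smul_right]
    simp only [norm_neg, mul_pow, Real.norm_eq_abs, sq_abs, map_neg, conj_trivial, norm_pow,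
      abs_norm]
    ring
  exact pos_of_mul_pos_right (e ▸ by positivity) (sq_nonneg ‖b‖)

namespace IsSpecialLegendrianImmersion

variable {w : ℝ × ℝ → C3} (hw : IsSpecialLegendrianImmersion 0 w) (p : ℝ × ℝ)

include hw

theorem partialS_ne_zero : partialS w p ≠ 0 := fun h => by
  simpa [h] using gram_pos_of_injective (hw.immersion p)

theorem areaDensity_ne_zero : areaDensity w p ≠ 0 :=
  (Real.sqrt_pos.2 (gram_pos_of_injective (hw.immersion p))).ne'

theorem inner_conjCross_partialT_ne_zero :
    inner ℝ (conjCross (w p) (partialS w p)) (partialT w p) ≠ 0 := by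
  obtain ⟨ε, hε, hcal⟩ := hw.calibrated
  rw [← slagForm_zero_eq_inner, ← slagNormal, hcal]
  refine mul_ne_zero ?_ (hw.areaDensity_ne_zero p)
  rcases hε with rfl | rfl <;> norm_num

theorem inner_eq_zero_and_smul_partialT_eq : inner ℂ (w p) (partialS w p) = 0 ∧
    ‖partialS w p‖ ^ 2 • partialT w p = inner ℝ (partialS w p) (partialT w p) • partialS w p +
      inner ℝ (conjCross (w p) (partialS w p)) (partialT w p) •
        conjCross (w p) (partialS w p) := by
  set b := partialS w p
  set n := conjCross (w p) b
  obtain ⟨ε, hε, hcal⟩ := hw.calibrated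
  have hbn : inner ℝ b n = 0 := by rw [inner_real_eq_re, inner_conjCross_right, Complex.zero_re]
  have hn : ‖n‖ ^ 2 = ‖b‖ ^ 2 - normSq (inner ℂ (w p) b) := by
    rw [norm_conjCross_sq, hw.mem_sphere, one_pow, one_mul]
  have hle : ‖n‖ ≤ ‖b‖ := by
    refine le_of_sq_le_sq ?_ (norm_nonneg _)
    linarith [Complex.normSq_nonneg (inner ℂ (w p) b)]
  have hnc : inner ℝ n (partialT w p) ^ 2 =
      ‖b‖ ^ 2 * ‖partialT w p‖ ^ 2 - inner ℝ b (partialT w p) ^ 2 := by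
    rw [← slagForm_zero_eq_inner, ← slagNormal, hcal, mul_pow, areaDensity,
      Real.sq_sqrt (gram_pos_of_injective (hw.immersion p)).le, sq_eq_one_iff.2 hε, one_mul]
  obtain ⟨hnb, h⟩ := eq_smul_add_smul_of_inner_sq_eq hbn hle
    (hw.inner_conjCross_partialT_ne_zero p) hnc
  exact ⟨Complex.normSq_eq_zero.1 (by linarith [hnb ▸ hn]), h⟩

end IsSpecialLegendrianImmersion

/-! ### Structure equations of equivariant surfaces -/

section Exp

variable {E : Type*} [NormedAddCommGroup E]

theorem apply_exp_smul [NormedSpace ℝ E] (A : E →L[ℝ] E) (s : ℝ) (x : E) :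
    A (NormedSpace.exp (s • A) x) = NormedSpace.exp (s • A) (A x) :=
  DFunLike.congr_fun ((Commute.refl A).smul_right s).exp_right.eq x

theorem inner_exp_smul [InnerProductSpace ℝ E] [CompleteSpace E] {A : E →L[ℝ] E}
    (hA : ∀ x y, inner ℝ (A x) y = -inner ℝ x (A y)) (s : ℝ) (x y : E) :
    inner ℝ (NormedSpace.exp (s • A) x) (NormedSpace.exp (s • A) y) = inner ℝ x y := by
  have hd (s : ℝ) : HasDerivAt (fun s : ℝ =>
      (inner ℝ (NormedSpace.exp (s • A) x) (NormedSpace.exp (s • A) y) : ℝ)) 0 s :=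
    ((hasDerivAt_exp_smul_apply A x s).inner ℝ (hasDerivAt_exp_smul_apply A y s)).congr_deriv (by
      rw [hA, add_neg_cancel])
  simpa using is_const_of_deriv_eq_zero (fun s => (hd s).differentiableAt)
    (fun s => (hd s).deriv) s 0

end Exp

/-- The structure equations of a special Legendrian immersion `w (s, t) = e^{As} z(t)`: it is
tangent to `A w` and to the normal field `conjCross w (A w)` of the orbits, and the coefficients
`β`, `γ` of `∂_t w` in this frame do not depend on `s`. -/
structure IsEquivariantLegendrian (A : C3 →L[ℝ] C3) (w : ℝ × ℝ → C3) (β γ : ℝ → ℝ) : Prop where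
  skew : ∀ x y, inner ℝ (A x) y = -inner ℝ x (A y)
  contDiff_left : ContDiff ℝ ∞ β
  contDiff_right : ContDiff ℝ ∞ γ
  ne_zero : ∀ t, γ t ≠ 0
  norm_eq : ∀ p, ‖w p‖ = 1
  generator_ne_zero : ∀ p, A (w p) ≠ 0
  inner_generator : ∀ p, inner ℂ (w p) (A (w p)) = 0
  hasDerivAt_fst : ∀ s t, HasDerivAt (fun s => w (s, t)) (A (w (s, t))) s
  hasDerivAt_snd : ∀ s t, HasDerivAt (fun t => w (s, t))
    (β t • A (w (s, t)) + γ t • conjCross (w (s, t)) (A (w (s, t)))) t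
  generator_conjCross : ∀ p, A (conjCross (w p) (A (w p))) = conjCross (w p) (A (A (w p)))

section ExpOrbits

variable {A : C3 →L[ℝ] C3} {w : ℝ × ℝ → C3}
  (horb : ∀ s t, w (s, t) = NormedSpace.exp (s • A) (w (0, t)))

include horb

theorem hasDerivAt_of_eq_exp (s t : ℝ) : HasDerivAt (fun s => w (s, t)) (A (w (s, t))) s := by
  have h := hasDerivAt_exp_smul_apply A (w (0, t)) s
  simp only [← horb] at h
  exact h

theorem partialS_of_eq_exp (hd : Differentiable ℝ w) (p : ℝ × ℝ) : partialS w p = A (w p) :=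
  (hasDerivAt_partialS hd p.1 p.2).unique (hasDerivAt_of_eq_exp horb p.1 p.2)

theorem partialT_of_eq_exp (hd : Differentiable ℝ w) (s t : ℝ) :
    partialT w (s, t) = NormedSpace.exp (s • A) (partialT w (0, t)) := by
  refine (hasDerivAt_partialT hd s t).unique ?_
  simp only [horb s]
  exact (NormedSpace.exp (s • A)).hasFDerivAt.comp_hasDerivAt t (hasDerivAt_partialT hd 0 t)

theorem generator_of_eq_exp (s t : ℝ) :
    A (w (s, t)) = NormedSpace.exp (s • A) (A (w (0, t))) := by
  rw [horb, apply_exp_smul]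

variable (hA : ∀ x y, inner ℝ (A x) y = -inner ℝ x (A y))

include hA

theorem norm_generator_of_eq_exp (s t : ℝ) : ‖A (w (s, t))‖ = ‖A (w (0, t))‖ := by
  rw [generator_of_eq_exp horb s, norm_eq_sqrt_real_inner, inner_exp_smul hA,
    ← norm_eq_sqrt_real_inner]

namespace IsSpecialLegendrianImmersion

variable (hw : IsSpecialLegendrianImmersion 0 w)

include hw

theorem inner_generator_partialT_eq (s t : ℝ) : inner ℝ (A (w (s, t))) (partialT w (s, t)) =
    inner ℝ (A (w (0, t))) (partialT w (0, t)) := by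
  rw [generator_of_eq_exp horb, partialT_of_eq_exp horb hw.differentiable, inner_exp_smul hA]

theorem inner_conjCross_generator_partialT_eq (s t : ℝ) :
    inner ℝ (conjCross (w (s, t)) (A (w (s, t)))) (partialT w (s, t)) =
      inner ℝ (conjCross (w (0, t)) (A (w (0, t)))) (partialT w (0, t)) := by
  obtain ⟨ε, -, hcal⟩ := hw.calibrated
  have hS := partialS_of_eq_exp horb hw.differentiable
  have h (p : ℝ × ℝ) :
      inner ℝ (conjCross (w p) (A (w p))) (partialT w p) = ε * areaDensity w p := by
    rw [← hcal, slagNormal, slagForm_zero_eq_inner, hS]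
  rw [h, h, areaDensity, areaDensity, hS, hS, hw.inner_generator_partialT_eq horb hA,
    norm_generator_of_eq_exp horb hA, ← real_inner_self_eq_norm_sq (partialT w _),
    partialT_of_eq_exp horb hw.differentiable s, inner_exp_smul hA, real_inner_self_eq_norm_sq]

theorem exp_smul_conjCross_generator (s t : ℝ) :
    NormedSpace.exp (s • A) (conjCross (w (0, t)) (A (w (0, t)))) =
      conjCross (w (s, t)) (A (w (s, t))) := by
  have hS := partialS_of_eq_exp horb hw.differentiable
  have h0 := (hw.inner_eq_zero_and_smul_partialT_eq (0, t)).2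
  have hs := (hw.inner_eq_zero_and_smul_partialT_eq (s, t)).2
  have hne := hw.inner_conjCross_partialT_ne_zero (0, t)
  simp only [hS] at h0 hs hne
  rw [norm_generator_of_eq_exp horb hA, hw.inner_generator_partialT_eq horb hA,
    hw.inner_conjCross_generator_partialT_eq horb hA, generator_of_eq_exp horb s,
    partialT_of_eq_exp horb hw.differentiable, ← map_smul, h0, map_add, map_smul, map_smul] at hs
  rw [generator_of_eq_exp horb s]
  exact smul_right_injective _ hne (add_left_cancel hs)

theorem exists_isEquivariantLegendrian : ∃ β γ : ℝ → ℝ, IsEquivariantLegendrian A w β γ := by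
  have hd := hw.differentiable
  have hS := partialS_of_eq_exp horb hd
  let b (t : ℝ) : C3 := A (w (0, t))
  let n (t : ℝ) : C3 := conjCross (w (0, t)) (b t)
  let c (t : ℝ) : C3 := partialT w (0, t)
  have hb0 (p : ℝ × ℝ) : A (w p) ≠ 0 := hS p ▸ hw.partialS_ne_zero p
  have hbsq (t : ℝ) : ‖b t‖ ^ 2 ≠ 0 := pow_ne_zero 2 (norm_ne_zero_iff.2 (hb0 (0, t)))
  have hwc : ContDiff ℝ ∞ fun t : ℝ => w (0, t) :=
    hw.smooth.comp (contDiff_const.prodMk contDiff_id)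
  have hbc : ContDiff ℝ ∞ b := A.contDiff.comp hwc
  have hnc : ContDiff ℝ ∞ n := (conjCross.contDiff.comp hwc).clm_apply hbc
  have hcc : ContDiff ℝ ∞ c := by
    have hc : c = deriv fun t : ℝ => w (0, t) :=
      funext fun t => (hasDerivAt_partialT hd 0 t).deriv.symm
    exact hc ▸ (contDiff_infty_iff_deriv.1 hwc).2
  refine ⟨fun t => inner ℝ (b t) (c t) / ‖b t‖ ^ 2, fun t => inner ℝ (n t) (c t) / ‖b t‖ ^ 2, hA,
    (hbc.inner ℝ hcc).div (hbc.norm_sq ℝ) hbsq, (hnc.inner ℝ hcc).div (hbc.norm_sq ℝ) hbsq,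
    fun t => div_ne_zero ?_ (hbsq t), hw.mem_sphere, hb0,
    fun p => hS p ▸ (hw.inner_eq_zero_and_smul_partialT_eq p).1, hasDerivAt_of_eq_exp horb,
    fun s t => (hasDerivAt_partialT hd s t).congr_deriv ?_, fun ⟨s, t⟩ => ?_⟩
  · simpa only [hS] using hw.inner_conjCross_partialT_ne_zero (0, t)
  · refine smul_right_injective _ (hbsq t) ?_
    have h := (hw.inner_eq_zero_and_smul_partialT_eq (s, t)).2
    rw [hS, norm_generator_of_eq_exp horb hA, hw.inner_generator_partialT_eq horb hA,
      hw.inner_conjCross_generator_partialT_eq horb hA] at h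
    simp only [smul_add, smul_smul, mul_div_cancel₀ _ (hbsq t), h, b, n, c]
  · have h1 := hasDerivAt_exp_smul_apply A (n t) s
    simp only [n, b, hw.exp_smul_conjCross_generator horb hA] at h1
    have hws := hasDerivAt_of_eq_exp horb s t
    simpa [conjCross_self] using h1.unique (conjCross.hasDerivAt_of_bilinear (fun _ => hws)
      fun _ => A.hasFDerivAt.comp_hasDerivAt s hws)

end IsSpecialLegendrianImmersion

end ExpOrbits

/-! ### Infinitesimal isometries -/

section SkewSymmetric

variable {A : C3 →L[ℝ] C3}

theorem conj_eq_neg_of_skew {H G : Matrix (Fin 3) (Fin 3) ℂ}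
    (hL : ∀ x j, A x j = ∑ k, (H j k * x k + G j k * conj (x k)))
    (hA : ∀ x y, inner ℝ (A x) y = -inner ℝ x (A y)) (j k : Fin 3) :
    conj (H j k) = -H k j ∧ G j k = -G k j := by
  have hs (i l : Fin 3) (a : ℂ) :
      A (EuclideanSpace.single l a) i = H i l * a + G i l * conj a := by
    rw [hL, Fintype.sum_eq_single l fun m hm => by simp [hm]]
    simp
  have key (a b : ℂ) : (b * conj (H j k * a + G j k * conj a)).re =
      -(conj a * (H k j * b + G k j * conj b)).re := by
    have h := hA (EuclideanSpace.single k a) (EuclideanSpace.single j b)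
    rwa [inner_real_eq_re, inner_real_eq_re, EuclideanSpace.inner_single_left,
      EuclideanSpace.inner_single_right, hs, hs] at h
  have h11 := key 1 1
  have h1I := key 1 I
  have hI1 := key I 1
  have hII := key I I
  simp at h11 h1I hI1 hII
  constructor <;> apply Complex.ext <;> simp <;> linarith

theorem exists_matAct_add_conjCross (hA : ∀ x y, inner ℝ (A x) y = -inner ℝ x (A y)) :
    ∃ (H : Matrix (Fin 3) (Fin 3) ℂ) (k : C3), (∀ i j, conj (H i j) = -H j i) ∧
      ∀ x, A x = matAct H x + conjCross k x := by
  obtain ⟨H, G, hL⟩ := exists_linear_add_antilinear A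
  have hp := conj_eq_neg_of_skew hL hA
  have hG (j k : Fin 3) : G j k = -G k j := (hp j k).2
  have hG0 (j : Fin 3) : G j j = 0 := by linear_combination hG j j / 2
  refine ⟨H, WithLp.toLp 2 ![conj (G 2 1), conj (G 0 2), conj (G 1 0)],
    fun j k => (hp j k).1, fun x => ?_⟩
  ext j
  rw [hL, PiLp.add_apply, matAct_apply, Finset.sum_add_distrib, Fin.sum_univ_three
    (fun k => G j k * conj (x k))]
  congr 1
  fin_cases j <;> simp [hG0, hG 0 1, hG 1 2, hG 2 0] <;> ring

variable {H : Matrix (Fin 3) (Fin 3) ℂ} {k x : C3} (hH : ∀ i j, conj (H i j) = -H j i)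
  (hA : ∀ x, A x = matAct H x + conjCross k x) (hxp : inner ℂ x (A x) = 0)
  (hN : A (conjCross x (A x)) = conjCross x (A (A x)))

include hH hA hxp hN

theorem trace_smul_conjCross_add_eq_zero : H.trace • conjCross x (A x) +
    (inner ℂ k (A x) - inner ℂ (A x) k) • x + (inner ℂ x k - inner ℂ k x) • A x = 0 := by
  have h1 : conjCross (matAct H x) (A x) = -(inner ℂ (A x) k : ℂ) • x := by
    rw [show matAct H x = A x - conjCross k x by rw [hA, add_sub_cancel_right], map_sub,
      sub_apply, conjCross_self, zero_sub, ← conjCross_swap, conjCross_conjCross,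
      inner_eq_zero_symm.1 hxp, zero_smul, zero_sub, neg_smul]
  have h2 : conjCross x (A (A x)) =
      conjCross x (matAct H (A x)) - (inner ℂ x k : ℂ) • A x := by
    rw [hA (A x), map_add, conjCross_conjCross, hxp, zero_smul, zero_sub, sub_eq_add_neg]
  rw [hA (conjCross x _), matAct_conjCross hH, h1, h2, conjCross_conjCross] at hN
  linear_combination (norm := module) hN

theorem trace_eq_zero_and_im_inner_eq_zero (hx : ‖x‖ = 1) (hp : A x ≠ 0) :
    H.trace = 0 ∧ (inner ℂ k x).im = 0 := by
  have h := trace_smul_conjCross_add_eq_zero hH hA hxp hN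
  have hNx := inner_eq_zero_symm.1 (inner_conjCross_left x (A x))
  have hNp := inner_eq_zero_symm.1 (inner_conjCross_right x (A x))
  constructor
  · have h1 := congrArg (inner ℂ (conjCross x (A x))) h
    simp only [inner_add_right, inner_smul_right, hNx, hNp, mul_zero, add_zero,
      inner_zero_right] at h1
    exact (mul_eq_zero.1 h1).resolve_right (inner_self_ne_zero.2 (conjCross_ne_zero hx hp hxp))
  · have h2 := congrArg (inner ℂ (A x)) h
    simp only [inner_add_right, inner_smul_right, inner_conjCross_right,
      inner_eq_zero_symm.1 hxp, mul_zero, zero_add, inner_zero_right] at h2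
    have h3 := (mul_eq_zero.1 h2).resolve_right (inner_self_ne_zero.2 hp)
    rw [sub_eq_zero, ← inner_conj_symm] at h3
    exact Complex.conj_eq_iff_im.1 h3

end SkewSymmetric

/-! ### Compact surfaces have their symmetry in the special unitary group -/

theorem deriv_deriv_nonneg_of_isLocalMin {f : ℝ → ℝ} {t : ℝ} (hf : ContinuousAt f t)
    (hmin : IsLocalMin f t) : 0 ≤ deriv (deriv f) t := by
  by_contra! h
  have hconst : f =ᶠ[nhds t] fun _ => f t := by
    filter_upwards [hmin, isLocalMax_of_deriv_deriv_neg h hmin.deriv_eq_zero hf] with s h1 h2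
    exact le_antisymm h2 h1
  rw [hconst.deriv.deriv_eq] at h
  simp at h

theorem exists_eq_add_intCast (x : ℝ × ℝ) :
    ∃ (y : ℝ × ℝ) (m n : ℤ), y ∈ Set.Icc (0 : ℝ) 1 ×ˢ Set.Icc (0 : ℝ) 1 ∧
      x = y + ((m : ℝ), (n : ℝ)) := by
  refine ⟨(Int.fract x.1, Int.fract x.2), ⌊x.1⌋, ⌊x.2⌋,
    ⟨⟨Int.fract_nonneg _, (Int.fract_lt_one _).le⟩, ⟨Int.fract_nonneg _, (Int.fract_lt_one _).le⟩⟩,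
    ?_⟩
  ext <;> simp

theorem CoversTorus.exists_forall_le {w : ℝ × ℝ → C3} (hw : CoversTorus w) (hc : Continuous w)
    {f : C3 → ℝ} (hf : Continuous f) : ∃ p, ∀ q, f (w p) ≤ f (w q) := by
  obtain ⟨ψ, hψ, hper⟩ := hw
  have hcont : Continuous fun x => f (w (ψ x)) := hf.comp (hc.comp hψ.1.continuous)
  obtain ⟨x, -, hx⟩ := (isCompact_Icc.prod isCompact_Icc :
    IsCompact (Set.Icc (0 : ℝ) 1 ×ˢ Set.Icc (0 : ℝ) 1)).exists_isMinOn
    ⟨(0, 0), by simp⟩ hcont.continuousOn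
  refine ⟨ψ x, fun q => ?_⟩
  obtain ⟨y, m, n, hy, hq⟩ := exists_eq_add_intCast (ψ.symm q)
  rw [← ψ.apply_symm_apply q, hq, hper]
  exact hx hy

theorem inner_I_smul_left (k x : C3) : inner ℝ ((I : ℂ) • k) x = (inner ℂ k x).im := by
  rw [inner_real_eq_re, inner_smul_left]
  simp

theorem inner_eq_zero_of_hasDerivAt {n : C3} {g : ℝ → C3} {g' : C3} {s : ℝ} (hg : HasDerivAt g g' s)
    (h : ∀ s, inner ℝ n (g s) = 0) : inner ℝ n g' = 0 := by
  simpa using eq_zero_of_hasDerivAt_of_eq_zero ((hasDerivAt_const s n).inner ℝ hg) h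

namespace IsEquivariantLegendrian

variable {A : C3 →L[ℝ] C3} {w : ℝ × ℝ → C3} {β γ : ℝ → ℝ}
  (h : IsEquivariantLegendrian A w β γ)

include h

theorem inner_self_generator (x : C3) : inner ℝ x (A x) = 0 := by
  have := h.skew x x
  rw [real_inner_comm] at this
  linarith

theorem hasDerivAt_fst_generator (s t : ℝ) :
    HasDerivAt (fun s => A (w (s, t))) (A (A (w (s, t)))) s :=
  A.hasFDerivAt.comp_hasDerivAt s (h.hasDerivAt_fst s t)

theorem hasDerivAt_snd_generator (s t : ℝ) : HasDerivAt (fun t => A (w (s, t)))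
    (β t • A (A (w (s, t))) + γ t • A (conjCross (w (s, t)) (A (w (s, t))))) t :=
  (A.hasFDerivAt.comp_hasDerivAt t (h.hasDerivAt_snd s t)).congr_deriv (by simp)

theorem hasDerivAt_fst_conjCross (s t : ℝ) :
    HasDerivAt (fun s => conjCross (w (s, t)) (A (w (s, t))))
      (A (conjCross (w (s, t)) (A (w (s, t))))) s :=
  (conjCross.hasDerivAt_of_bilinear (fun _ => h.hasDerivAt_fst s t)
    fun _ => h.hasDerivAt_fst_generator s t).congr_deriv (by
      rw [conjCross_self, add_zero, h.generator_conjCross])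

theorem inner_generator_generator (p : ℝ × ℝ) :
    inner ℂ (w p) (A (A (w p))) = -(‖A (w p)‖ : ℂ) ^ 2 := by
  obtain ⟨s, t⟩ := p
  have h1 := eq_zero_of_hasDerivAt_of_eq_zero ((h.hasDerivAt_fst s t).inner ℂ
    (h.hasDerivAt_fst_generator s t)) fun s => h.inner_generator (s, t)
  rw [inner_self_eq_norm_sq_to_K] at h1
  exact eq_neg_of_add_eq_zero_left h1

theorem norm_generator_eq (s s' t : ℝ) : ‖A (w (s, t))‖ ^ 2 = ‖A (w (s', t))‖ ^ 2 := by
  have hd (s : ℝ) : HasDerivAt (fun s => ‖A (w (s, t))‖ ^ 2) 0 s :=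
    (h.hasDerivAt_fst_generator s t).norm_sq.congr_deriv (by simp [h.inner_self_generator])
  exact is_const_of_deriv_eq_zero (fun s => (hd s).differentiableAt) (fun s => (hd s).deriv) s s'

theorem exists_generator_eq_frame (p : ℝ × ℝ) : ∃ ζ η : ℂ, ζ.re = 0 ∧
    A (A (w p)) = -(‖A (w p)‖ : ℂ) ^ 2 • w p + ζ • A (w p) + η • conjCross (w p) (A (w p)) ∧
    A (conjCross (w p) (A (w p))) = conj ζ • conjCross (w p) (A (w p)) - conj η • A (w p) := by
  have hq := eq_sum_inner_smul (h.norm_eq p) (h.generator_ne_zero p) (h.inner_generator p)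
    (A (A (w p)))
  rw [h.inner_generator_generator] at hq
  set ζ : ℂ := inner ℂ (A (w p)) (A (A (w p))) / (‖A (w p)‖ : ℂ) ^ 2 with hζ
  set η : ℂ := inner ℂ (conjCross (w p) (A (w p))) (A (A (w p))) / (‖A (w p)‖ : ℂ) ^ 2
  refine ⟨ζ, η, ?_, hq, ?_⟩
  · rw [hζ, ← Complex.ofReal_pow, Complex.div_ofReal_re, ← inner_real_eq_re, h.inner_self_generator,
      zero_div]
  · rw [h.generator_conjCross, hq, map_add, map_add, conjCross_smul_right, conjCross_smul_right,
      conjCross_smul_right, conjCross_self, conjCross_conjCross, h.inner_generator,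
      inner_self_eq_norm_sq_to_K, h.norm_eq]
    module

theorem inner_eq_zero_of_forall_inner_eq_zero {n : C3} (hn : ∀ p, inner ℝ n (w p) = 0) (s t : ℝ) :
    inner ℝ n (A (w (s, t))) = 0 ∧ inner ℝ n (A (A (w (s, t)))) = 0 ∧
      inner ℝ n (conjCross (w (s, t)) (A (w (s, t)))) = 0 ∧
      inner ℝ n (A (conjCross (w (s, t)) (A (w (s, t))))) = 0 := by
  have h1 (s : ℝ) : inner ℝ n (A (w (s, t))) = 0 :=
    inner_eq_zero_of_hasDerivAt (h.hasDerivAt_fst s t) fun s => hn (s, t)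
  have h2 (s : ℝ) : inner ℝ n (conjCross (w (s, t)) (A (w (s, t)))) = 0 := by
    have := inner_eq_zero_of_hasDerivAt (h.hasDerivAt_snd s t) fun t => hn (s, t)
    rw [inner_add_right, inner_smul_right, h1, mul_zero, zero_add, inner_smul_right] at this
    exact (mul_eq_zero.1 this).resolve_left (h.ne_zero t)
  exact ⟨h1 s, inner_eq_zero_of_hasDerivAt (h.hasDerivAt_fst_generator s t) h1, h2 s,
    inner_eq_zero_of_hasDerivAt (h.hasDerivAt_fst_conjCross s t) h2⟩

theorem exists_inner_ne_zero {k : C3} (hk : k ≠ 0) (t : ℝ) :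
    ∃ s, inner ℂ k (A (w (s, t))) ≠ 0 ∨ inner ℂ k (conjCross (w (s, t)) (A (w (s, t)))) ≠ 0 := by
  by_contra! hall
  have hkq : inner ℂ k (A (A (w (0, t)))) = 0 := by
    simpa using eq_zero_of_hasDerivAt_of_eq_zero ((hasDerivAt_const (0 : ℝ) k).inner ℂ
      (h.hasDerivAt_fst_generator 0 t)) fun s => (hall s).1
  obtain ⟨ζ, η, -, hq, -⟩ := h.exists_generator_eq_frame (0, t)
  have hp := h.generator_ne_zero (0, t)
  rw [hq, inner_add_right, inner_add_right, inner_smul_right, inner_smul_right, inner_smul_right,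
    (hall 0).1, (hall 0).2, mul_zero, mul_zero, add_zero, add_zero] at hkq
  have hkw : inner ℂ k (w (0, t)) = 0 := by simpa [hp] using hkq
  exact hk (eq_zero_of_inner_conjCross
    (conjCross_ne_zero (h.norm_eq (0, t)) hp (h.inner_generator (0, t)))
    (inner_eq_zero_symm.1 hkw) (inner_eq_zero_symm.1 (hall 0).1) (inner_eq_zero_symm.1 (hall 0).2))

theorem exists_generator_conjCross_eq {k : C3} (hk : k ≠ 0)
    (him : ∀ p, (inner ℂ k (w p)).im = 0) (t : ℝ) :
    ∃ s κ : ℝ, A (conjCross (w (s, t)) (A (w (s, t)))) = κ • A (w (s, t)) := by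
  obtain ⟨s, hs⟩ := h.exists_inner_ne_zero hk t
  obtain ⟨ζ, η, hζ, hq, hAN⟩ := h.exists_generator_eq_frame (s, t)
  obtain ⟨e1, e2, e3, e4⟩ := h.inner_eq_zero_of_forall_inner_eq_zero
    (fun p => (inner_I_smul_left k (w p)).trans (him p)) s t
  rw [inner_I_smul_left] at e1 e2 e3 e4
  rw [hq, inner_add_right, inner_add_right, inner_smul_right, inner_smul_right,
    inner_smul_right] at e2
  rw [hAN, inner_sub_right, inner_smul_right, inner_smul_right] at e4
  set P := inner ℂ k (A (w (s, t)))
  set Q := inner ℂ k (conjCross (w (s, t)) (A (w (s, t))))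
  have h1 : P.re * ζ.im + Q.re * η.im = 0 := by
    simpa [him, P, Q, e1, e3, ← Complex.ofReal_pow, mul_comm] using e2
  have h2 : -Q.re * ζ.im + P.re * η.im = 0 := by
    simpa [P, Q, e1, e3, mul_comm] using e4
  have hPQ : P.re ^ 2 + Q.re ^ 2 ≠ 0 := by
    intro h0
    rcases hs with hP | hQ
    · exact hP (Complex.ext (by rw [Complex.zero_re]; nlinarith) e1)
    · exact hQ (Complex.ext (by rw [Complex.zero_re]; nlinarith) e3)
  have hζ0 : ζ = 0 := Complex.ext hζ ((mul_eq_zero.1 (by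
    linear_combination P.re * h1 - Q.re * h2)).resolve_left hPQ)
  have hη : conj η = η := Complex.conj_eq_iff_im.2 ((mul_eq_zero.1 (by
    linear_combination Q.re * h1 + P.re * h2)).resolve_left hPQ)
  refine ⟨s, -η.re, ?_⟩
  rw [hAN, hζ0, hη, ← Complex.conj_eq_iff_re.1 hη]
  simp

theorem hasDerivAt_snd_norm_generator_sq (s t : ℝ) : HasDerivAt (fun t => ‖A (w (s, t))‖ ^ 2)
    (2 * γ t * inner ℝ (A (w (s, t))) (A (conjCross (w (s, t)) (A (w (s, t)))))) t :=
  (h.hasDerivAt_snd_generator s t).norm_sq.congr_deriv (by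
    rw [inner_add_right, inner_smul_right, inner_smul_right, h.inner_self_generator]
    ring)

theorem hasDerivAt_snd_conjCross {s t : ℝ} (hN : A (conjCross (w (s, t)) (A (w (s, t)))) = 0) :
    HasDerivAt (fun t => conjCross (w (s, t)) (A (w (s, t))))
      (-(γ t * ‖A (w (s, t))‖ ^ 2) • w (s, t)) t := by
  refine (conjCross.hasDerivAt_of_bilinear (fun _ => h.hasDerivAt_snd s t)
    fun _ => h.hasDerivAt_snd_generator s t).congr_deriv ?_
  have hpx := inner_eq_zero_symm.1 (h.inner_generator (s, t))
  rw [hN, smul_zero, add_zero, map_smul, ← h.generator_conjCross, hN, smul_zero, zero_add, map_add,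
    map_smul, map_smul, add_apply, smul_apply, smul_apply, conjCross_self, conjCross_swap,
    conjCross_conjCross, hpx, inner_self_eq_norm_sq_to_K]
  ext j
  simp
  ring

-- Let `N = conjCross w (A w)`. On an orbit where `‖A w‖ ^ 2` is minimal and `A N` is a multiple of
-- `A w`, the first derivative `2 γ ⟪A w, A N⟫` forces `A N = 0`, and then the second derivative is
-- `-2 γ ^ 2 ‖A w‖ ^ 4 < 0`.
theorem eq_zero_of_coversTorus (hw : CoversTorus w) (hc : Continuous w) {k : C3}
    (him : ∀ p, (inner ℂ k (w p)).im = 0) : k = 0 := by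
  by_contra hk
  obtain ⟨⟨s₀, t₀⟩, hmin⟩ := hw.exists_forall_le hc (f := fun x => ‖A x‖ ^ 2) (by fun_prop)
  obtain ⟨s, κ, hκ⟩ := h.exists_generator_conjCross_eq hk him t₀
  have hmin' : IsLocalMin (fun t => ‖A (w (s, t))‖ ^ 2) t₀ :=
    .of_forall fun t => (h.norm_generator_eq s s₀ t₀).trans_le (hmin (s, t))
  have hd := h.hasDerivAt_snd_norm_generator_sq s
  have hp : 0 < ‖A (w (s, t₀))‖ := norm_pos_iff.2 (h.generator_ne_zero (s, t₀))
  have hg : inner ℝ (A (w (s, t₀))) (A (conjCross (w (s, t₀)) (A (w (s, t₀))))) = 0 := by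
    simpa [h.ne_zero t₀] using hmin'.hasDerivAt_eq_zero (hd t₀)
  have hN : A (conjCross (w (s, t₀)) (A (w (s, t₀)))) = 0 := by
    rw [hκ, inner_smul_right, real_inner_self_eq_norm_sq] at hg
    rw [hκ, (mul_eq_zero.1 hg).resolve_right (by positivity), zero_smul]
  have hγ : HasDerivAt (fun t => 2 * γ t) (2 * deriv γ t₀) t₀ :=
    ((h.contDiff_right.differentiable (by simp) t₀).hasDerivAt).const_mul 2
  have hdd := hγ.mul ((h.hasDerivAt_snd_generator s t₀).inner ℝ
    (A.hasFDerivAt.comp_hasDerivAt t₀ (h.hasDerivAt_snd_conjCross hN)))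
  have hnonneg := deriv_deriv_nonneg_of_isLocalMin (hd t₀).continuousAt hmin'
  rw [funext fun t => (hd t).deriv] at hnonneg
  have hval := hnonneg.trans_eq hdd.deriv
  simp only [Function.comp_apply, hN, inner_zero_right, mul_zero, map_smul, inner_smul_right,
    real_inner_self_eq_norm_sq, zero_add, add_zero] at hval
  have hpos : 0 < (γ t₀ * ‖A (w (s, t₀))‖ ^ 2) ^ 2 := by
    have := h.ne_zero t₀
    positivity
  linarith

theorem exists_skewHermitian (hw : CoversTorus w) (hc : Continuous w) :
    ∃ H : Matrix (Fin 3) (Fin 3) ℂ, (∀ i j, conj (H i j) = -H j i) ∧ H.trace = 0 ∧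
      A = matAct H := by
  obtain ⟨H, k, hH, hA⟩ := exists_matAct_add_conjCross h.skew
  have hp (p : ℝ × ℝ) := trace_eq_zero_and_im_inner_eq_zero hH hA (h.inner_generator p)
    (h.generator_conjCross p) (h.norm_eq p) (h.generator_ne_zero p)
  have hk := h.eq_zero_of_coversTorus hw hc fun p => (hp p).2
  refine ⟨H, hH, (hp 0).1, ?_⟩
  ext1 x
  rw [hA, hk, map_zero, zero_apply, add_zero]

end IsEquivariantLegendrian

/-! ### Diagonalization in the special unitary group -/

theorem exists_perm_abs_le (f : Fin 3 → ℝ) :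
    ∃ σ : Equiv.Perm (Fin 3), |f (σ 1)| ≤ |f (σ 0)| ∧ |f (σ 0)| ≤ |f (σ 2)| := by
  have hm := Tuple.monotone_sort fun j => |f j|
  have h01 := hm (show (0 : Fin 3) ≤ 1 by decide)
  have h12 := hm (show (1 : Fin 3) ≤ 2 by decide)
  exact ⟨(Equiv.swap 0 1).trans (Tuple.sort fun j => |f j|), by simpa using h01,
    by simpa [Equiv.swap_apply_of_ne_of_ne] using h12⟩

theorem exists_eq_mul_weight {f : Fin 3 → ℝ} (hsum : ∑ j, f j = 0) (h0 : f 0 ≠ 0)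
    (h1 : |f 1| ≤ |f 0|) (h2 : |f 0| ≤ |f 2|) :
    ∃ α ∈ Set.Icc (0 : ℝ) 1, ∀ j, f j = f 0 * weight α j := by
  have hf2 : f 2 = f 0 * (-1 - f 1 / f 0) := by
    rw [Fin.sum_univ_three] at hsum
    field_simp
    linarith
  have hα1 : |f 1 / f 0| ≤ 1 := by rwa [abs_div, div_le_one (abs_pos.2 h0)]
  have hα2 : 1 ≤ |-1 - f 1 / f 0| := by
    rw [hf2, abs_mul] at h2
    exact one_le_of_le_mul_left₀ (abs_pos.2 h0) h2
  refine ⟨f 1 / f 0, ⟨?_, (abs_le.1 hα1).2⟩, fun j => ?_⟩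
  · rw [abs_of_nonpos (by linarith [(abs_le.1 hα1).1])] at hα2
    linarith
  · fin_cases j
    · simp [weight]
    · exact (mul_div_cancel₀ _ h0).symm
    · exact hf2

theorem exists_perm_eq_mul_weight {f : Fin 3 → ℝ} (hsum : ∑ j, f j = 0) (hf : f ≠ 0) :
    ∃ σ : Equiv.Perm (Fin 3), ∃ α ∈ Set.Icc (0 : ℝ) 1, ∃ k : ℝ, k ≠ 0 ∧
      ∀ j, f (σ j) = k * weight α j := by
  obtain ⟨σ, h1, h2⟩ := exists_perm_abs_le f
  have hs : ∑ j, f (σ j) = 0 := by rwa [Equiv.sum_comp σ]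
  have h0 : f (σ 0) ≠ 0 := by
    intro h0
    have e1 : f (σ 1) = 0 := by simpa [h0] using h1
    have e2 : f (σ 2) = 0 := by simpa [Fin.sum_univ_three, h0, e1] using hs
    refine hf (funext fun j => ?_)
    obtain ⟨i, rfl⟩ := σ.surjective j
    fin_cases i
    exacts [h0, e1, e2]
  obtain ⟨α, hα, h⟩ := exists_eq_mul_weight (f := f ∘ σ) hs h0 h1 h2
  exact ⟨σ, α, hα, f (σ 0), h0, h⟩

theorem exists_smul_mem_specialUnitaryGroup {V : Matrix (Fin 3) (Fin 3) ℂ}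
    (hV : V ∈ Matrix.unitaryGroup (Fin 3) ℂ) :
    ∃ c : ℂ, conj c * c = 1 ∧ c • V ∈ Matrix.specialUnitaryGroup (Fin 3) ℂ := by
  have hn : ‖V.det‖ = 1 := CStarRing.norm_of_mem_unitary (Matrix.det_of_mem_unitary hV)
  obtain ⟨c, hc⟩ := IsAlgClosed.exists_pow_nat_eq (V.det)⁻¹ (n := 3) (by norm_num)
  have hcn : ‖c‖ = 1 := by
    rw [← pow_eq_one_iff_of_nonneg (norm_nonneg c) three_ne_zero, ← norm_pow, hc, norm_inv, hn,
      inv_one]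
  have hcc : conj c * c = 1 := by
    rw [← Complex.normSq_eq_conj_mul_self, Complex.normSq_eq_norm_sq, hcn, one_pow,
      Complex.ofReal_one]
  refine ⟨c, hcc, Matrix.mem_specialUnitaryGroup_iff.2 ⟨?_, ?_⟩⟩
  · simpa using mul_mem (smul_one_mem_unitaryGroup hcc) hV
  · rw [Matrix.det_smul, Fintype.card_fin, hc, inv_mul_cancel₀ (norm_ne_zero_iff.1 (by simp [hn]))]

section Diagonalization

variable {H : Matrix (Fin 3) (Fin 3) ℂ} (hH : ∀ i j, conj (H i j) = -H j i)

include hH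

theorem exists_star_mul_mul_eq_diagonal : ∃ U ∈ Matrix.unitaryGroup (Fin 3) ℂ, ∃ f : Fin 3 → ℝ,
    star U * H * U = Matrix.diagonal fun j => I * f j := by
  have hX : (-I • H).IsHermitian := by
    ext i j
    simp [hH]
  refine ⟨hX.eigenvectorUnitary, hX.eigenvectorUnitary.2, hX.eigenvalues, ?_⟩
  have h := congrArg (I • ·) hX.conjStarAlgAut_star_eigenvectorUnitary
  rw [Unitary.conjStarAlgAut_apply] at h
  simpa [smul_smul, ← Matrix.diagonal_smul, Function.comp_def, Pi.smul_def] using h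

theorem exists_star_mul_mul_eq_diagonal_weight (htr : H.trace = 0) (hne : H ≠ 0) :
    ∃ α ∈ Set.Icc (0 : ℝ) 1, ∃ k : ℝ, k ≠ 0 ∧ ∃ V ∈ Matrix.specialUnitaryGroup (Fin 3) ℂ,
      star V * H * V = Matrix.diagonal fun j => I * (k * weight α j : ℝ) := by
  obtain ⟨U, hU, f, hf⟩ := exists_star_mul_mul_eq_diagonal hH
  have hsum : ∑ j, f j = 0 := by
    have h := congrArg Matrix.trace hf
    rw [Matrix.trace_mul_cycle, Matrix.mem_unitaryGroup_iff.1 hU, one_mul, htr,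
      Matrix.trace_diagonal, ← Finset.mul_sum, ← Complex.ofReal_sum, zero_eq_mul] at h
    exact Complex.ofReal_eq_zero.1 (h.resolve_left Complex.I_ne_zero)
  have hf0 : f ≠ 0 := by
    rintro rfl
    refine hne ?_
    have h := congrArg (U * · * star U) hf
    simpa [Matrix.mul_assoc, Matrix.mem_unitaryGroup_iff.1 hU, ← Matrix.mul_assoc U] using h
  obtain ⟨σ, α, hα, k, hk, hσ⟩ := exists_perm_eq_mul_weight hsum hf0
  have hperm (M N : Matrix (Fin 3) (Fin 3) ℂ) :
      M.submatrix σ id * N.submatrix id σ = (M * N).submatrix σ σ :=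
    Matrix.submatrix_mul_equiv M N σ (.refl _) σ
  have hV : U.submatrix id σ ∈ Matrix.unitaryGroup (Fin 3) ℂ := by
    rw [Matrix.mem_unitaryGroup_iff'] at hU ⊢
    rw [Matrix.star_eq_conjTranspose, Matrix.conjTranspose_submatrix, hperm,
      ← Matrix.star_eq_conjTranspose, hU, Matrix.submatrix_one_equiv]
  obtain ⟨c, hcc, hc⟩ := exists_smul_mem_specialUnitaryGroup hV
  refine ⟨α, hα, k, hk, _, hc, ?_⟩
  calc star (c • U.submatrix id σ) * H * (c • U.submatrix id σ)
      = (star U).submatrix σ id * H.submatrix id id * U.submatrix id σ := by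
        rw [star_smul, Matrix.smul_mul, Matrix.smul_mul, Matrix.mul_smul, smul_smul,
          RCLike.star_def, hcc, one_smul]
        rfl
    _ = (star U * H * U).submatrix σ σ := by
        rw [← hperm (star U * H) U]
        rfl
    _ = Matrix.diagonal fun j => I * (k * weight α j : ℝ) := by
        rw [hf, Matrix.submatrix_diagonal_equiv]
        simp only [Function.comp_def, hσ]

theorem exists_matAct_eq_smul_generator (htr : H.trace = 0) (hne : H ≠ 0) :
    ∃ α ∈ Set.Icc (0 : ℝ) 1, ∃ k : ℝ, k ≠ 0 ∧ ∃ V ∈ Matrix.specialUnitaryGroup (Fin 3) ℂ,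
      ∀ x, matAct (star V) (matAct H x) = k • generator α (matAct (star V) x) := by
  obtain ⟨α, hα, k, hk, V, hV, hd⟩ := exists_star_mul_mul_eq_diagonal_weight hH htr hne
  refine ⟨α, hα, k, hk, V, hV, fun x => ?_⟩
  have hVu := Matrix.mem_unitaryGroup_iff.1 (Matrix.mem_specialUnitaryGroup_iff.1 hV).1
  have h : star V * H = (Matrix.diagonal fun j => I * (k * weight α j : ℝ)) * star V := by
    rw [← hd, Matrix.mul_assoc _ V, hVu, mul_one]
  rw [← matAct_mul, h, matAct_mul]
  ext j
  rw [matAct_apply]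
  simp [Matrix.diagonal_apply]
  ring

end Diagonalization

/-! ### Completeness of the profile of a compact surface -/

theorem exists_contDiff_primitive {f : ℝ → ℝ} (hf : ContDiff ℝ ∞ f) (a : ℝ) :
    ∃ F : ℝ → ℝ, ContDiff ℝ ∞ F ∧ (∀ t, HasDerivAt F (f t) t) ∧ F a = 0 := by
  have hd (t : ℝ) : HasDerivAt (fun t => ∫ x in a..t, f x) (f t) t :=
    intervalIntegral.integral_hasDerivAt_right (hf.continuous.intervalIntegrable _ _)
      hf.continuous.stronglyMeasurable.stronglyMeasurableAtFilter hf.continuous.continuousAt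
  refine ⟨fun t => ∫ x in a..t, f x, contDiff_infty_iff_deriv.2
    ⟨fun t => (hd t).differentiableAt, ?_⟩, hd, intervalIntegral.integral_same⟩
  rwa [funext fun t => (hd t).deriv]

theorem exists_abs_eq_mul {f : ℝ → ℝ} (hf : Continuous f) (h0 : ∀ t, f t ≠ 0) :
    ∃ ε : ℝ, ε ≠ 0 ∧ ∀ t, |f t| = ε * f t := by
  rcases isPreconnected_univ.eq_or_eq_neg_of_sq_eq hf.abs.continuousOn hf.continuousOn
    (fun t _ => sq_abs (f t)) (fun {t} _ => h0 t) with h | h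
  · exact ⟨1, one_ne_zero, fun t => (h (Set.mem_univ t)).trans (one_mul _).symm⟩
  · exact ⟨-1, by norm_num, fun t => (h (Set.mem_univ t)).trans (neg_one_mul _).symm⟩

theorem surjective_of_norm_deriv_le {E : Type*} [NormedAddCommGroup E] [NormedSpace ℝ E]
    {x x' : ℝ → E} {σ σ' : ℝ → ℝ} (hx : ∀ t, HasDerivAt x (x' t) t)
    (hproper : Filter.Tendsto (fun t => ‖x t‖) (Filter.cocompact ℝ) Filter.atTop)
    (hσ : ∀ t, HasDerivAt σ (σ' t) t) (hle : ∀ t, ‖x' t‖ ≤ σ' t) : Function.Surjective σ := by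
  have hlip (a t : ℝ) (hat : a ≤ t) : ‖x t - x a‖ ≤ σ t - σ a :=
    image_norm_le_of_norm_deriv_right_le_deriv_boundary (f := fun t => x t - x a)
      (B := fun t => σ t - σ a)
      (fun t _ => ((hx t).sub_const (x a)).continuousAt.continuousWithinAt)
      (fun t _ => ((hx t).sub_const (x a)).hasDerivWithinAt) (by simp)
      (fun t => (hσ t).sub_const _) (fun t _ => hle t) (Set.right_mem_Icc.2 hat)
  rw [cocompact_eq_atBot_atTop, Filter.tendsto_sup] at hproper
  refine (continuous_iff_continuousAt.2 fun t => (hσ t).continuousAt).surjective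
    (Filter.tendsto_atTop_mono' _ ?_ (Filter.tendsto_atTop_add_const_right _ (σ 0 - ‖x 0‖)
      hproper.2))
    (Filter.tendsto_atBot_mono' _ ?_ (Filter.tendsto_atBot_add_const_right _ (σ 0 + ‖x 0‖)
      (Filter.tendsto_neg_atTop_atBot.comp hproper.1)))
  · filter_upwards [Filter.eventually_ge_atTop 0] with t ht
    linarith [hlip 0 t ht, norm_sub_norm_le (x t) (x 0)]
  · filter_upwards [Filter.eventually_le_atBot 0] with t ht
    have := norm_sub_norm_le (x t) (x 0)
    rw [norm_sub_rev] at this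
    simp only [Function.comp_apply]
    linarith [hlip t 0 ht]

theorem IsPlaneDiffeo.injective_fderiv {ψ : ℝ × ℝ ≃ ℝ × ℝ} (hψ : IsPlaneDiffeo ψ) (x : ℝ × ℝ) :
    Function.Injective (fderiv ℝ ψ x) := by
  have h1 := (hψ.1.differentiable (by simp) x).hasFDerivAt
  have h2 := ((hψ.2.differentiable (by simp) (ψ x)).hasFDerivAt).comp x h1
  rw [ψ.symm_comp_self] at h2
  exact Function.LeftInverse.injective (g := fderiv ℝ ψ.symm (ψ x)) fun ξ =>
    DFunLike.congr_fun (h2.unique (hasFDerivAt_id x)) ξ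

theorem IsPlaneDiffeo.tendsto_symm_cocompact {ψ : ℝ × ℝ ≃ ℝ × ℝ} (hψ : IsPlaneDiffeo ψ) :
    Filter.Tendsto ψ.symm (Filter.cocompact _) (Filter.cocompact _) :=
  (Homeomorph.mk ψ.symm hψ.2.continuous hψ.1.continuous).isClosedEmbedding.tendsto_cocompact

theorem exists_mul_norm_le_norm_fderiv {E : Type*} [NormedAddCommGroup E] [NormedSpace ℝ E]
    {f : ℝ × ℝ → E} (hf : ContDiff ℝ 1 f) (hinj : ∀ x, Function.Injective (fderiv ℝ f x))
    (hper : ∀ (m n : ℤ) (x : ℝ × ℝ), f (x + ((m : ℝ), (n : ℝ))) = f x) :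
    ∃ m > 0, ∀ x ξ, m * ‖ξ‖ ≤ ‖fderiv ℝ f x ξ‖ := by
  have hcont : Continuous fun q : (ℝ × ℝ) × (ℝ × ℝ) => ‖fderiv ℝ f q.1 q.2‖ :=
    (((hf.continuous_fderiv (by simp)).comp continuous_fst).clm_apply continuous_snd).norm
  obtain ⟨⟨x₀, ξ₀⟩, hx₀, hmin⟩ := ((isCompact_Icc.prod isCompact_Icc :
    IsCompact (Set.Icc (0 : ℝ) 1 ×ˢ Set.Icc (0 : ℝ) 1)).prod
    (isCompact_sphere (0 : ℝ × ℝ) 1)).exists_isMinOn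
    ⟨((0, 0), (1, 0)), by simp [Prod.norm_def]⟩ hcont.continuousOn
  have hξ₀ : ξ₀ ≠ 0 := ne_zero_of_mem_unit_sphere ⟨ξ₀, hx₀.2⟩
  refine ⟨‖fderiv ℝ f x₀ ξ₀‖, norm_pos_iff.2 ((map_ne_zero_iff _ (hinj x₀)).2 hξ₀), fun x ξ => ?_⟩
  obtain ⟨y, m, n, hy, rfl⟩ := exists_eq_add_intCast x
  have hfd : fderiv ℝ f (y + ((m : ℝ), (n : ℝ))) = fderiv ℝ f y := by
    rw [← fderiv_comp_add_right, funext (hper m n)]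
  rcases eq_or_ne ξ 0 with rfl | hξ
  · simp
  · have hξn : 0 < ‖ξ‖ := norm_pos_iff.2 hξ
    have h1 : ‖fderiv ℝ f x₀ ξ₀‖ ≤ ‖fderiv ℝ f y (‖ξ‖⁻¹ • ξ)‖ :=
      hmin (a := (y, ‖ξ‖⁻¹ • ξ)) ⟨hy, by simp [norm_smul, hξn.ne']⟩
    rwa [map_smul, norm_smul, norm_inv, norm_norm, inv_mul_eq_div, le_div_iff₀ hξn, ← hfd] at h1

-- The metric induced on a torus is complete, so a proper curve has infinite length in both
-- directions.
theorem CoversTorus.surjective_of_norm_fderiv_le {w : ℝ × ℝ → C3} (hw : CoversTorus w)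
    (hs : ContDiff ℝ 1 w) (himm : ∀ p, Function.Injective (fderiv ℝ w p)) {P P' : ℝ → ℝ × ℝ}
    (hP : ∀ t, HasDerivAt P (P' t) t)
    (hproper : Filter.Tendsto P (Filter.cocompact _) (Filter.cocompact _)) {σ σ' : ℝ → ℝ}
    (hσ : ∀ t, HasDerivAt σ (σ' t) t) (hle : ∀ t, ‖fderiv ℝ w (P t) (P' t)‖ ≤ σ' t) :
    Function.Surjective σ := by
  obtain ⟨ψ, hψ, hper⟩ := hw
  have hcomp (x : ℝ × ℝ) : fderiv ℝ (w ∘ ψ) x = (fderiv ℝ w (ψ x)).comp (fderiv ℝ ψ x) :=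
    fderiv_comp x (hs.differentiable one_ne_zero _) (hψ.1.differentiable (by simp) _)
  obtain ⟨m, hm, hmle⟩ := exists_mul_norm_le_norm_fderiv (hs.comp (hψ.1.of_le (by simp)))
    (fun x => hcomp x ▸ (himm (ψ x)).comp (hψ.injective_fderiv x)) hper
  have hx (t : ℝ) : HasDerivAt (fun t => ψ.symm (P t)) (fderiv ℝ ψ.symm (P t) (P' t)) t :=
    ((hψ.2.differentiable (by simp) (P t)).hasFDerivAt).comp_hasDerivAt t (hP t)
  have hψx (t : ℝ) : fderiv ℝ ψ (ψ.symm (P t)) (fderiv ℝ ψ.symm (P t) (P' t)) = P' t := by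
    have h := ((hψ.1.differentiable (by simp) (ψ.symm (P t))).hasFDerivAt).comp_hasDerivAt t (hx t)
    exact h.unique (by simpa [Function.comp_def] using hP t)
  have hsurj : Function.Surjective fun t => m⁻¹ * σ t := by
    refine surjective_of_norm_deriv_le hx
      ((tendsto_norm_cocompact_atTop).comp (hψ.tendsto_symm_cocompact.comp hproper))
      (fun t => (hσ t).const_mul m⁻¹) fun t => ?_
    rw [inv_mul_eq_div, le_div_iff₀ hm, mul_comm]
    refine (hmle (ψ.symm (P t)) _).trans ?_
    rw [hcomp, ContinuousLinearMap.comp_apply, hψx, ψ.apply_symm_apply]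
    exact hle t
  intro y
  obtain ⟨t, ht⟩ := hsurj (m⁻¹ * y)
  exact ⟨t, mul_left_cancel₀ (inv_ne_zero hm.ne') ht⟩

theorem IsEquivariantLegendrian.surjective_primitive {A : C3 →L[ℝ] C3} {w : ℝ × ℝ → C3}
    {β γ : ℝ → ℝ} (h : IsEquivariantLegendrian A w β γ) (hw : CoversTorus w) (hs : ContDiff ℝ 1 w)
    (himm : ∀ p, Function.Injective (fderiv ℝ w p)) {τ : ℝ → ℝ}
    (hτ : ∀ t, HasDerivAt τ (γ t) t) : Function.Surjective τ := by
  have hd := hs.differentiable one_ne_zero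
  obtain ⟨b, -, hb, -⟩ := exists_contDiff_primitive h.contDiff_left 0
  obtain ⟨ε, hε, habs⟩ := exists_abs_eq_mul h.contDiff_right.continuous h.ne_zero
  have hproper : Filter.Tendsto (fun t => (-b t, t)) (Filter.cocompact ℝ) (Filter.cocompact _) := by
    rw [← Metric.cobounded_eq_cocompact (α := ℝ × ℝ), ← tendsto_norm_atTop_iff_cobounded]
    exact Filter.tendsto_atTop_mono (fun t => norm_snd_le (-b t, t)) tendsto_norm_cocompact_atTop
  -- This curve is orthogonal to the orbits, so its length is measured by `γ`.
  have hsurj : Function.Surjective fun t => ‖A‖ * ε * τ t := by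
    refine hw.surjective_of_norm_fderiv_le hs himm
      (fun t => (hb t).fun_neg.prodMk (hasDerivAt_id' t)) hproper (fun t => (hτ t).const_mul _)
      fun t => ?_
    have hS := (hasDerivAt_partialS hd (-b t) t).unique (h.hasDerivAt_fst _ _)
    have hT := (hasDerivAt_partialT hd (-b t) t).unique (h.hasDerivAt_snd _ _)
    have hfd : fderiv ℝ w (-b t, t) (-β t, 1) =
        γ t • conjCross (w (-b t, t)) (A (w (-b t, t))) := by
      rw [fderiv_apply_eq_partial, hS, hT]
      module
    have hA := A.le_opNorm (w (-b t, t))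
    rw [h.norm_eq, mul_one] at hA
    rw [hfd, norm_smul, norm_conjCross (h.norm_eq _) (h.inner_generator _), Real.norm_eq_abs,
      mul_comm, mul_assoc, ← habs]
    gcongr
  intro y
  obtain ⟨t, ht⟩ := hsurj (‖A‖ * ε * y)
  have hA : ‖A‖ ≠ 0 := norm_ne_zero_iff.2 fun h0 => h.generator_ne_zero 0 (by simp [h0])
  exact ⟨t, mul_left_cancel₀ (mul_ne_zero hA hε) ht⟩

/-! ### Classification of the surfaces which cover a torus -/

theorem exists_equiv_contDiff_symm {τ : ℝ → ℝ} (hτ : ContDiff ℝ ∞ τ) (h0 : ∀ t, deriv τ t ≠ 0)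
    (hs : Function.Surjective τ) : ∃ e : ℝ ≃ ℝ, ⇑e = τ ∧ ContDiff ℝ ∞ e.symm := by
  have hd (t : ℝ) : HasDerivAt τ (deriv τ t) t := (hτ.differentiable (by simp) t).hasDerivAt
  have hinj : Function.Injective τ := Function.Injective.of_lt_imp_ne fun a b hab heq => by
    obtain ⟨t, -, ht⟩ := exists_deriv_eq_zero hab hτ.continuous.continuousOn heq
    exact h0 t ht
  have hopen : IsOpenMap τ := isOpenMap_of_hasStrictDerivAt
    (fun t => hτ.contDiffAt.hasStrictDerivAt (by simp)) h0
  let e : ℝ ≃ₜ ℝ :=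
    (Equiv.ofBijective τ ⟨hinj, hs⟩).toHomeomorphOfContinuousOpen hτ.continuous hopen
  exact ⟨e.toEquiv, rfl, e.contDiff_symm_deriv h0 hd hτ⟩

theorem exists_isPlaneDiffeo_shear {k : ℝ} (hk : k ≠ 0) {b τ : ℝ → ℝ} (hb : ContDiff ℝ ∞ b)
    (hτ : ContDiff ℝ ∞ τ) (h0 : ∀ t, deriv τ t ≠ 0) (hs : Function.Surjective τ) :
    ∃ φ : ℝ × ℝ ≃ ℝ × ℝ, IsPlaneDiffeo φ ∧ ∀ p, φ p = (k * p.1 + b p.2, τ p.2) := by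
  obtain ⟨e, rfl, he⟩ := exists_equiv_contDiff_symm hτ h0 hs
  refine ⟨⟨fun p => (k * p.1 + b p.2, e p.2), fun q => ((q.1 - b (e.symm q.2)) / k, e.symm q.2),
    fun p => ?_, fun q => ?_⟩, ⟨?_, ?_⟩, fun p => rfl⟩
  · simp [hk]
  · simp [mul_div_cancel₀ _ hk]
  · exact ((contDiff_const.mul contDiff_fst).add (hb.comp contDiff_snd)).prodMk
      (hτ.comp contDiff_snd)
  · have he2 : ContDiff ℝ ∞ fun q : ℝ × ℝ => e.symm q.2 := he.comp contDiff_snd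
    exact ((contDiff_fst.sub (hb.comp he2)).div_const k).prodMk he2

section Diagonal

variable {e : Fin 3 → ℂ}

theorem matAct_diagonal_apply (e : Fin 3 → ℂ) (x : C3) (j : Fin 3) :
    matAct (Matrix.diagonal e) x j = e j * x j := by
  simp [matAct_apply, Matrix.diagonal_apply]

theorem diagonal_mem_unitaryGroup_iff :
    Matrix.diagonal e ∈ Matrix.unitaryGroup (Fin 3) ℂ ↔ ∀ j, conj (e j) * e j = 1 := by
  rw [Matrix.mem_unitaryGroup_iff', Matrix.star_eq_conjTranspose, Matrix.diagonal_conjTranspose,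
    Matrix.diagonal_mul_diagonal, ← Matrix.diagonal_one, Matrix.diagonal_eq_diagonal_iff]
  rfl

theorem diagonal_mem_specialUnitaryGroup_iff :
    Matrix.diagonal e ∈ Matrix.specialUnitaryGroup (Fin 3) ℂ ↔
      (∀ j, conj (e j) * e j = 1) ∧ e 0 * e 1 * e 2 = 1 := by
  rw [Matrix.mem_specialUnitaryGroup_iff, diagonal_mem_unitaryGroup_iff, Matrix.det_diagonal,
    Fin.prod_univ_three]

theorem conj_mul_eq_of_diagonal_mem_specialUnitaryGroup
    (he : Matrix.diagonal e ∈ Matrix.specialUnitaryGroup (Fin 3) ℂ) (j : Fin 3) :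
    conj (e (j + 1) * e (j + 2)) = e j := by
  obtain ⟨hu, hp⟩ := diagonal_mem_specialUnitaryGroup_iff.1 he
  have hprod : e j * (e (j + 1) * e (j + 2)) = 1 := by
    rw [← hp]
    fin_cases j <;> simp <;> ring
  rw [map_mul]
  linear_combination (-(conj (e (j + 1)) * conj (e (j + 2)))) * hprod +
    e j * (conj (e (j + 2)) * e (j + 2)) * hu (j + 1) + e j * hu (j + 2)

theorem rotate_matAct_diagonal (α s : ℝ) (e : Fin 3 → ℂ) (x : C3) :
    rotate α s (matAct (Matrix.diagonal e) x) = matAct (Matrix.diagonal e) (rotate α s x) := by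
  ext j
  simp only [rotate_apply, matAct_diagonal_apply]
  ring

theorem generator_matAct_diagonal (α : ℝ) (e : Fin 3 → ℂ) (x : C3) :
    generator α (matAct (Matrix.diagonal e) x) = matAct (Matrix.diagonal e) (generator α x) := by
  ext j
  simp only [generator_apply, matAct_diagonal_apply]
  ring

theorem flowField_matAct_diagonal (α : ℝ)
    (he : Matrix.diagonal e ∈ Matrix.specialUnitaryGroup (Fin 3) ℂ) (x : C3) :
    flowField α (matAct (Matrix.diagonal e) x) = matAct (Matrix.diagonal e) (flowField α x) := by
  ext j
  have hj := conj_mul_eq_of_diagonal_mem_specialUnitaryGroup he j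
  simp only [flowField_apply, matAct_diagonal_apply, map_mul] at hj ⊢
  linear_combination (I * momentVector α j * conj (x (j + 1)) * conj (x (j + 2))) * hj

theorem exists_diagonal_mem_specialUnitaryGroup {x z : C3} (h0 : x 0 ≠ 0) (h2 : x 2 ≠ 0)
    (hn : ∀ j, normSq (z j) = normSq (x j)) (hp : coordProd z = coordProd x) :
    ∃ e : Fin 3 → ℂ, Matrix.diagonal e ∈ Matrix.specialUnitaryGroup (Fin 3) ℂ ∧
      z = matAct (Matrix.diagonal e) x := by
  have hunit (j : Fin 3) (hj : x j ≠ 0) : conj (z j / x j) * (z j / x j) = 1 := by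
    rw [← Complex.normSq_eq_conj_mul_self, map_div₀, hn, div_self ((map_ne_zero _).2 hj),
      Complex.ofReal_one]
  have ha := hunit 0 h0
  have hc := hunit 2 h2
  have hz0 : z 0 = z 0 / x 0 * x 0 := (div_mul_cancel₀ _ h0).symm
  have hz2 : z 2 = z 2 / x 2 * x 2 := (div_mul_cancel₀ _ h2).symm
  generalize z 0 / x 0 = a at *
  generalize z 2 / x 2 = c at *
  have hz1 : z 1 = conj a * conj c * x 1 := by
    refine mul_left_cancel₀ (mul_ne_zero h0 h2) ?_
    rw [coordProd, coordProd, hz0, hz2] at hp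
    linear_combination (conj a * conj c) * hp - (x 0 * x 2 * z 1 * (conj c * c)) * ha -
      x 0 * x 2 * z 1 * hc
  refine ⟨![a, conj a * conj c, c], diagonal_mem_specialUnitaryGroup_iff.2 ⟨fun j => ?_, ?_⟩, ?_⟩
  · fin_cases j
    · exact ha
    · simp only [Fin.mk_one, Matrix.cons_val_one, Matrix.cons_val_zero, map_mul, Complex.conj_conj]
      linear_combination (conj c * c) * ha + hc
    · exact hc
  · simp only [Matrix.cons_val]
    linear_combination (conj c * c) * ha + hc
  · ext j
    rw [matAct_diagonal_apply]
    fin_cases j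
    exacts [hz0, hz1, hz2]

end Diagonal

theorem IsProfile.coord_two_ne_zero {α J : ℝ} {Z : ℝ → C3} (h : IsProfile α J Z)
    (hα : α ∈ Set.Icc (0 : ℝ) 1) : Z 0 2 ≠ 0 := by
  have hn := h.normSq_eq hα.1 0 2
  have hv := h.level_zero_nonpos hα.1
  rw [← map_ne_zero normSq, hn]
  simp only [momentVector, Matrix.cons_val]
  nlinarith [hα.2]

theorem IsProfile.exists_diagonal_eq {α J : ℝ} {Z : ℝ → C3} (h : IsProfile α J Z)
    (hα : α ∈ Set.Icc (0 : ℝ) 1) (hJ : 0 ≤ J) {z : C3} (hz : z ∈ zeroMoment α)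
    (hv : level α z ≤ 0) (hP : coordProd z = J) :
    ∃ e : Fin 3 → ℂ, Matrix.diagonal e ∈ Matrix.specialUnitaryGroup (Fin 3) ℂ ∧
      z = matAct (Matrix.diagonal e) (Z 0) := by
  have hlevel : level α z = level α (Z 0) := by
    refine (strictMonoOn_levelCubic hα).injOn hv (h.level_zero_nonpos hα.1) ?_
    rw [h.levelCubic_level_zero hα.1, ← normSq_coordProd_of_mem_zeroMoment hα.1 hz, hP,
      Complex.normSq_ofReal, sq]
  refine exists_diagonal_mem_specialUnitaryGroup (h.coord_zero_ne_zero hα.1)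
    (h.coord_two_ne_zero hα) (fun j => ?_) (by rw [hP, h.coordProd_zero hJ])
  rw [normSq_eq_of_mem_zeroMoment hα.1 hz, h.normSq_eq hα.1, hlevel]

theorem mem_Icc_maxJ {α J : ℝ} (hα : α ∈ Set.Icc (0 : ℝ) 1) (hJ : 0 ≤ J) {z : C3}
    (hz : z ∈ zeroMoment α) (hv : level α z ≤ 0) (hP : coordProd z = J) :
    J ∈ Set.Icc (0 : ℝ) maxJ := by
  refine ⟨hJ, (sq_le_sq₀ hJ maxJ_pos.le).1 ?_⟩
  rw [maxJ_sq, ← levelCubic_zero α, sq, ← Complex.normSq_ofReal, ← hP,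
    normSq_coordProd_of_mem_zeroMoment hα.1 hz]
  exact (strictMonoOn_levelCubic hα).monotoneOn hv Set.self_mem_Iic hv

theorem level_nonpos_of_deriv_levelCubic_nonneg {α : ℝ} (hα : α ∈ Set.Icc (0 : ℝ) 1) {z : C3}
    (hz : z ∈ zeroMoment α) (hA : generator α z ≠ 0)
    (h : 0 ≤ deriv (levelCubic α) (level α z)) : level α z ≤ 0 := by
  obtain ⟨h0, h1⟩ := hα
  by_contra! hv
  have hn := normSq_eq_of_mem_zeroMoment h0 hz
  have hnn : 0 ≤ 1 / 3 + (-1 - 2 * α) * level α z := (hn 0).symm ▸ Complex.normSq_nonneg (z 0)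
  rw [deriv_levelCubic] at h
  have hcubic := nonneg_of_mul_nonneg_right h hv
  have hbound : 0 ≤ (2 + α) * (1 - α) * (1 - 3 * (1 + 2 * α) * level α z) :=
    mul_nonneg (mul_nonneg (by linarith) (by linarith)) (by linarith)
  obtain rfl : α = 0 := by nlinarith
  -- Only the degenerate orbit `|z 1| = 1` is left, which consists of zeros of the generator.
  have hlevel : level 0 z = 1 / 3 := by linarith
  have hz0 : z 0 = 0 := by simpa [hlevel, momentVector] using hn 0
  have hz2 : z 2 = 0 := by simpa [hlevel, momentVector] using hn 2
  refine hA ?_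
  ext j
  fin_cases j <;> simp [weight, hz0, hz2]

namespace IsFlowCurve

variable {α : ℝ} {b c : ℝ → ℝ} {z : ℝ → C3}

theorem neg (hz : IsFlowCurve α b c z) : IsFlowCurve α b (fun t => -c t) (fun t => -z t) := by
  intro t
  refine (hz t).fun_neg.congr_deriv ?_
  have heven : flowField α (-z t) = flowField α (z t) := by
    ext j
    simp
  rw [heven, map_neg]
  module

theorem matAct_diagonal (hz : IsFlowCurve α b c z) {e : Fin 3 → ℂ}
    (he : Matrix.diagonal e ∈ Matrix.specialUnitaryGroup (Fin 3) ℂ) :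
    IsFlowCurve α b c (fun t => matAct (Matrix.diagonal e) (z t)) := by
  intro t
  refine ((matAct (Matrix.diagonal e)).hasFDerivAt.comp_hasDerivAt t (hz t)).congr_deriv ?_
  rw [generator_matAct_diagonal, flowField_matAct_diagonal α he, map_add, map_smul, map_smul]

theorem eq_of_eq (hz : IsFlowCurve α b c z) (hb : Continuous b) (hc : Continuous c) {y : ℝ → C3}
    (hy : IsFlowCurve α b c y) {t₀ : ℝ} (h0 : z t₀ ∈ zeroMoment α) (h : z t₀ = y t₀) : z = y :=
  eq_of_forall_hasDerivAt_smul_add_smul (contDiff_flowField α) (generator α) hb hc hz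
    (fun t => (hz.mem_zeroMoment h0 t).1.le) hy (fun t => (hy.mem_zeroMoment (h ▸ h0) t).1.le) h

theorem sweep {J : ℝ} {Z : ℝ → C3} (hZ : IsProfile α J Z) {B τ : ℝ → ℝ}
    (hB : ∀ t, HasDerivAt B (b t) t) (hτ : ∀ t, HasDerivAt τ (c t) t) :
    IsFlowCurve α b c (fun t => sweep α Z (B t, τ t)) := by
  intro t
  have h := (hZ.differentiable_sweep (B t, τ t)).hasFDerivAt.comp_hasDerivAt t
    ((hB t).prodMk (hτ t))
  rwa [fderiv_apply_eq_partial, hZ.partialS_sweep, hZ.partialT_sweep] at h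

theorem deriv_levelCubic_nonneg_of_isLocalMin (hz : IsFlowCurve α b c z) (hα : 0 ≤ α) {t₀ : ℝ}
    (h0 : z t₀ ∈ zeroMoment α) (hc : Differentiable ℝ c) (hc0 : c t₀ ≠ 0)
    (hmin : IsLocalMin (fun t => level α (z t)) t₀) :
    (coordProd (z t₀)).im = 0 ∧ 0 ≤ deriv (levelCubic α) (level α (z t₀)) := by
  have hd := hz.hasDerivAt_level hα
  have him : (coordProd (z t₀)).im = 0 := by
    simpa [hc0] using hmin.hasDerivAt_eq_zero (hd t₀)
  have hsecond := deriv_deriv_nonneg_of_isLocalMin (hd t₀).continuousAt hmin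
  rw [funext fun t => (hd t).deriv, (((hc t₀).hasDerivAt.const_mul 2).fun_mul
    (hz.hasDerivAt_coordProd_im hα h0)).deriv, him, mul_zero, zero_add] at hsecond
  have hsq : 0 < c t₀ ^ 2 := by positivity
  exact ⟨him, nonneg_of_mul_nonneg_right (by linarith) hsq⟩

theorem exists_eq_sweep_of_nonneg (hz : IsFlowCurve α b c z) (hα : α ∈ Set.Icc (0 : ℝ) 1)
    (hb : ContDiff ℝ ∞ b) (hc : ContDiff ℝ ∞ c) {t₀ : ℝ} (h0 : z t₀ ∈ zeroMoment α)
    (hv : level α (z t₀) ≤ 0) {J : ℝ} (hJ : 0 ≤ J) (hP : coordProd (z t₀) = J) :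
    J ∈ Set.Icc (0 : ℝ) maxJ ∧
      ∃ e : Fin 3 → ℂ, Matrix.diagonal e ∈ Matrix.specialUnitaryGroup (Fin 3) ℂ ∧
        ∃ B τ : ℝ → ℝ, ContDiff ℝ ∞ B ∧ ContDiff ℝ ∞ τ ∧ (∀ t, HasDerivAt τ (c t) t) ∧
          ∀ t, z t = matAct (Matrix.diagonal e) (_root_.sweep α (profile α J) (B t, τ t)) := by
  have hJ' := mem_Icc_maxJ hα hJ h0 hv hP
  have hZ := isProfile_profile hα hJ'
  obtain ⟨e, he, hstart⟩ := hZ.exists_diagonal_eq hα hJ h0 hv hP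
  obtain ⟨B, hBs, hBd, hB0⟩ := exists_contDiff_primitive hb t₀
  obtain ⟨τ, hτs, hτd, hτ0⟩ := exists_contDiff_primitive hc t₀
  refine ⟨hJ', e, he, B, τ, hBs, hτs, hτd, congrFun ?_⟩
  refine hz.eq_of_eq hb.continuous hc.continuous ((sweep hZ hBd hτd).matAct_diagonal he) h0 ?_
  rw [hB0, hτ0, _root_.sweep, rotate_zero, hstart]

theorem exists_eq_sweep (hz : IsFlowCurve α b c z) (hα : α ∈ Set.Icc (0 : ℝ) 1)
    (hb : ContDiff ℝ ∞ b) (hc : ContDiff ℝ ∞ c) {t₀ : ℝ} (h0 : z t₀ ∈ zeroMoment α)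
    (hv : level α (z t₀) ≤ 0) (him : (coordProd (z t₀)).im = 0) :
    ∃ J ∈ Set.Icc (0 : ℝ) maxJ,
      ∃ e : Fin 3 → ℂ, Matrix.diagonal e ∈ Matrix.unitaryGroup (Fin 3) ℂ ∧
        ((Matrix.diagonal e).det = 1 ∨ (Matrix.diagonal e).det = -1) ∧
          ∃ ε : ℝ, ε ≠ 0 ∧ ∃ B τ : ℝ → ℝ, ContDiff ℝ ∞ B ∧ ContDiff ℝ ∞ τ ∧
            (∀ t, HasDerivAt τ (ε * c t) t) ∧
              ∀ t, z t = matAct (Matrix.diagonal e) (_root_.sweep α (profile α J) (B t, τ t)) := by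
  rcases le_total 0 (coordProd (z t₀)).re with hJ | hJ
  · obtain ⟨hJ', e, he, B, τ, hBs, hτs, hτd, hzt⟩ :=
      hz.exists_eq_sweep_of_nonneg hα hb hc h0 hv hJ (Complex.ext rfl him)
    obtain ⟨hu, hdet⟩ := Matrix.mem_specialUnitaryGroup_iff.1 he
    exact ⟨_, hJ', e, hu, Or.inl hdet, 1, one_ne_zero, B, τ, hBs, hτs,
      fun t => by simpa using hτd t, hzt⟩
  · -- `coordProd` is odd, so `-z` has a nonnegative parameter.
    have hneg : (-z t₀) ∈ zeroMoment α := by simpa [zeroMoment] using h0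
    have hP : coordProd (-z t₀) = (-(coordProd (z t₀)).re : ℝ) := by
      rw [show coordProd (-z t₀) = -coordProd (z t₀) by simp [coordProd], ← Complex.re_add_im
        (coordProd (z t₀)), him]
      simp
    obtain ⟨hJ', e, he, B, τ, hBs, hτs, hτd, hzt⟩ := hz.neg.exists_eq_sweep_of_nonneg hα hb hc.neg
      hneg (by simpa [level] using hv) (neg_nonneg.2 hJ) hP
    obtain ⟨hu, hdet⟩ := Matrix.mem_specialUnitaryGroup_iff.1 he
    refine ⟨_, hJ', -e, ?_, Or.inr ?_, -1, by norm_num, B, τ, hBs, hτs,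
      fun t => by simpa using hτd t, fun t => ?_⟩
    · simpa [diagonal_mem_unitaryGroup_iff] using hu
    · rw [show Matrix.diagonal (-e) = -Matrix.diagonal e from (Matrix.diagonal_neg e).symm,
        Matrix.det_neg, hdet]
      norm_num
    · rw [← neg_neg (z t), hzt]
      ext j
      simp [matAct_diagonal_apply]

end IsFlowCurve

theorem conjCross_generator (α : ℝ) (z : C3) : conjCross z (generator α z) = -flowField α z := by
  ext j
  simp only [conjCross_apply, generator_apply, flowField_apply, PiLp.neg_apply, map_sub, map_mul,
    Complex.conj_I, Complex.conj_ofReal, momentVector_eq_weight_sub, Complex.ofReal_sub]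
  ring

theorem inner_generator_left (α : ℝ) (x y : C3) :
    inner ℝ (generator α x) y = -inner ℝ x (generator α y) := by
  rw [inner_eq_sum_re_im, inner_eq_sum_re_im, ← Finset.sum_neg_distrib]
  refine Finset.sum_congr rfl fun j _ => ?_
  simp
  ring

namespace IsEquivariantLegendrian

variable {α k : ℝ} {w : ℝ × ℝ → C3} {β γ : ℝ → ℝ}
  (h : IsEquivariantLegendrian (k • generator α) w β γ)

include h

theorem ne_zero_of_smul_generator : k ≠ 0 := by
  rintro rfl
  exact h.generator_ne_zero 0 (by simp)

theorem eq_rotate (p : ℝ × ℝ) : w p = rotate α (k * p.1) (w (0, p.2)) := by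
  have hexp := exp_smul_apply_eq_of_hasDerivAt _ (fun s => h.hasDerivAt_fst s p.2) p.1
  rw [← hexp, smul_smul, mul_comm, exp_smul_generator]

theorem isFlowCurve :
    IsFlowCurve α (fun t => k * β t) (fun t => -k * γ t) (fun t => w (0, t)) := by
  intro t
  refine (h.hasDerivAt_snd 0 t).congr_deriv ?_
  rw [smul_apply, map_smul, conjCross_generator]
  module

theorem mem_zeroMoment (p : ℝ × ℝ) : w p ∈ zeroMoment α := by
  refine ⟨h.norm_eq p, ?_⟩
  have hinner : (k : ℂ) * I * ((∑ j, weight α j * normSq (w p j) : ℝ) : ℂ) = 0 := by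
    rw [← h.inner_generator p, PiLp.inner_apply, Complex.ofReal_sum, Finset.mul_sum]
    refine Finset.sum_congr rfl fun j _ => ?_
    simp only [smul_apply, PiLp.smul_apply, generator_apply, Complex.real_smul, RCLike.inner_apply,
      Complex.ofReal_mul, Complex.normSq_eq_conj_mul_self]
    ring
  exact_mod_cast (mul_eq_zero.1 hinner).resolve_left (by simp [h.ne_zero_of_smul_generator])

theorem exists_forall_level_le (hα : 0 ≤ α) (hw : CoversTorus w) (hc : Continuous w) :
    ∃ t₀, ∀ t, level α (w (0, t₀)) ≤ level α (w (0, t)) := by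
  obtain ⟨⟨s₀, t₀⟩, hmin⟩ := hw.exists_forall_le hc (f := fun x => normSq (x 1))
    (Complex.continuous_normSq.comp (by fun_prop))
  refine ⟨t₀, fun t => ?_⟩
  have hle : normSq (w (0, t₀) 1) ≤ normSq (w (0, t) 1) := by
    simpa only [h.eq_rotate (s₀, t₀), normSq_rotate] using hmin (0, t)
  unfold level
  gcongr

theorem exists_eq_matAct_sweep (hα : α ∈ Set.Icc (0 : ℝ) 1) (hw : CoversTorus w)
    (hs : ContDiff ℝ 1 w) (himm : ∀ p, Function.Injective (fderiv ℝ w p)) :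
    ∃ J ∈ Set.Icc (0 : ℝ) maxJ, ∃ D ∈ Matrix.unitaryGroup (Fin 3) ℂ, (D.det = 1 ∨ D.det = -1) ∧
      ∃ φ : ℝ × ℝ ≃ ℝ × ℝ, IsPlaneDiffeo φ ∧
        ∀ p, w p = matAct D (sweep α (profile α J) (φ p)) := by
  have hk := h.ne_zero_of_smul_generator
  have hb : ContDiff ℝ ∞ fun t => k * β t := contDiff_const.mul h.contDiff_left
  have hc : ContDiff ℝ ∞ fun t => -k * γ t := contDiff_const.mul h.contDiff_right
  have hc0 (t : ℝ) : -k * γ t ≠ 0 := mul_ne_zero (neg_ne_zero.2 hk) (h.ne_zero t)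
  obtain ⟨t₀, hmin⟩ := h.exists_forall_level_le hα.1 hw hs.continuous
  obtain ⟨him, hderiv⟩ := h.isFlowCurve.deriv_levelCubic_nonneg_of_isLocalMin hα.1
    (h.mem_zeroMoment (0, t₀)) (hc.differentiable (by simp)) (hc0 t₀) (.of_forall hmin)
  have hA : generator α (w (0, t₀)) ≠ 0 := fun hz =>
    h.generator_ne_zero (0, t₀) (by rw [smul_apply, hz, smul_zero])
  obtain ⟨J, hJ, e, hu, hdet, ε, hε, B, τ, hBs, hτs, hτ, hwt⟩ :=
    h.isFlowCurve.exists_eq_sweep hα hb hc (h.mem_zeroMoment (0, t₀))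
      (level_nonpos_of_deriv_levelCubic_nonneg hα (h.mem_zeroMoment (0, t₀)) hA hderiv) him
  have hτ0 (t : ℝ) : deriv τ t ≠ 0 := (hτ t).deriv ▸ mul_ne_zero hε (hc0 t)
  have hsurj : Function.Surjective τ := by
    have hm : (ε * -k)⁻¹ ≠ 0 := inv_ne_zero (mul_ne_zero hε (neg_ne_zero.2 hk))
    have hscaled := h.surjective_primitive hw hs himm (τ := fun t => (ε * -k)⁻¹ * τ t) fun t =>
      ((hτ t).const_mul _).congr_deriv (by field_simp)
    exact Function.Surjective.of_comp_left (f := ((ε * -k)⁻¹ * ·)) hscaled (mul_right_injective₀ hm)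
  obtain ⟨φ, hφ, hφe⟩ := exists_isPlaneDiffeo_shear hk hBs hτs hτ0 hsurj
  refine ⟨J, hJ, Matrix.diagonal e, hu, hdet, φ, hφ, fun p => ?_⟩
  rw [h.eq_rotate, hwt, rotate_matAct_diagonal, hφe, sweep, sweep, rotate_add, add_comm]

end IsEquivariantLegendrian

section MatAct

variable {w : ℝ × ℝ → C3}

theorem CoversTorus.matAct (hw : CoversTorus w) (B : Matrix (Fin 3) (Fin 3) ℂ) :
    CoversTorus fun p => matAct B (w p) := by
  obtain ⟨ψ, hψ, hper⟩ := hw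
  exact ⟨ψ, hψ, fun m n x => congrArg (_root_.matAct B) (hper m n x)⟩

variable {B : Matrix (Fin 3) (Fin 3) ℂ} (hB : B ∈ Matrix.unitaryGroup (Fin 3) ℂ)

include hB

theorem matAct_star_matAct (x : C3) : matAct (star B) (matAct B x) = x := by
  rw [← matAct_mul, Matrix.mem_unitaryGroup_iff'.1 hB, matAct_one]

theorem inner_matAct_left (x y : C3) :
    inner ℝ (matAct B x) y = inner ℝ x (matAct (star B) y) := by
  have hy : matAct B (matAct (star B) y) = y := by
    simpa using matAct_star_matAct (Unitary.star_mem hB) y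
  rw [← inner_matAct hB x, hy]

theorem IsEquivariantForm.matAct (hw : IsEquivariantForm w) :
    IsEquivariantForm fun p => matAct B (w p) := by
  obtain ⟨A, hA, z, hz⟩ := hw
  let A' : C3 →L[ℝ] C3 := _root_.matAct B ∘L A ∘L _root_.matAct (star B)
  refine ⟨A', fun x y => ?_, fun t => _root_.matAct B (z t), fun s t => ?_⟩
  · change inner ℝ (_root_.matAct B (A (_root_.matAct (star B) x))) y =
      -inner ℝ x (_root_.matAct B (A (_root_.matAct (star B) y)))
    rw [inner_matAct_left hB, hA, inner_matAct_left (Unitary.star_mem hB), star_star]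
  · have hd (s : ℝ) : HasDerivAt (fun s => _root_.matAct B (w (s, t)))
        (A' (_root_.matAct B (w (s, t)))) s := by
      refine ((_root_.matAct B).hasFDerivAt.comp_hasDerivAt s
        (hasDerivAt_exp_smul_apply A (z t) s)).congr_deriv ?_ |>.congr_of_eventuallyEq ?_
      · change _ = _root_.matAct B (A (_root_.matAct (star B) _))
        rw [matAct_star_matAct hB, hz]
      · exact .of_forall fun s => congrArg (_root_.matAct B) (hz s t)
    have h0 : w (0, t) = z t := by rw [hz, exp_zero_smul_apply]
    change _ = NormedSpace.exp (s • A') (_root_.matAct B (z t))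
    rw [← h0, exp_smul_apply_eq_of_hasDerivAt A' hd]

end MatAct

section Classification

variable {θ : ℝ} {w : ℝ × ℝ → C3}

theorem IsSpecialLegendrianImmersion.exists_isEquivariantLegendrian_generator
    (hw : IsSpecialLegendrianImmersion 0 w) (hA : IsEquivariantForm w) (ht : CoversTorus w) :
    ∃ α ∈ Set.Icc (0 : ℝ) 1, ∃ k : ℝ, ∃ V ∈ Matrix.specialUnitaryGroup (Fin 3) ℂ, ∃ β γ : ℝ → ℝ,
      IsSpecialLegendrianImmersion 0 (fun p => _root_.matAct (star V) (w p)) ∧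
        IsEquivariantLegendrian (k • generator α) (fun p => _root_.matAct (star V) (w p)) β γ := by
  obtain ⟨A, hskew, z, hz⟩ := hA
  have horb (s t : ℝ) : w (s, t) = NormedSpace.exp (s • A) (w (0, t)) := by
    rw [hz, hz, exp_zero_smul_apply]
  obtain ⟨β, γ, h⟩ := hw.exists_isEquivariantLegendrian horb hskew
  obtain ⟨H, hH, htr, rfl⟩ := h.exists_skewHermitian ht hw.smooth.continuous
  have hH0 : H ≠ 0 := by
    rintro rfl
    exact h.generator_ne_zero 0 (by ext j; simp [matAct_apply])
  obtain ⟨α, hα, k, -, V, hV, hVH⟩ := exists_matAct_eq_smul_generator hH htr hH0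
  obtain ⟨hVu, hVd⟩ := Matrix.mem_specialUnitaryGroup_iff.1 hV
  have hw' : IsSpecialLegendrianImmersion 0 fun p => _root_.matAct (star V) (w p) :=
    hw.matAct (Unitary.star_mem hVu) (by
      rw [Matrix.star_eq_conjTranspose, Matrix.det_conjTranspose, hVd, star_one, mul_one])
  have hd (s t : ℝ) : HasDerivAt (fun s => _root_.matAct (star V) (w (s, t)))
      ((k • generator α) (_root_.matAct (star V) (w (s, t)))) s :=
    ((_root_.matAct (star V)).hasFDerivAt.comp_hasDerivAt s (h.hasDerivAt_fst s t)).congr_deriv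
      (hVH _)
  obtain ⟨β', γ', h'⟩ := hw'.exists_isEquivariantLegendrian (A := k • generator α)
    (fun s t => (exp_smul_apply_eq_of_hasDerivAt _ (fun s => hd s t) s).symm) fun x y => by
      simp only [smul_apply, inner_smul_left, inner_smul_right, inner_generator_left]
      simp
  exact ⟨α, hα, k, V, hV, β', γ', hw', h'⟩

theorem exists_eq_matAct_sweep (hw : IsSpecialLegendrianImmersion 0 w) (hA : IsEquivariantForm w)
    (ht : CoversTorus w) :
    ∃ α ∈ Set.Icc (0 : ℝ) 1, ∃ J ∈ Set.Icc (0 : ℝ) maxJ,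
      ∃ B ∈ Matrix.unitaryGroup (Fin 3) ℂ, (B.det = 1 ∨ B.det = -1) ∧
        ∃ φ : ℝ × ℝ ≃ ℝ × ℝ, IsPlaneDiffeo φ ∧
          ∀ p, w p = matAct B (sweep α (profile α J) (φ p)) := by
  obtain ⟨α, hα, k, V, hV, β, γ, hw', h⟩ := hw.exists_isEquivariantLegendrian_generator hA ht
  obtain ⟨hVu, hVd⟩ := Matrix.mem_specialUnitaryGroup_iff.1 hV
  obtain ⟨J, hJ, D, hD, hdet, φ, hφ, hwφ⟩ := h.exists_eq_matAct_sweep hα (ht.matAct _)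
    (hw'.smooth.of_le (by simp)) hw'.immersion
  refine ⟨α, hα, J, hJ, V * D, mul_mem hVu hD, by rwa [Matrix.det_mul, hVd, one_mul], φ, hφ,
    fun p => ?_⟩
  rw [matAct_mul, ← hwφ]
  simpa using (matAct_star_matAct (Unitary.star_mem hVu) (w p)).symm

theorem exists_eq_legendrianFamily (hw : IsSpecialLegendrianImmersion θ w)
    (hA : IsEquivariantForm w) (ht : CoversTorus w) :
    ∃ α ∈ Set.Icc (0 : ℝ) 1, ∃ J ∈ Set.Icc (0 : ℝ) maxJ,
      ∃ B ∈ Matrix.unitaryGroup (Fin 3) ℂ, (B.det = 1 ∨ B.det = -1) ∧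
        ∃ φ : ℝ × ℝ ≃ ℝ × ℝ, IsPlaneDiffeo φ ∧
          ∀ p, w p = matAct B (legendrianFamily θ α J (φ p)) := by
  have hphase := conj_phase_mul θ
  have hB : conj (phase θ) • (1 : Matrix (Fin 3) (Fin 3) ℂ) ∈ Matrix.unitaryGroup (Fin 3) ℂ :=
    smul_one_mem_unitaryGroup (by rw [Complex.conj_conj, mul_comm, hphase])
  have hw' : IsSpecialLegendrianImmersion 0 fun p => matAct (conj (phase θ) • 1) (w p) := by
    refine hw.matAct hB ?_
    rw [det_smul_one, Complex.ofReal_zero, zero_mul, Complex.exp_zero, one_mul]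
    calc conj (phase θ) ^ 3
        = Complex.exp (θ * I) * phase θ ^ 3 * conj (phase θ) ^ 3 := by rw [phase_cube, one_mul]
      _ = Complex.exp (θ * I) * (conj (phase θ) * phase θ) ^ 3 := by ring
      _ = Complex.exp (θ * I) := by rw [hphase, one_pow, mul_one]
  obtain ⟨α, hα, J, hJ, B, hBu, hBd, φ, hφ, hwφ⟩ :=
    exists_eq_matAct_sweep hw' (hA.matAct hB) (ht.matAct _)
  refine ⟨α, hα, J, hJ, B, hBu, hBd, φ, hφ, fun p => ?_⟩
  calc w p = phase θ • conj (phase θ) • w p := by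
        rw [smul_smul, mul_comm, hphase, one_smul]
    _ = phase θ • matAct B (sweep α (profile α J) (φ p)) := by
        rw [← hwφ, matAct_smul_one]
    _ = matAct B (legendrianFamily θ α J (φ p)) := by
        rw [legendrianFamily, ← matAct_mul, ← matAct_smul_one, ← matAct_mul]
        simp

end Classification

theorem theorem4 (θ : ℝ) :
    ∃ u : ℝ → ℝ → ℝ × ℝ → C3,
      -- a family of conformal `θ`-special Legendrian immersions, invariant under `exp (σ A)`,
      -- in which `J` is the angular momentum parameter
      (∀ α ∈ Set.Icc (0 : ℝ) 1, ∀ J ∈ Set.Icc (0 : ℝ) maxJ,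
        IsSpecialLegendrianImmersion θ (u α J) ∧
        IsInvariantUnder (generator α) (u α J) ∧
        IsConformalParam (u α J) ∧
        HasAngularMomenta (u α J) (fun j => J * momentVector α j)) ∧
      -- for `α = 1` or maximal `J` the surface is a generalized Clifford torus
      (∀ α ∈ Set.Icc (0 : ℝ) 1, ∀ J ∈ Set.Icc (0 : ℝ) maxJ, α = 1 ∨ J = maxJ →
        ∃ φ : ℝ, ∃ B ∈ Matrix.specialUnitaryGroup (Fin 3) ℂ,
          Set.range (u α J) = matAct B '' cliffordTorus φ) ∧
      -- otherwise the surfaces are pairwise non-congruent, and not congruent to the former ones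
      (∀ α ∈ Set.Icc (0 : ℝ) 1, ∀ J ∈ Set.Icc (0 : ℝ) maxJ,
        ∀ α' ∈ Set.Icc (0 : ℝ) 1, ∀ J' ∈ Set.Icc (0 : ℝ) maxJ,
          ¬ (α = 1 ∨ J = maxJ) → (α, J) ≠ (α', J') →
            ¬ AreCongruent (u α J) (u α' J')) ∧
      -- every equivariant `θ`-special Legendrian immersion which covers a torus is in the family
      (∀ w : ℝ × ℝ → C3, IsSpecialLegendrianImmersion θ w → IsEquivariantForm w → CoversTorus w →
        ∃ α ∈ Set.Icc (0 : ℝ) 1, ∃ J ∈ Set.Icc (0 : ℝ) maxJ,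
          ∃ B ∈ Matrix.unitaryGroup (Fin 3) ℂ, (B.det = 1 ∨ B.det = -1) ∧
            ∃ φ : ℝ × ℝ ≃ ℝ × ℝ, IsPlaneDiffeo φ ∧
              ∀ p, w p = matAct B (u α J (φ p))) :=
  ⟨legendrianFamily θ,
    fun α hα J hJ => ⟨isSpecialLegendrianImmersion_legendrianFamily θ hα hJ,
      isInvariantUnder_legendrianFamily θ α J, isConformalParam_legendrianFamily θ hα hJ,
      hasAngularMomenta_legendrianFamily θ hα hJ⟩,
    fun _ hα _ hJ h => exists_range_legendrianFamily_eq θ hα hJ h,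
    fun _ hα _ hJ _ hα' _ hJ' h hne => not_areCongruent θ hα hJ hα' hJ' h hne,
    fun _ hw hA ht => exists_eq_legendrianFamily hw hA ht⟩
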